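/- **Setting.** Let $r\ge 0$, $p_0\ge p_1\ge\dots\ge p_r\ge 1$ be integers, $d=p_0+\dots+p_r$, and let $B$ be a constant real $d\times d$ matrix, written in blocks of sizes $p_0,\dots,p_r$, whose only possibly non-zero blocks are those immediately below the diagonal: the block in position $(j,j-1)$ is a $p_j\times p_{j-1}$ matrix of rank $p_j$, $j=1,\dots,r$. Put $\sigma_i=2j+1$ if the $i$-th coordinate belongs to block $j\in\{0,\dots,r\}$, and $|\beta|_B=\sum_i\sigma_i\beta_i$ for $\beta\in\mathbb N_0^d$. Let $Y=\langle Bx,\nabla_x\rangle+\partial_t$, i.e. $Yf(t,x)=\frac{d}{d\delta}f(t+\delta,e^{\delta B}x)|_{\delta=0}$. For a vector field $Z$ with flow $e^{\delta Z}$ and formal degree $m_Z$ ($m_Y=2$, $m_{\partial_{x_i}}=1$ for $i\le p_0$) put $\|u\|_{C^\alpha_Z}=\sup|u|+\sup_{z,\,\delta\ne0}|u(e^{\delta Z}z)-u(z)|\,|\delta|^{-\alpha/m_Z}$, and define the intrinsic Hölder spaces on $\mathbb R\times\mathbb R^d$ by $\|u\|_{C^{0,\alpha}_B}=\|u\|_{C^\alpha_Y}+\sum_{i\le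 p_0}\|u\|_{C^\alpha_{\partial_{x_i}}}$, $\|u\|_{C^{1,\alpha}_B}=\|u\|_{C^{1+\alpha}_Y}+\sum_{i\le p_0}\|\partial_{x_i}u\|_{C^{0,\alpha}_B}$, $\|u\|_{C^{n,\alpha}_B}=\|Yu\|_{C^{n-2,\alpha}_B}+\sum_{i\le p_0}\|\partial_{x_i}u\|_{C^{n-1,\alpha}_B}$ for $n\ge2$ (the derivatives being required to exist and the norms to be finite). Let $N\in\mathbb N_0$, $T>0$, and let $a_{ij}=a_{ji}$, $a_i$ ($1\le i,j\le p_0$) be functions on $\mathbb R\times\mathbb R^d$ such that, for some $M,\mu>0$, $\mu M|\xi|^2<\sum_{i,j}a_{ij}(t,x)\xi_i\xi_j<M|\xi|^2$ for all $(t,x)$ and all $\xi\in\mathbb R^{p_0}\setminus\{0\}$, and $a_{ij},a_i\in C^{N,1}_B$ with $C^{N,1}_B$-norms at most $M$. For $f\in C_B^{N,1}$, $n\le N$ and $\zeta=(s,\xi)$ let $$\mathbf T_n(f,\zeta)(t,x)=\sum_{2k+|\beta|_B\le n}\frac{1}{k!\,\beta!}\,Y^k\partial^\beta_\xi f(s,\xi)\,(t-s)^k\,(x-e^{(t-s)B}\xi)^\beta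 ,\qquad \mathbf T_{-1}(f,\zeta)\equiv0 .$$ Fix $\bar z\in\mathbb R\times\mathbb R^d$ and put, for $0\le n\le N$, $$\mathcal K_n^{(\bar z)}=\tfrac12\sum_{i,j=1}^{p_0}\mathbf T_n(a_{ij},\bar z)\,\partial_{x_ix_j}+\sum_{i=1}^{p_0}\mathbf T_{n-1}(a_i,\bar z)\,\partial_{x_i}+Y .$$ Let $\varphi:\mathbb R^d\to\mathbb R$ be continuous with $|\varphi(x)|\le Ce^{C|x|}$ for some $C$. The functions $u_0^{(\bar z)},\dots,u_N^{(\bar z)}$ are the solutions of the nested Cauchy problems $$\mathcal K_0^{(\bar z)}u_0^{(\bar z)}=0\ \text{ on }[0,T[\times\mathbb R^d,\qquad u_0^{(\bar z)}(T,\cdot)=\varphi,$$ $$\mathcal K_0^{(\bar z)}u_n^{(\bar z)}=-\sum_{h=1}^n\big(\mathcal K_h^{(\bar z)}-\mathcal K_{h-1}^{(\bar z)}\big)u_{n-h}^{(\bar z)}\ \text{ on }[0,T[\times\mathbb R^d,\qquad u_n^{(\bar z)}(T,\cdot)=0\qquad(1\le n\le N),$$ in the class of functions $u$ that are continuous on $[0,T]\times\mathbb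 R^d$, have on $[0,T[\times\mathbb R^d$ continuous derivatives $\partial_{x_i}u,\partial_{x_ix_j}u$ ($i,j\le p_0$) and a Lie derivative $Yu$ (one-sided at $t=0$), and satisfy $|u(t,x)|\le Ce^{C|x|^2}$ for some $C$. **Operators.** With $A(\bar z)$ the $d\times d$ matrix whose upper left $p_0\times p_0$ block is $(a_{ij}(\bar z))$ and whose other entries are $0$, let $\mathbf C_{\bar z}(t)=\int_0^te^{sB}A(\bar z)e^{sB^*}ds$, $\mathbf M_{\bar z}(t)=e^{-tB}\mathbf C_{\bar z}(t)e^{-tB^*}$ and $\mathcal M^{(\bar z)}(t,x)=e^{tB}\big(x+\mathbf M_{\bar z}(t)\nabla_x\big)$, a vector of first order operators whose components commute on smooth functions. For $n\ge1$ let $$\mathcal G_n^{(\bar z)}(t,s,x)=\tfrac12\sum_{i,j=1}^{p_0}\big(\mathbf T_n(a_{ij},\bar z)-\mathbf T_{n-1}(a_{ij},\bar z)\big)\big(s,\mathcal M^{(\bar z)}(s-t,x)\big)\big(e^{-(s-t)B^*}\nabla_x\big)_i\big(e^{-(s-t)B^*}\nabla_x\big)_j$$ $$\qquad+\sum_{i=1}^{p_0}\big(\mathbf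 T_{n-1}(a_i,\bar z)-\mathbf T_{n-2}(a_i,\bar z)\big)\big(s,\mathcal M^{(\bar z)}(s-t,x)\big)\big(e^{-(s-t)B^*}\nabla_x\big)_i ,$$ $$\mathcal L_n^{(\bar z)}(t,T,x)=\sum_{h=1}^n\int_t^Tds_1\int_{s_1}^Tds_2\cdots\int_{s_{h-1}}^Tds_h\sum_{i\in I_{n,h}}\mathcal G^{(\bar z)}_{i_1}(t,s_1,x)\cdots\mathcal G^{(\bar z)}_{i_h}(t,s_h,x),$$ where $I_{n,h}=\{i\in\mathbb N^h: i_j\ge1,\ i_1+\dots+i_h=n\}$. **Theorem.** The nested Cauchy problems have a solution $(u_0^{(\bar z)},\dots,u_N^{(\bar z)})$ in the above class, and every such solution satisfies: $u_0^{(\bar z)}(t,\cdot)$ is $C^\infty$ for every $t\in[0,T[$, and for every $1\le n\le N$ $$u_n^{(\bar z)}(t,x)=\mathcal L_n^{(\bar z)}(t,T,x)\,u_0^{(\bar z)}(t,x),\qquad (t,x)\in[0,T[\times\mathbb R^d ,$$ where, for each $h$, $i\in I_{n,h}$ and $(t,x)$, the integrand $\mathcal G^{(\bar z)}_{i_1}(t,s_1,x)\cdots\mathcal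 G^{(\bar z)}_{i_h}(t,s_h,x)u_0^{(\bar z)}(t,x)$ is a continuous function of $(s_1,\dots,s_h)\in\mathbb R^h$. -/

import Mathlib

open Set
open scoped ENNReal ContDiff Matrix

noncomputable section

/-! ### The space `ℝ^d`, `d = p 0 + ⋯ + p r`, with its coordinates arranged in blocks -/

/-- Coordinate indices of `ℝ^d`: the pair `⟨j, a⟩` is the `a`-th coordinate of the `j`-th block. -/
abbrev Idx {r : ℕ} (p : Fin (r + 1) → ℕ) : Type := Σ j : Fin (r + 1), Fin (p j)

/-- The space `ℝ^d`. -/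
abbrev Sp {r : ℕ} (p : Fin (r + 1) → ℕ) : Type := Idx p → ℝ

variable {r : ℕ} {p : Fin (r + 1) → ℕ}

/-- One of the first `p 0` coordinates, seen as a coordinate of `ℝ^d`. -/
abbrev fst₀ (i : Fin (p 0)) : Idx p := ⟨0, i⟩

/-- All coordinates in their natural order. -/
def idxList (p : Fin (r + 1) → ℕ) : List (Idx p) :=
  (List.finRange (r + 1)).flatMap fun j => (List.finRange (p j)).map fun a => ⟨j, a⟩

/-- The homogeneity exponents: `1` on block `0`, `3` on block `1`, `5` on block `2`, … -/
def sig (i : Idx p) : ℕ := 2 * (i.1 : ℕ) + 1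

/-- The `B`-length of a multi-index. -/
def lenB (β : Idx p → ℕ) : ℕ := ∑ i, sig i * β i

/-! ### Derivatives -/

/-- The partial derivative `∂_{x_i} g (x)`. -/
def pd (i : Idx p) (g : Sp p → ℝ) (x : Sp p) : ℝ := lineDeriv ℝ g x (Pi.single i 1)

/-- The spatial partial derivative of a function of `z = (t, x)`. -/
def dx (i : Idx p) (f : ℝ × Sp p → ℝ) (z : ℝ × Sp p) : ℝ := pd i (fun y => f (z.1, y)) z.2

/-- Existence of the spatial partial derivative at `z`. -/
def DxDiff (i : Idx p) (f : ℝ × Sp p → ℝ) (z : ℝ × Sp p) : Prop :=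
  LineDifferentiableAt ℝ (fun y => f (z.1, y)) z.2 (Pi.single i 1)

/-- The iterated spatial derivative `∂_x^β`. -/
def dxPow (β : Idx p → ℕ) (f : ℝ × Sp p → ℝ) : ℝ × Sp p → ℝ :=
  (idxList p).foldr (fun i g => (dx i)^[β i] g) f

/-- The matrix `e^{tB}`. -/
def expB (B : Matrix (Idx p) (Idx p) ℝ) (t : ℝ) : Matrix (Idx p) (Idx p) ℝ :=
  NormedSpace.exp (t • B)

/-- `f` along the integral curve of `Y = ⟨Bx, ∇⟩ + ∂_t` through `z`, parametrized by time. -/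
def alongY (B : Matrix (Idx p) (Idx p) ℝ) (f : ℝ × Sp p → ℝ) (z : ℝ × Sp p) (τ : ℝ) : ℝ :=
  f (τ, expB B (τ - z.1) *ᵥ z.2)

/-- The Lie derivative `Y f (z)`, the times being restricted to the set `S`
(`S = univ` for functions on the whole of `ℝ × ℝ^d`; `S = [0, ∞)` for functions
on `[0, T[ × ℝ^d`, for which it is one-sided at time `0` only). -/
def lieY (B : Matrix (Idx p) (Idx p) ℝ) (S : Set ℝ) (f : ℝ × Sp p → ℝ) (z : ℝ × Sp p) : ℝ :=
  derivWithin (alongY B f z) S z.1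

/-- Existence of the Lie derivative along `Y` at `z`. -/
def YDiff (B : Matrix (Idx p) (Idx p) ℝ) (S : Set ℝ) (f : ℝ × Sp p → ℝ) (z : ℝ × Sp p) : Prop :=
  DifferentiableWithinAt ℝ (alongY B f z) S z.1

/-! ### Intrinsic Hölder spaces -/

/-- The integral curves of `∂_{x_i}`. -/
def flowX (i : Idx p) (δ : ℝ) (z : ℝ × Sp p) : ℝ × Sp p := (z.1, z.2 + δ • Pi.single i 1)

/-- The integral curves of `Y`. -/
def flowY (B : Matrix (Idx p) (Idx p) ℝ) (δ : ℝ) (z : ℝ × Sp p) : ℝ × Sp p :=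
  (z.1 + δ, expB B δ *ᵥ z.2)

/-- The norm of `C^α_Z` for a vector field `Z` with flow `Φ` and formal degree `m`. -/
def flowNorm (Φ : ℝ → ℝ × Sp p → ℝ × Sp p) (m α : ℝ) (u : ℝ × Sp p → ℝ) : ℝ≥0∞ :=
  (⨆ z, ‖u z‖ₑ) +
    ⨆ (δ : ℝ) (_ : δ ≠ 0) (z : ℝ × Sp p), ‖u (Φ δ z) - u z‖ₑ / ENNReal.ofReal (|δ| ^ (α / m))

/-- The norm of `C^{n,α}_B`. -/
def holderNorm (B : Matrix (Idx p) (Idx p) ℝ) (α : ℝ) : ℕ → (ℝ × Sp p → ℝ) → ℝ≥0∞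
  | 0, u => flowNorm (flowY B) 2 α u + ∑ i : Fin (p 0), flowNorm (flowX (fst₀ i)) 1 α u
  | 1, u => flowNorm (flowY B) 2 (1 + α) u +
      ∑ i : Fin (p 0), holderNorm B α 0 (dx (fst₀ i) u)
  | n + 2, u => holderNorm B α n (lieY B univ u) +
      ∑ i : Fin (p 0), holderNorm B α (n + 1) (dx (fst₀ i) u)

/-- Membership in `C^{n,α}_B`. -/
def InHolderB (B : Matrix (Idx p) (Idx p) ℝ) (α : ℝ) : ℕ → (ℝ × Sp p → ℝ) → Prop
  | 0, u => flowNorm (flowY B) 2 α u < ⊤ ∧ ∀ i : Fin (p 0), flowNorm (flowX (fst₀ i)) 1 α u < ⊤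
  | 1, u => flowNorm (flowY B) 2 (1 + α) u < ⊤ ∧
      ∀ i : Fin (p 0), (∀ z, DxDiff (fst₀ i) u z) ∧ InHolderB B α 0 (dx (fst₀ i) u)
  | n + 2, u => ((∀ z, YDiff B univ u z) ∧ InHolderB B α n (lieY B univ u)) ∧
      ∀ i : Fin (p 0), (∀ z, DxDiff (fst₀ i) u z) ∧ InHolderB B α (n + 1) (dx (fst₀ i) u)

/-! ### The operator `𝒦 = ½ ∑ a_{ij} ∂_{ij} + ∑ a_i ∂_i + Y` and its assumptions -/

/-- Coefficients of the Kolmogorov operator: `a₂ i j` is `a_{ij}`, `a₁ i` is `a_i`. -/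
structure KolmogorovOp {r : ℕ} (p : Fin (r + 1) → ℕ) where
  a₂ : Fin (p 0) → Fin (p 0) → ℝ × Sp p → ℝ
  a₁ : Fin (p 0) → ℝ × Sp p → ℝ
  B : Matrix (Idx p) (Idx p) ℝ

namespace KolmogorovOp

/-- The matrix `(a_{ij})` is symmetric and uniformly positive definite, with bounds `μM` and `M`. -/
structure NonDegenerate (K : KolmogorovOp p) (μ M : ℝ) : Prop where
  pos_μ : 0 < μ
  pos_M : 0 < M
  symm : ∀ i j z, K.a₂ i j z = K.a₂ j i z
  lower : ∀ z (ξ : Fin (p 0) → ℝ), ξ ≠ 0 → μ * M * ∑ i, ξ i ^ 2 < ∑ i, ∑ j, K.a₂ i j z * ξ i * ξ j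
  upper : ∀ z (ξ : Fin (p 0) → ℝ), ξ ≠ 0 → ∑ i, ∑ j, K.a₂ i j z * ξ i * ξ j < M * ∑ i, ξ i ^ 2

/-- `B` has blocks `B_j` of size `p j × p (j-1)` and rank `p j` below the diagonal, and is zero
elsewhere; `p 0 ≥ p 1 ≥ ⋯ ≥ p r ≥ 1`. -/
structure BlockStructure (K : KolmogorovOp p) : Prop where
  anti : Antitone p
  one_le : ∀ j, 1 ≤ p j
  zero : ∀ k l : Idx p, (k.1 : ℕ) ≠ (l.1 : ℕ) + 1 → K.B k l = 0
  rank : ∀ j : Fin r,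
    (Matrix.of fun (a : Fin (p j.succ)) (b : Fin (p j.castSucc)) =>
      K.B ⟨j.succ, a⟩ ⟨j.castSucc, b⟩).rank = p j.succ

/-- The coefficients belong to `C^{N,1}_B`, with norms at most `M`. -/
structure Regular (K : KolmogorovOp p) (N : ℕ) (M : ℝ) : Prop where
  mem₂ : ∀ i j, InHolderB K.B 1 N (K.a₂ i j)
  mem₁ : ∀ i, InHolderB K.B 1 N (K.a₁ i)
  le₂ : ∀ i j, holderNorm K.B 1 N (K.a₂ i j) ≤ ENNReal.ofReal M
  le₁ : ∀ i, holderNorm K.B 1 N (K.a₁ i) ≤ ENNReal.ofReal M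

/-! ### Intrinsic Taylor polynomials and the approximating operators -/

/-- The intrinsic Taylor polynomial `𝐓_n(f, ζ)(t, ·)`, as a polynomial in the `d` space variables.
It is zero for negative `n`. -/
def taylorPoly (K : KolmogorovOp p) (n : ℤ) (f : ℝ × Sp p → ℝ) (ζ : ℝ × Sp p) (t : ℝ) :
    MvPolynomial (Idx p) ℝ :=
  ∑ q ∈ (Finset.range (n.toNat + 1) ×ˢ
      Fintype.piFinset fun _ : Idx p => Finset.range (n.toNat + 1)).filter
        (fun q => 2 * (q.1 : ℤ) + (lenB q.2 : ℤ) ≤ n),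
    MvPolynomial.C ((1 / ((q.1.factorial : ℝ) * ∏ i, ((q.2 i).factorial : ℝ))) *
        ((lieY K.B univ)^[q.1] (dxPow q.2 f)) ζ * (t - ζ.1) ^ q.1) *
      ∏ i, (MvPolynomial.X i - MvPolynomial.C ((expB K.B (t - ζ.1) *ᵥ ζ.2) i)) ^ q.2 i

/-- The operator `𝒦_n^{(ζ)}`, acting on functions on `[0, T[ × ℝ^d`. -/
def approx (K : KolmogorovOp p) (ζ : ℝ × Sp p) (n : ℤ) (u : ℝ × Sp p → ℝ) (z : ℝ × Sp p) : ℝ :=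
  1 / 2 * ∑ i, ∑ j, (K.taylorPoly n (K.a₂ i j) ζ z.1).eval z.2 * dx (fst₀ i) (dx (fst₀ j) u) z
    + ∑ i, (K.taylorPoly (n - 1) (K.a₁ i) ζ z.1).eval z.2 * dx (fst₀ i) u z
    + lieY K.B (Ici 0) u z

/-- Classical solutions on `[0, T] × ℝ^d` that are not rapidly increasing: the derivatives which
appear in the operator exist on `[0, T[ × ℝ^d`, those in space being continuous, the function is
continuous up to time `T`, and it grows at most like `C e^{C|x|²}`. -/
structure Admissible (K : KolmogorovOp p) (T : ℝ) (u : ℝ × Sp p → ℝ) : Prop where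
  cont : ContinuousOn u (Icc 0 T ×ˢ univ)
  diff₁ : ∀ i : Fin (p 0), ∀ z ∈ Ico 0 T ×ˢ univ, DxDiff (fst₀ i) u z
  cont₁ : ∀ i : Fin (p 0), ContinuousOn (dx (fst₀ i) u) (Ico 0 T ×ˢ univ)
  diff₂ : ∀ i j : Fin (p 0), ∀ z ∈ Ico 0 T ×ˢ univ, DxDiff (fst₀ i) (dx (fst₀ j) u) z
  cont₂ : ∀ i j : Fin (p 0), ContinuousOn (dx (fst₀ i) (dx (fst₀ j) u)) (Ico 0 T ×ˢ univ)
  diffY : ∀ z ∈ Ico 0 T ×ˢ univ, YDiff K.B (Ici 0) u z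
  growth : ∃ C : ℝ, ∀ t ∈ Icc 0 T, ∀ x, |u (t, x)| ≤ C * Real.exp (C * ‖x‖ ^ 2)

/-- `u 0, …, u N` solve the nested Cauchy problems with final datum `φ`. -/
structure IsExpansion (K : KolmogorovOp p) (ζ : ℝ × Sp p) (T : ℝ) (N : ℕ) (φ : Sp p → ℝ)
    (u : ℕ → ℝ × Sp p → ℝ) : Prop where
  admissible : ∀ n ≤ N, K.Admissible T (u n)
  eq_zero : ∀ z ∈ Ico 0 T ×ˢ univ, K.approx ζ 0 (u 0) z = 0
  final_zero : ∀ x, u 0 (T, x) = φ x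
  eq : ∀ n, 1 ≤ n → n ≤ N → ∀ z ∈ Ico 0 T ×ˢ univ,
    K.approx ζ 0 (u n) z =
      -∑ h ∈ Finset.Icc 1 n, (K.approx ζ h (u (n - h)) z - K.approx ζ ((h : ℤ) - 1) (u (n - h)) z)
  final : ∀ n, 1 ≤ n → n ≤ N → ∀ x, u n (T, x) = 0

/-! ### The operators `ℳ`, `𝒢_n` and `ℒ_n`, acting on functions of `x` -/

/-- The `d × d` matrix `A(ζ)` with upper left block `(a_{ij}(ζ))` and zeros elsewhere. -/
def matA (K : KolmogorovOp p) (ζ : ℝ × Sp p) : Matrix (Idx p) (Idx p) ℝ :=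
  ∑ i, ∑ j, Matrix.single (fst₀ i) (fst₀ j) (K.a₂ i j ζ)

/-- The covariance matrix `∫_0^t e^{sB} A(ζ) e^{sB*} ds`. -/
def covC (K : KolmogorovOp p) (ζ : ℝ × Sp p) (t : ℝ) : Matrix (Idx p) (Idx p) ℝ :=
  Matrix.of fun k l => ∫ s in (0 : ℝ)..t, (expB K.B s * K.matA ζ * expB K.Bᵀ s) k l

/-- The matrix `e^{-tB} C(t) e^{-tB*}`. -/
def matM (K : KolmogorovOp p) (ζ : ℝ × Sp p) (t : ℝ) : Matrix (Idx p) (Idx p) ℝ :=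
  expB K.B (-t) * K.covC ζ t * expB K.Bᵀ (-t)

/-- The `k`-th component of the operator `ℳ(t, x) = e^{tB} (x + M(t) ∇_x)`. -/
def opM (K : KolmogorovOp p) (ζ : ℝ × Sp p) (t : ℝ) (k : Idx p) (f : Sp p → ℝ) (x : Sp p) : ℝ :=
  ∑ l, expB K.B t k l * (x l * f x + ∑ m, K.matM ζ t l m * pd m f x)

/-- The `k`-th component of the operator `e^{-tB*} ∇_x`. -/
def opW (K : KolmogorovOp p) (t : ℝ) (k : Idx p) (f : Sp p → ℝ) (x : Sp p) : ℝ :=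
  ∑ l, expB K.Bᵀ (-t) k l * pd l f x

/-- The value `P(O)` of a polynomial at a vector of operators. The components of `ℳ(t, x)`, to
which it is applied, commute on smooth functions, so that the order of the factors, here
the order of the coordinates, is immaterial. -/
def opEval (P : MvPolynomial (Idx p) ℝ) (O : Idx p → (Sp p → ℝ) → (Sp p → ℝ)) (f : Sp p → ℝ)
    (x : Sp p) : ℝ :=
  ∑ β ∈ P.support, P.coeff β * (idxList p).foldr (fun k g => (O k)^[β k] g) f x

/-- The operator `𝒢_n(t, s, x)`. -/
def opG (K : KolmogorovOp p) (ζ : ℝ × Sp p) (n : ℕ) (t s : ℝ) (f : Sp p → ℝ) (x : Sp p) : ℝ :=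
  1 / 2 * ∑ i, ∑ j,
      opEval (K.taylorPoly n (K.a₂ i j) ζ s - K.taylorPoly ((n : ℤ) - 1) (K.a₂ i j) ζ s)
        (K.opM ζ (s - t)) (K.opW (s - t) (fst₀ i) (K.opW (s - t) (fst₀ j) f)) x
    + ∑ i,
      opEval (K.taylorPoly ((n : ℤ) - 1) (K.a₁ i) ζ s - K.taylorPoly ((n : ℤ) - 2) (K.a₁ i) ζ s)
        (K.opM ζ (s - t)) (K.opW (s - t) (fst₀ i) f) x

/-- The product `𝒢_{i_1}(t, s_1, x) ⋯ 𝒢_{i_h}(t, s_h, x)`. -/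
def prodG (K : KolmogorovOp p) (ζ : ℝ × Sp p) (t : ℝ) {h : ℕ} (i : Fin h → ℕ) (s : Fin h → ℝ)
    (f : Sp p → ℝ) : Sp p → ℝ :=
  (List.ofFn fun k => K.opG ζ (i k) t (s k)).foldr (fun O g => O g) f

/-- `∫_t^T ds_1 ∫_{s_1}^T ds_2 ⋯ ∫_{s_{h-1}}^T ds_h F(s_1, …, s_h)`. -/
def nestedIntegral (T : ℝ) : (h : ℕ) → ℝ → ((Fin h → ℝ) → ℝ) → ℝ
  | 0, _, F => F Fin.elim0
  | h + 1, t, F => ∫ s in t..T, nestedIntegral T h s fun v => F (Fin.cons s v)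

/-- The set `I_{n,h}` of the `i ∈ {1, 2, …}^h` with `i_1 + ⋯ + i_h = n`. -/
def compIdx (n h : ℕ) : Finset (Fin h → ℕ) :=
  (Fintype.piFinset fun _ : Fin h => Finset.Icc 1 n).filter fun i => ∑ k, i k = n

/-- The operator `ℒ_n(t, T, x)`. -/
def opL (K : KolmogorovOp p) (ζ : ℝ × Sp p) (n : ℕ) (t T : ℝ) (f : Sp p → ℝ) (x : Sp p) : ℝ :=
  ∑ h ∈ Finset.Icc 1 n,
    nestedIntegral T h t fun s => ∑ i ∈ compIdx n h, K.prodG ζ t i s f x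

end KolmogorovOp

end

open MeasureTheory

noncomputable section

variable {r : ℕ} {p : Fin (r + 1) → ℕ}

/-! ### The group e^{tB} and its homogeneity under block dilations. -/

section ExpB

variable (B : Matrix (Idx p) (Idx p) ℝ)

/-! Put τ = T - t, θ = -log τ and y = e^{τB}x. Along an integral curve of Y the point y is constant,
so τ𝒦_0 becomes the heat operator ∂_θ - ½ ∑ Q'_{kl}(θ) ∂_{y_k}∂_{y_l} with Q(θ) = C(e^{-θ})
(`heat`). Its coefficients depend on θ only, hence it commutes with ∂_y and with the constants of
motion y + Q∇_y (`heat_dy`, `heat_opX`).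

The cocycle identity C(τ) = C(T-s) + e^{(T-s)B} C(s-t) e^{(T-s)B*} turns ℳ(s-t,x) into e^{-(T-s)B}(y
+ Q∇_y - C(T-s)∇_y) and e^{-(s-t)B*}∇_x into a combination of the ∂_y with coefficients in T-s
(`slice_heatM`, `slice_heatW`). So in these variables 𝒢_n(t,s,x) is an operator `heatG` in whose
expression t no longer occurs, and which maps solutions of the heat equation to solutions.
Differentiating ℒ_n u_0 along Y therefore sees only the lower limits of integration, besides the
heat equation itself, and gives -∑_m 𝒢_m(t,t,x) ℒ_{n-m} u_0 with ℒ_0 = 1 (`hasDerivAt_heatV`). Since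
ℳ(0,x) is multiplication by x, 𝒢_m(t,t,x) = 𝒦_m - 𝒦_{m-1} (`smG_self`), and the nested equations
follow (`approx_zero_sol`).

The function u_0 is a Gaussian integral. By homogeneity its kernel is a fixed Gaussian density in z
= e^{θ·hw}(w - y), where hw is half of the homogeneity exponent. Derivatives and multiplications by
coordinates act on polynomial factors in (w, z), the symbols. With T - t = ε² and T - s = ρε², the
operator ε²𝒢_n acts on symbols with coefficients continuous up to ε = 0, so h factors 𝒢 cost at most
(T-t)^{-h} (`exists_prodG_le`), and the h-fold integral over [t,T] restores (T-t)^h. As 𝒢 kills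
constants, φ may be replaced by φ - φ(x_0), whose Gaussian integrals tend to 0 as (t,x) → (T,x_0).
This gives the final values and the growth bounds (`exists_sol_le`).

Uniqueness is a maximum principle for 𝒦_0, proved with a Gaussian barrier on short time intervals
(`IsSubsolution.step`). Smoothness in y-derivatives is not available for an arbitrary solution: only
lines in the first p_0 directions and the curves of Y are used.

No topology is put on operators: every family depending on times is of finite rank, ∑ c_j(s) O_j
with continuous scalars c_j (`sep`), so continuity, integration and compactness bounds reduce to the
c_j. -/

theorem expB_add (s t : ℝ) : expB B (s + t) = expB B s * expB B t := by
  unfold expB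
  rw [add_smul]
  exact Matrix.exp_add_of_commute _ _ ((Commute.refl B).smul_left s |>.smul_right t)

@[simp] theorem expB_zero : expB B 0 = 1 := by
  simp [expB]

theorem expB_mul_neg (t : ℝ) : expB B t * expB B (-t) = 1 := by
  rw [← expB_add, add_neg_cancel, expB_zero]

theorem expB_neg_mul (t : ℝ) : expB B (-t) * expB B t = 1 := by
  rw [← expB_add, neg_add_cancel, expB_zero]

theorem expB_transpose (t : ℝ) : expB Bᵀ t = (expB B t)ᵀ := by
  rw [expB, expB, ← Matrix.exp_transpose, Matrix.transpose_smul]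

theorem hasDerivAt_expB (t : ℝ) (k l : Idx p) :
    HasDerivAt (fun s => expB B s k l) ((B * expB B t) k l) t := by
  let _ : NormedRing (Matrix (Idx p) (Idx p) ℝ) := Matrix.linftyOpNormedRing
  let _ : NormedAlgebra ℝ (Matrix (Idx p) (Idx p) ℝ) := Matrix.linftyOpNormedAlgebra
  have h : HasDerivAt (fun s : ℝ => expB B s) (B * expB B t) t :=
    hasDerivAt_exp_smul_const' (𝕂 := ℝ) B t
  exact (hasDerivAt_pi.1 ((hasDerivAt_pi.1 h) k)) l

theorem hasDerivAt_expB_mulVec (v : Sp p) (t : ℝ) :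
    HasDerivAt (fun s => expB B s *ᵥ v) (B *ᵥ (expB B t *ᵥ v)) t := by
  refine hasDerivAt_pi.2 fun k => ?_
  rw [Matrix.mulVec_mulVec]
  simp only [Matrix.mulVec, dotProduct]
  exact HasDerivAt.fun_sum fun l _ => (hasDerivAt_expB B t k l).mul_const (v l)

theorem contDiff_expB (k l : Idx p) : ContDiff ℝ ∞ fun s => expB B s k l := by
  rw [contDiff_infty]
  intro n
  induction n generalizing k l with
  | zero => exact contDiff_zero.2 (continuous_iff_continuousAt.2
      fun t => (hasDerivAt_expB B t k l).continuousAt)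
  | succ n ih =>
    push_cast
    refine contDiff_succ_iff_deriv.2 ⟨fun t => (hasDerivAt_expB B t k l).differentiableAt,
      fun h => absurd h (by simp), ?_⟩
    have : deriv (fun s => expB B s k l) = fun t => ∑ m, B k m * expB B t m l := by
      ext t
      rw [(hasDerivAt_expB B t k l).deriv, Matrix.mul_apply]
    rw [this]
    exact ContDiff.sum fun m _ => contDiff_const.mul (ih m l)

theorem continuous_expB_apply (k l : Idx p) : Continuous fun s => expB B s k l :=
  (contDiff_expB B k l).continuous

variable {B} (hB : ∀ k l : Idx p, (k.1 : ℕ) ≠ (l.1 : ℕ) + 1 → B k l = 0)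
include hB

/-- Since B raises the block index by exactly one, conjugation by D = diag(t^{block}) carries B to
tB, hence e^B to e^{tB}. -/
theorem expB_scaling (t : ℝ) (k l : Idx p) :
    expB B t k l * t ^ (l.1 : ℕ) = t ^ (k.1 : ℕ) * expB B 1 k l := by
  have key : ∀ t : ℝ, t ≠ 0 → expB B t k l * t ^ (l.1 : ℕ) = t ^ (k.1 : ℕ) * expB B 1 k l := by
    intro t ht
    set D : Matrix (Idx p) (Idx p) ℝ := Matrix.diagonal fun i => t ^ (i.1 : ℕ) with hD
    have hu : IsUnit D := by
      rw [Matrix.isUnit_iff_isUnit_det, hD, Matrix.det_diagonal]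
      exact (Finset.prod_ne_zero_iff.2 fun i _ => pow_ne_zero _ ht).isUnit
    have hdet : IsUnit D.det := (Matrix.isUnit_iff_isUnit_det _).1 hu
    have hc : (t • B) * D = D * B := by
      ext i j
      rw [hD, Matrix.mul_diagonal, Matrix.diagonal_mul, Matrix.smul_apply, smul_eq_mul]
      by_cases hij : (i.1 : ℕ) = (j.1 : ℕ) + 1
      · rw [hij]; ring
      · rw [hB i j hij]; ring
    have h1 : t • B = D * B * D⁻¹ := by
      rw [← hc, Matrix.mul_assoc, Matrix.mul_nonsing_inv _ hdet, Matrix.mul_one]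
    have h2 : expB B t * D = D * expB B 1 := by
      unfold expB
      rw [h1, Matrix.exp_conj D B hu, one_smul, Matrix.mul_assoc, Matrix.nonsing_inv_mul _ hdet,
        Matrix.mul_one]
    have := congrFun (congrFun h2 k) l
    rwa [hD, Matrix.mul_diagonal, Matrix.diagonal_mul] at this
  -- At t = 0 the matrix D may be singular; both sides being continuous, the identity extends from t
  -- ≠ 0 by density.
  have hcl : IsClosed {t : ℝ | expB B t k l * t ^ (l.1 : ℕ) = t ^ (k.1 : ℕ) * expB B 1 k l} :=
    isClosed_eq ((continuous_expB_apply B k l).mul (continuous_pow _))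
      ((continuous_pow _).mul continuous_const)
  have hd : Dense {t : ℝ | t ≠ 0} := dense_compl_singleton 0
  have := hcl.closure_subset_iff.2 (fun t (ht : t ∈ {t : ℝ | t ≠ 0}) => key t ht)
  exact this (hd t)

theorem expB_scaling_zero (t : ℝ) {k l : Idx p} (hl : (l.1 : ℕ) = 0) :
    expB B t k l = t ^ (k.1 : ℕ) * expB B 1 k l := by
  have := expB_scaling hB t k l
  rwa [hl, pow_zero, mul_one] at this

end ExpB

/-! ### The covariance matrix: cocycle identity, symmetry and homogeneity. -/

section Cov

variable (K : KolmogorovOp p) (ζ : ℝ × Sp p)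

theorem matA_apply_eq_zero {k l : Idx p} (h : (k.1 : ℕ) ≠ 0 ∨ (l.1 : ℕ) ≠ 0) :
    K.matA ζ k l = 0 := by
  simp only [KolmogorovOp.matA, Matrix.sum_apply]
  refine Finset.sum_eq_zero fun i _ => Finset.sum_eq_zero fun j _ => ?_
  rw [Matrix.single_apply, if_neg]
  rintro ⟨rfl, rfl⟩
  simp at h

theorem matA_apply_fst (i j : Fin (p 0)) : K.matA ζ (fst₀ i) (fst₀ j) = K.a₂ i j ζ := by
  simp only [KolmogorovOp.matA, Matrix.sum_apply]
  rw [Finset.sum_eq_single i, Finset.sum_eq_single j]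
  · simp
  · intro b _ hb
    rw [Matrix.single_apply, if_neg]
    rintro ⟨-, h⟩
    exact hb (by simpa [fst₀] using h)
  · simp
  · intro b _ hb
    refine Finset.sum_eq_zero fun j' _ => ?_
    rw [Matrix.single_apply, if_neg]
    rintro ⟨h, -⟩
    exact hb (by simpa [fst₀] using h)
  · simp

theorem sum_matA (F : Idx p → Idx p → ℝ) :
    ∑ k, ∑ l, K.matA ζ k l * F k l = ∑ i, ∑ j, K.a₂ i j ζ * F (fst₀ i) (fst₀ j) := by
  have h1 : ∀ G : Idx p → ℝ, (∀ k : Idx p, (k.1 : ℕ) ≠ 0 → G k = 0) →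
      ∑ k, G k = ∑ i : Fin (p 0), G (fst₀ i) := by
    intro G hG
    rw [Fintype.sum_sigma, Finset.sum_eq_single 0]
    · intro j _ hj
      exact Finset.sum_eq_zero fun i _ => hG ⟨j, i⟩ fun h => hj (Fin.ext h)
    · simp
  rw [h1]
  · refine Finset.sum_congr rfl fun i _ => ?_
    rw [h1]
    · simp only [matA_apply_fst]
    · intro l hl
      rw [matA_apply_eq_zero K ζ (Or.inr hl), zero_mul]
  · intro k hk
    exact Finset.sum_eq_zero fun l _ => by rw [matA_apply_eq_zero K ζ (Or.inl hk), zero_mul]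

/-- The density `e^{tB} A e^{tB*}` of the covariance matrix. -/
def covDensity (t : ℝ) : Matrix (Idx p) (Idx p) ℝ := expB K.B t * K.matA ζ * expB K.Bᵀ t

theorem covDensity_apply (t : ℝ) (k l : Idx p) :
    covDensity K ζ t k l =
      ∑ i, ∑ j, K.a₂ i j ζ * (expB K.B t k (fst₀ i) * expB K.B t l (fst₀ j)) := by
  rw [← sum_matA K ζ fun a b => expB K.B t k a * expB K.B t l b, covDensity, Matrix.mul_assoc,
    Matrix.mul_apply]
  refine Finset.sum_congr rfl fun a _ => ?_
  rw [Matrix.mul_apply, Finset.mul_sum]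
  refine Finset.sum_congr rfl fun b _ => ?_
  rw [expB_transpose, Matrix.transpose_apply]
  ring

theorem continuous_covDensity (k l : Idx p) : Continuous fun t => covDensity K ζ t k l := by
  simp only [covDensity_apply]
  have := continuous_expB_apply K.B
  fun_prop

theorem covC_apply (t : ℝ) (k l : Idx p) :
    K.covC ζ t k l = ∫ s in (0 : ℝ)..t, covDensity K ζ s k l := rfl

theorem hasDerivAt_covC (t : ℝ) (k l : Idx p) :
    HasDerivAt (fun s => K.covC ζ s k l) (covDensity K ζ t k l) t := by
  simp only [covC_apply]
  exact intervalIntegral.integral_hasDerivAt_right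
    ((continuous_covDensity K ζ k l).intervalIntegrable _ _)
    ((continuous_covDensity K ζ k l).stronglyMeasurableAtFilter _ _)
    (continuous_covDensity K ζ k l).continuousAt

@[simp] theorem covC_zero : K.covC ζ 0 = 0 := by
  ext k l; simp [covC_apply]

theorem continuous_covC_apply (k l : Idx p) : Continuous fun t => K.covC ζ t k l :=
  continuous_iff_continuousAt.2 fun t => (hasDerivAt_covC K ζ t k l).continuousAt

theorem covDensity_add (s t : ℝ) :
    covDensity K ζ (s + t) = expB K.B s * covDensity K ζ t * (expB K.B s)ᵀ := by
  rw [covDensity, covDensity, expB_transpose, expB_transpose, expB_add,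
    Matrix.transpose_mul]
  simp only [Matrix.mul_assoc]

/-- As functions of t the two sides have the same derivative, by the group law in `covDensity_add`,
and they agree at t = 0. This identity later separates the times t and s in ℳ(s - t, x). -/
theorem covC_add (s t : ℝ) :
    K.covC ζ (s + t) = K.covC ζ s + expB K.B s * K.covC ζ t * (expB K.B s)ᵀ := by
  ext k l
  have h1 : ∀ t, HasDerivAt (fun t => K.covC ζ (s + t) k l) (covDensity K ζ (s + t) k l) t :=
    fun t => by
      simpa using (hasDerivAt_covC K ζ (s + t) k l).comp_const_add s t
  have h2 : ∀ t, HasDerivAt (fun t => (K.covC ζ s + expB K.B s * K.covC ζ t * (expB K.B s)ᵀ) k l)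
      (covDensity K ζ (s + t) k l) t := by
    intro t
    rw [covDensity_add]
    simp only [Matrix.add_apply, Matrix.mul_apply]
    refine HasDerivAt.const_add _ (HasDerivAt.fun_sum fun b _ => HasDerivAt.mul_const
      (HasDerivAt.fun_sum fun a _ => HasDerivAt.const_mul _ (hasDerivAt_covC K ζ t a b)) _)
  have h3 : ∀ t, HasDerivAt (fun t => K.covC ζ (s + t) k l -
      (K.covC ζ s + expB K.B s * K.covC ζ t * (expB K.B s)ᵀ) k l) 0 t := fun t => by
    have := (h1 t).fun_sub (h2 t)
    rwa [sub_self] at this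
  have h4 := is_const_of_deriv_eq_zero (fun t => (h3 t).differentiableAt)
    (fun t => (h3 t).deriv) t 0
  simpa [sub_eq_zero] using h4

theorem covC_symm (hs : ∀ i j z, K.a₂ i j z = K.a₂ j i z) (t : ℝ) (k l : Idx p) :
    K.covC ζ t k l = K.covC ζ t l k := by
  simp only [covC_apply]
  congr 1
  ext s
  rw [covDensity_apply, covDensity_apply, Finset.sum_comm]
  refine Finset.sum_congr rfl fun i _ => Finset.sum_congr rfl fun j _ => ?_
  rw [hs j i]; ring

/-- Only columns of e^{sB} in block 0 enter the density, as A lives there; by `expB_scaling_zero`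
its (k, l) entry is homogeneous of degree the sum of the block indices, and the integration adds
one. -/
theorem covC_scaling (hB : ∀ k l : Idx p, (k.1 : ℕ) ≠ (l.1 : ℕ) + 1 → K.B k l = 0) (t : ℝ)
    (k l : Idx p) : K.covC ζ t k l = t ^ ((k.1 : ℕ) + l.1 + 1) * K.covC ζ 1 k l := by
  have h : ∀ s, covDensity K ζ s k l = s ^ ((k.1 : ℕ) + l.1) * covDensity K ζ 1 k l := by
    intro s
    simp only [covDensity_apply, Finset.mul_sum]
    refine Finset.sum_congr rfl fun i _ => Finset.sum_congr rfl fun j _ => ?_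
    rw [expB_scaling_zero hB s (k := k) (l := fst₀ i) rfl,
      expB_scaling_zero hB s (k := l) (l := fst₀ j) rfl]
    ring
  have h' : ∀ u, K.covC ζ u k l =
      ∫ s in (0 : ℝ)..u, s ^ ((k.1 : ℕ) + l.1) * covDensity K ζ 1 k l := fun u => by
    rw [covC_apply]
    exact intervalIntegral.integral_congr fun s _ => h s
  rw [h', h', intervalIntegral.integral_mul_const, intervalIntegral.integral_mul_const,
    integral_pow, integral_pow]
  rw [zero_pow (Nat.succ_ne_zero _), one_pow]
  ring

end Cov

/-! ### Positivity of the covariance from the rank condition. -/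

section Kalman

theorem vecMul_injective_of_rank {m n : ℕ} (A : Matrix (Fin m) (Fin n) ℝ) (h : A.rank = m)
    {v : Fin m → ℝ} (hv : ∀ b, ∑ a, A a b * v a = 0) : v = 0 := by
  have h1 : LinearIndependent ℝ A.row := by
    rw [linearIndependent_iff_card_eq_finrank_span, Set.finrank,
      ← Matrix.rank_eq_finrank_span_row, h, Fintype.card_fin]
  have h2 := Matrix.vecMul_injective_iff.2 h1
  apply h2
  show v ᵥ* A = 0 ᵥ* A
  rw [Matrix.zero_vecMul]
  ext b
  simpa [Matrix.vecMul, dotProduct, mul_comm] using hv b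

variable (K : KolmogorovOp p) (ζ : ℝ × Sp p)

/-- Vectors `v` such that `e^{sB*} v` has a vanishing first block for all `0 < s < 1`. -/
def Unobservable (v : Sp p) : Prop :=
  ∀ s ∈ Ioo (0 : ℝ) 1, ∀ i : Fin (p 0), ((expB K.B s)ᵀ *ᵥ v) (fst₀ i) = 0

variable {K}

theorem hasDerivAt_expB_transpose_mulVec (v : Sp p) (k : Idx p) (s : ℝ) :
    HasDerivAt (fun s => ((expB K.B s)ᵀ *ᵥ v) k) (((expB K.B s)ᵀ *ᵥ (K.Bᵀ *ᵥ v)) k) s := by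
  have := hasDerivAt_expB_mulVec K.Bᵀ v s
  simp only [expB_transpose] at this
  have h := hasDerivAt_pi.1 this k
  rw [Matrix.mulVec_mulVec] at h ⊢
  have hc : Commute K.Bᵀ (expB K.Bᵀ s) :=
    ((Commute.refl K.Bᵀ).smul_right s).exp_right
  rw [expB_transpose] at hc
  rwa [hc.eq] at h

/-- The first block of e^{sB*}v vanishes on an open interval, so its derivative, the first block of
e^{sB*}B*v, vanishes there too. -/
theorem Unobservable.transpose_mulVec {v : Sp p} (hv : Unobservable K v) :
    Unobservable K (K.Bᵀ *ᵥ v) := by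
  intro s hs i
  have h1 := hasDerivAt_expB_transpose_mulVec (K := K) v (fst₀ i) s
  have h2 : (fun s => ((expB K.B s)ᵀ *ᵥ v) (fst₀ i)) =ᶠ[nhds s] fun _ => 0 := by
    filter_upwards [isOpen_Ioo.mem_nhds hs] with u hu using hv u hu i
  exact h1.unique ((hasDerivAt_const s (0 : ℝ)).congr_of_eventuallyEq h2)

theorem Unobservable.fst_eq_zero {v : Sp p} (hv : Unobservable K v) (i : Fin (p 0)) :
    v (fst₀ i) = 0 := by
  have hc : Continuous fun s => ((expB K.B s)ᵀ *ᵥ v) (fst₀ i) :=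
    continuous_iff_continuousAt.2 fun s => (hasDerivAt_expB_transpose_mulVec v _ s).continuousAt
  have hcl : IsClosed {s | ((expB K.B s)ᵀ *ᵥ v) (fst₀ i) = 0} := isClosed_eq hc continuous_const
  have hsub := hcl.closure_subset_iff.2 (fun s (hs : s ∈ Ioo (0 : ℝ) 1) => hv s hs i)
  have h0 : (0 : ℝ) ∈ closure (Ioo (0 : ℝ) 1) := by
    rw [closure_Ioo zero_ne_one]; simp
  simpa using hsub h0

/-- Kalman's argument, by induction on the block. The vector B*v is again unobservable, and its
block j is B_{j+1}* applied to block j+1 of v; the matrix B_{j+1} has full row rank, so its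
transpose is injective. -/
theorem Unobservable.eq_zero (hB : K.BlockStructure) {v : Sp p} (hv : Unobservable K v) :
    v = 0 := by
  have key : ∀ (j : ℕ) (v : Sp p), Unobservable K v → ∀ k : Idx p, (k.1 : ℕ) = j → v k = 0 := by
    intro j
    induction j with
    | zero =>
      rintro v hv ⟨k, i⟩ hk
      obtain rfl : k = 0 := Fin.ext hk
      exact hv.fst_eq_zero i
    | succ j ih =>
      rintro v hv ⟨k, i⟩ hk
      obtain ⟨J, rfl⟩ : ∃ J : Fin r, k = J.succ :=
        ⟨⟨j, by have := k.2; simp only at hk; omega⟩, Fin.ext hk⟩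
      have hJ : (J : ℕ) = j := by simpa using hk
      have := vecMul_injective_of_rank _ (hB.rank J) (v := fun a => v ⟨J.succ, a⟩) ?_
      · exact congrFun this i
      · intro b
        have h0 := ih _ hv.transpose_mulVec ⟨J.castSucc, b⟩ (by simpa using hJ)
        rw [Matrix.mulVec, dotProduct, Fintype.sum_sigma, Finset.sum_eq_single J.succ] at h0
        · simpa using h0
        · intro j' _ hj'
          refine Finset.sum_eq_zero fun a _ => ?_
          rw [Matrix.transpose_apply, hB.zero, zero_mul]
          intro h
          exact hj' (Fin.ext (by simpa using h))
        · simp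
  ext k
  exact key _ v hv k rfl

theorem covDensity_quadratic (s : ℝ) (v : Sp p) :
    ∑ k, ∑ l, covDensity K ζ s k l * v k * v l = ∑ i, ∑ j, K.a₂ i j ζ *
      ((expB K.B s)ᵀ *ᵥ v) (fst₀ i) * ((expB K.B s)ᵀ *ᵥ v) (fst₀ j) := by
  simp only [covDensity_apply, Matrix.mulVec, dotProduct, Matrix.transpose_apply, Finset.sum_mul,
    Finset.mul_sum]
  rw [Finset.sum_congr rfl fun k _ => Finset.sum_comm, Finset.sum_comm]
  refine Finset.sum_congr rfl fun i _ => ?_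
  rw [Finset.sum_congr rfl fun k _ => Finset.sum_comm, Finset.sum_comm]
  refine Finset.sum_congr rfl fun j _ => ?_
  rw [Finset.sum_comm]
  refine Finset.sum_congr rfl fun l _ => Finset.sum_congr rfl fun k _ => ?_
  ring

variable {μ M : ℝ}

/-- The form is the integral over [0, 1] of the A-form of the first block of e^{sB*}v. This
integrand is continuous and nonnegative; if it were nowhere positive, ellipticity would make v
unobservable. -/
theorem covC_quadratic_pos (hA : K.NonDegenerate μ M) (hB : K.BlockStructure) {v : Sp p}
    (hv : v ≠ 0) : 0 < ∑ k, ∑ l, K.covC ζ 1 k l * v k * v l := by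
  have hnn : ∀ ξ : Fin (p 0) → ℝ, 0 ≤ ∑ i, ∑ j, K.a₂ i j ζ * ξ i * ξ j := by
    intro ξ
    by_cases hξ : ξ = 0
    · simp [hξ]
    · refine le_trans ?_ (hA.lower ζ ξ hξ).le
      exact mul_nonneg (mul_pos hA.pos_μ hA.pos_M).le (Finset.sum_nonneg fun i _ => sq_nonneg _)
  have hcont : Continuous fun s => ∑ k, ∑ l, covDensity K ζ s k l * v k * v l := by
    have := continuous_covDensity K ζ
    fun_prop
  have hI : ∑ k, ∑ l, K.covC ζ 1 k l * v k * v l =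
      ∫ s in (0 : ℝ)..1, ∑ k, ∑ l, covDensity K ζ s k l * v k * v l := by
    have hc := continuous_covDensity K ζ
    rw [intervalIntegral.integral_finsetSum
      fun k _ => Continuous.intervalIntegrable (by fun_prop) _ _]
    refine Finset.sum_congr rfl fun k _ => ?_
    rw [intervalIntegral.integral_finsetSum
      fun k _ => Continuous.intervalIntegrable (by fun_prop) _ _]
    refine Finset.sum_congr rfl fun l _ => ?_
    rw [intervalIntegral.integral_mul_const, intervalIntegral.integral_mul_const, covC_apply]
  rw [hI]
  refine intervalIntegral.integral_pos one_pos hcont.continuousOn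
    (fun s _ => by rw [covDensity_quadratic]; exact hnn _) ?_
  by_contra! hcon
  refine hv (Unobservable.eq_zero hB (K := K) fun s hs i => ?_)
  have h1 := hcon s (Ioo_subset_Icc_self hs)
  rw [covDensity_quadratic] at h1
  by_contra hne
  have hξ : (fun i : Fin (p 0) => ((expB K.B s)ᵀ *ᵥ v) (fst₀ i)) ≠ 0 :=
    fun h => hne (congrFun h i)
  have h2 := hA.lower ζ _ hξ
  have h3 : 0 ≤ μ * M * ∑ i : Fin (p 0), ((expB K.B s)ᵀ *ᵥ v) (fst₀ i) ^ 2 :=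
    mul_nonneg (mul_pos hA.pos_μ hA.pos_M).le (Finset.sum_nonneg fun i _ => sq_nonneg _)
  linarith

theorem covC_isUnit_det (hA : K.NonDegenerate μ M) (hB : K.BlockStructure) :
    IsUnit (K.covC ζ 1).det := by
  rw [isUnit_iff_ne_zero]
  intro h
  obtain ⟨v, hv, h0⟩ := Matrix.exists_mulVec_eq_zero_iff.2 h
  have := covC_quadratic_pos ζ hA hB hv
  have h1 : ∑ k, ∑ l, K.covC ζ 1 k l * v k * v l = v ⬝ᵥ (K.covC ζ 1 *ᵥ v) := by
    simp only [Matrix.mulVec, dotProduct, Finset.mul_sum]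
    exact Finset.sum_congr rfl fun k _ => Finset.sum_congr rfl fun l _ => by ring
  rw [h1, h0] at this
  simp at this

/-- The quadratic form of the inverse of the covariance matrix is bounded from below. -/
theorem exists_covC_inv_lower (hA : K.NonDegenerate μ M) (hB : K.BlockStructure) :
    ∃ c : ℝ, 0 < c ∧ ∀ z : Sp p, c * ‖z‖ ^ 2 ≤ z ⬝ᵥ ((K.covC ζ 1)⁻¹ *ᵥ z) := by
  have hu := covC_isUnit_det ζ hA hB
  have hpos : ∀ z : Sp p, z ≠ 0 → 0 < z ⬝ᵥ ((K.covC ζ 1)⁻¹ *ᵥ z) := by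
    intro z hz
    -- Writing z = Cv turns the form of C⁻¹ at z into the form of C at v.
    set v := (K.covC ζ 1)⁻¹ *ᵥ z with hv
    have hz' : z = K.covC ζ 1 *ᵥ v := by
      rw [hv, Matrix.mulVec_mulVec, Matrix.mul_nonsing_inv _ hu, Matrix.one_mulVec]
    have hv0 : v ≠ 0 := by
      intro h
      rw [h, Matrix.mulVec_zero] at hz'
      exact hz hz'
    have := covC_quadratic_pos ζ hA hB hv0
    rw [hz']
    convert this using 1
    simp only [Matrix.mulVec, dotProduct, Finset.sum_mul]
    rw [Finset.sum_comm]
    refine Finset.sum_congr rfl fun k _ => Finset.sum_congr rfl fun l _ => ?_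
    rw [covC_symm K ζ hA.symm]
  have hcont : Continuous fun z : Sp p => z ⬝ᵥ ((K.covC ζ 1)⁻¹ *ᵥ z) := by
    simp only [Matrix.mulVec, dotProduct]
    fun_prop
  by_cases hne : (Metric.sphere (0 : Sp p) 1).Nonempty
  · obtain ⟨z₀, hz₀, hmin⟩ := (isCompact_sphere (0 : Sp p) 1).exists_isMinOn hne hcont.continuousOn
    have hz₀' : z₀ ≠ 0 := by
      rintro rfl
      simp at hz₀
    refine ⟨_, hpos z₀ hz₀', fun z => ?_⟩
    by_cases hz : z = 0
    · simp [hz]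
    · have hn : ‖z‖ ≠ 0 := norm_ne_zero_iff.2 hz
      have h1 := hmin (show (‖z‖⁻¹ • z) ∈ Metric.sphere (0 : Sp p) 1 by
        simp [norm_smul, hn])
      simp only [Set.mem_ofPred_eq, Matrix.mulVec_smul, smul_dotProduct, dotProduct_smul,
        smul_eq_mul] at h1
      calc _ ≤ (‖z‖⁻¹ * (‖z‖⁻¹ * z ⬝ᵥ ((K.covC ζ 1)⁻¹ *ᵥ z))) * ‖z‖ ^ 2 := by gcongr
        _ = _ := by field_simp
  · refine ⟨1, one_pos, fun z => ?_⟩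
    have : z = 0 := by
      by_contra hz
      exact hne ⟨‖z‖⁻¹ • z, by simp [norm_smul, norm_ne_zero_iff.2 hz]⟩
    simp [this]

end Kalman

/-! ### Bundled smooth functions, on which differential operators form an algebra of endomorphisms.
-/

section Smooth

variable {F F' : Type*} [NormedAddCommGroup F] [NormedSpace ℝ F] [NormedAddCommGroup F']
  [NormedSpace ℝ F']

variable (F) in
/-- Smooth real functions on `F`. -/
structure Sm where
  toFun : F → ℝ
  smooth : ContDiff ℝ ∞ toFun

namespace Sm

instance : FunLike (Sm F) F ℝ where
  coe := toFun
  coe_injective f g h := by cases f; cases g; congr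

@[simp] theorem coe_mk (f : F → ℝ) (hf : ContDiff ℝ ∞ f) : ((⟨f, hf⟩ : Sm F) : F → ℝ) = f := rfl

theorem contDiff (f : Sm F) : ContDiff ℝ ∞ (f : F → ℝ) := f.2

@[ext] theorem ext {f g : Sm F} (h : ∀ x, f x = g x) : f = g := DFunLike.ext f g h

instance : Zero (Sm F) := ⟨⟨0, contDiff_const⟩⟩
instance : Add (Sm F) := ⟨fun f g => ⟨f + g, (contDiff f).add (contDiff g)⟩⟩
instance : Neg (Sm F) := ⟨fun f => ⟨-f, (contDiff f).neg⟩⟩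
instance : Sub (Sm F) := ⟨fun f g => ⟨f - g, (contDiff f).sub (contDiff g)⟩⟩
instance : SMul ℝ (Sm F) := ⟨fun c f => ⟨c • f, contDiff_const.smul (contDiff f)⟩⟩
instance : SMul ℕ (Sm F) := ⟨fun n f => ⟨n • f, (contDiff f).const_smul n⟩⟩
instance : SMul ℤ (Sm F) := ⟨fun n f => ⟨n • f, (contDiff f).const_smul n⟩⟩

instance : AddCommGroup (Sm F) :=
  DFunLike.coe_injective.addCommGroup _ rfl (fun _ _ => rfl) (fun _ => rfl) (fun _ _ => rfl)
    (fun _ _ => rfl) (fun _ _ => rfl)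

@[simp] theorem coe_zero : ((0 : Sm F) : F → ℝ) = 0 := rfl
@[simp] theorem coe_add (f g : Sm F) : ((f + g : Sm F) : F → ℝ) = f + g := rfl
@[simp] theorem coe_sub (f g : Sm F) : ((f - g : Sm F) : F → ℝ) = f - g := rfl
@[simp] theorem coe_neg (f : Sm F) : ((-f : Sm F) : F → ℝ) = -f := rfl
@[simp] theorem coe_smul (c : ℝ) (f : Sm F) : ((c • f : Sm F) : F → ℝ) = c • (f : F → ℝ) := rfl

/-- The coercion to functions, as an additive homomorphism. -/
def coeHom : Sm F →+ (F → ℝ) where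
  toFun f := f
  map_zero' := rfl
  map_add' _ _ := rfl

instance : Module ℝ (Sm F) :=
  Function.Injective.module ℝ coeHom DFunLike.coe_injective fun _ _ => rfl

@[simp] theorem coe_sum {ι : Type*} (S : Finset ι) (f : ι → Sm F) :
    ((∑ i ∈ S, f i : Sm F) : F → ℝ) = ∑ i ∈ S, (f i : F → ℝ) :=
  map_sum coeHom f S

theorem differentiable (f : Sm F) : Differentiable ℝ (f : F → ℝ) :=
  (contDiff f).differentiable (by simp)

theorem continuous (f : Sm F) : Continuous (f : F → ℝ) := (contDiff f).continuous

/-- The directional derivative of smooth functions. -/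
def dd : F →ₗ[ℝ] Module.End ℝ (Sm F) where
  toFun v :=
    { toFun := fun f => ⟨fun x => fderiv ℝ (f : F → ℝ) x v,
        (((Sm.contDiff f).fderiv_right (m := ∞) (by simp)).clm_apply contDiff_const)⟩
      map_add' := fun f g => by
        ext x
        simp [fderiv_add ((differentiable f) x) ((differentiable g) x)]
      map_smul' := fun c f => by
        ext x
        simp [fderiv_const_smul ((differentiable f) x) c] }
  map_add' v w := by ext f x; simp
  map_smul' c v := by ext f x; simp

theorem dd_apply (v : F) (f : Sm F) (x : F) : dd v f x = fderiv ℝ (f : F → ℝ) x v := rfl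

/-- Multiplication by a smooth function. -/
def mul (g : Sm F) : Module.End ℝ (Sm F) where
  toFun f := ⟨fun x => (g : F → ℝ) x * (f : F → ℝ) x, ((contDiff g).mul (contDiff f))⟩
  map_add' f h := by ext x; simp [mul_add]
  map_smul' c f := by ext x; simp [mul_left_comm]

@[simp] theorem mul_apply (g f : Sm F) (x : F) :
    (mul g f : F → ℝ) x = (g : F → ℝ) x * (f : F → ℝ) x := rfl

/-- Composition with a smooth map. -/
def comp (g : F' → F) (hg : ContDiff ℝ ∞ g) : Sm F →ₗ[ℝ] Sm F' where
  toFun f := ⟨fun x => (f : F → ℝ) (g x), ((contDiff f).comp hg)⟩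
  map_add' f h := by ext x; simp
  map_smul' c f := by ext x; simp

@[simp] theorem comp_apply (g : F' → F) (hg : ContDiff ℝ ∞ g) (f : Sm F) (x : F') :
    (comp g hg f : F' → ℝ) x = (f : F → ℝ) (g x) := rfl

theorem dd_comm (v w : F) (f : Sm F) : dd v (dd w f) = dd w (dd v f) := by
  ext x
  simp only [dd_apply]
  have hd : DifferentiableAt ℝ (fderiv ℝ (f : F → ℝ)) x :=
    (((Sm.contDiff f).fderiv_right (m := ∞) (by simp)).differentiable (by simp)) x
  have h : ∀ u : F, fderiv ℝ (dd u f : F → ℝ) x = (fderiv ℝ (fderiv ℝ (f : F → ℝ)) x).flip u := by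
    intro u
    have : HasFDerivAt (fun y => fderiv ℝ (f : F → ℝ) y u)
        ((fderiv ℝ (fderiv ℝ (f : F → ℝ)) x).flip u) x := by
      simpa using hd.hasFDerivAt.clm_apply (hasFDerivAt_const u x)
    exact this.fderiv
  rw [h, h]
  have hs : IsSymmSndFDerivAt ℝ (f : F → ℝ) x :=
    (contDiff f).contDiffAt.isSymmSndFDerivAt (by
      simp only [minSmoothness_of_isRCLikeNormedField]; exact WithTop.coe_le_coe.2 (le_top (a := (2
          : ℕ∞))))
  exact hs v w

theorem dd_mul (v : F) (g f : Sm F) :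
    dd v (mul g f) = mul (dd v g) f + mul g (dd v f) := by
  ext x
  have : HasFDerivAt (fun x => (g : F → ℝ) x * (f : F → ℝ) x) _ x :=
    ((differentiable g) x).hasFDerivAt.mul ((differentiable f) x).hasFDerivAt
  rw [dd_apply]
  change fderiv ℝ (fun x => (g : F → ℝ) x * (f : F → ℝ) x) x v = _
  rw [this.fderiv]
  simp [dd_apply]
  ring

theorem mul_comm' (g h f : Sm F) : mul g (mul h f) = mul h (mul g f) := by
  ext x
  simp [mul_left_comm]

/-- Smooth functions on `ℝ^d`: the coordinates. -/
def coord {ι : Type*} [Fintype ι] (k : ι) : Sm (ι → ℝ) :=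
  ⟨fun x => x k, (contDiff_apply ℝ ℝ k)⟩

@[simp] theorem coord_apply {ι : Type*} [Fintype ι] (k : ι) (x : ι → ℝ) :
    (coord k : (ι → ℝ) → ℝ) x = x k := rfl

theorem pd_eq (k : Idx p) (f : Sm (Sp p)) (x : Sp p) :
    pd k (f : Sp p → ℝ) x = dd (Pi.single k 1) f x :=
  ((differentiable f) x).lineDeriv_eq_fderiv

end Sm

end Smooth

/-! ### Finite rank families, a substitute for topologies on operators. -/

section Separated

variable {ι M M' M'' : Type*} [AddCommGroup M] [Module ℝ M] [AddCommGroup M'] [Module ℝ M']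
  [AddCommGroup M''] [Module ℝ M'']

/-- Families of finite rank `i ↦ ∑ c_j(i) m_j` with `c_j ∈ R` and `m_j ∈ A`. -/
def sep (R : Subalgebra ℝ (ι → ℝ)) (A : Submodule ℝ M) : Submodule ℝ (ι → M) :=
  Submodule.span ℝ {f | ∃ c ∈ R, ∃ m ∈ A, f = fun i => c i • m}

variable {R : Subalgebra ℝ (ι → ℝ)} {A : Submodule ℝ M} {A' : Submodule ℝ M'}
  {A'' : Submodule ℝ M''}

theorem sep_mk {c : ι → ℝ} (hc : c ∈ R) {m : M} (hm : m ∈ A) : (fun i => c i • m) ∈ sep R A :=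
  Submodule.subset_span ⟨c, hc, m, hm, rfl⟩

theorem sep_const {m : M} (hm : m ∈ A) : (fun _ : ι => m) ∈ sep R A := by
  simpa using sep_mk (R := R) R.one_mem hm

/-- The scalars of the span can be absorbed into the coefficients c, so generators and sums suffice.
-/
theorem sep_induction {P : (ι → M) → Prop}
    (mk : ∀ c ∈ R, ∀ m ∈ A, P fun i => c i • m)
    (add : ∀ f g, f ∈ sep R A → g ∈ sep R A → P f → P g → P fun i => f i + g i)
    {f : ι → M} (hf : f ∈ sep R A) : P f := by
  have h0 : P 0 := by
    have := mk 0 R.zero_mem 0 A.zero_mem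
    simp only [smul_zero] at this
    exact this
  induction hf using Submodule.span_induction with
  | mem x h => obtain ⟨c, hc, m, hm, rfl⟩ := h; exact mk c hc m hm
  | zero => exact h0
  | add x y hx hy h1 h2 => exact add x y hx hy h1 h2
  | smul a x hx h =>
    clear h
    revert a
    induction hx using Submodule.span_induction with
    | mem x h =>
      intro a
      obtain ⟨c, hc, m, hm, rfl⟩ := h
      have := mk (a • c) (R.smul_mem hc a) m hm
      convert this using 1
      ext i
      simp [smul_smul]
    | zero => intro a; rw [smul_zero]; exact h0
    | add x y hx hy h1 h2 =>
      intro a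
      rw [smul_add]
      exact add _ _ (Submodule.smul_mem _ a hx) (Submodule.smul_mem _ a hy) (h1 a) (h2 a)
    | smul b x hx h => intro a; rw [smul_smul]; exact h (a * b)

theorem sep_add {f g : ι → M} (hf : f ∈ sep R A) (hg : g ∈ sep R A) :
    (fun i => f i + g i) ∈ sep R A :=
  (sep R A).add_mem hf hg

theorem sep_sub {f g : ι → M} (hf : f ∈ sep R A) (hg : g ∈ sep R A) :
    (fun i => f i - g i) ∈ sep R A :=
  (sep R A).sub_mem hf hg

theorem sep_sum {κ : Type*} (S : Finset κ) {f : κ → ι → M} (hf : ∀ a ∈ S, f a ∈ sep R A) :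
    (fun i => ∑ a ∈ S, f a i) ∈ sep R A := by
  have := (sep R A).sum_mem hf
  convert this using 1
  ext i
  simp

theorem sep_map (L : M →ₗ[ℝ] M') (hL : ∀ m ∈ A, L m ∈ A') {f : ι → M} (hf : f ∈ sep R A) :
    (fun i => L (f i)) ∈ sep R A' := by
  refine sep_induction (P := fun f => (fun i => L (f i)) ∈ sep R A') (fun c hc m hm => ?_) (fun f g
      _ _ h1 h2 => ?_) hf
  · simpa using sep_mk hc (hL m hm)
  · simpa using sep_add h1 h2

theorem sep_smul {c : ι → ℝ} (hc : c ∈ R) {f : ι → M} (hf : f ∈ sep R A) :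
    (fun i => c i • f i) ∈ sep R A := by
  refine sep_induction (P := fun f => (fun i => c i • f i) ∈ sep R A) (fun c' hc' m hm => ?_) (fun
      f g _ _ h1 h2 => ?_) hf
  · simpa [smul_smul] using sep_mk (R.mul_mem hc hc') hm
  · simpa using sep_add h1 h2

/-- Covers both products of families of operators and, through `sep_mul`, all noncommutative
polynomial expressions in them. -/
theorem sep_map₂ (L : M →ₗ[ℝ] M' →ₗ[ℝ] M'') (hL : ∀ m ∈ A, ∀ m' ∈ A', L m m' ∈ A'') {f : ι → M}
    (hf : f ∈ sep R A) {g : ι → M'} (hg : g ∈ sep R A') : (fun i => L (f i) (g i)) ∈ sep R A'' := by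
  refine sep_induction (P := fun f => (fun i => L (f i) (g i)) ∈ sep R A'') (fun c hc m hm => ?_)
      (fun f g _ _ h1 h2 => ?_) hf
  · simpa using sep_smul hc (sep_map (L m) (hL m hm) hg)
  · simpa using sep_add h1 h2

variable {X : Type*} [Ring X] [Algebra ℝ X] {U : Subalgebra ℝ X}

theorem sep_mul {f g : ι → X} (hf : f ∈ sep R U.toSubmodule) (hg : g ∈ sep R U.toSubmodule) :
    (fun i => f i * g i) ∈ sep R U.toSubmodule :=
  sep_map₂ (LinearMap.mul ℝ X) (fun _ h _ h' => U.mul_mem h h') hf hg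

theorem sep_pow {f : ι → X} (hf : f ∈ sep R U.toSubmodule) (n : ℕ) :
    (fun i => f i ^ n) ∈ sep R U.toSubmodule := by
  induction n with
  | zero => simpa using sep_const U.one_mem
  | succ n ih => simpa [pow_succ] using sep_mul ih hf

theorem sep_list_prod {κ : Type*} (l : List κ) {f : ι → κ → X}
    (hf : ∀ a, (fun i => f i a) ∈ sep R U.toSubmodule) :
    (fun i => (l.map (f i)).prod) ∈ sep R U.toSubmodule := by
  induction l with
  | nil => simpa using sep_const U.one_mem
  | cons a l ih => simpa using sep_mul (hf a) ih

end Separated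

/-! ### Polynomials evaluated at noncommuting elements. -/

section OpEval

variable {X : Type*} [Ring X] [Algebra ℝ X]

/-- The value of a polynomial at a vector of elements of a noncommutative algebra, the factors of
each monomial being multiplied in the order of the coordinates. -/
def algEval (P : MvPolynomial (Idx p) ℝ) (O : Idx p → X) : X :=
  ∑ β ∈ P.support, P.coeff β • ((idxList p).map fun k => O k ^ β k).prod

theorem algEval_eq_sum {P : MvPolynomial (Idx p) ℝ} {S : Finset (Idx p →₀ ℕ)} (h : P.support ⊆ S)
    (O : Idx p → X) :
    algEval P O = ∑ β ∈ S, P.coeff β • ((idxList p).map fun k => O k ^ β k).prod :=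
  Finset.sum_subset h fun β _ hβ => by rw [MvPolynomial.notMem_support_iff.1 hβ, zero_smul]

theorem algEval_add (P Q : MvPolynomial (Idx p) ℝ) (O : Idx p → X) :
    algEval (P + Q) O = algEval P O + algEval Q O := by
  classical
  rw [algEval_eq_sum (S := P.support ∪ Q.support) MvPolynomial.support_add O,
    algEval_eq_sum (S := P.support ∪ Q.support) Finset.subset_union_left O,
    algEval_eq_sum (S := P.support ∪ Q.support) Finset.subset_union_right O,
    ← Finset.sum_add_distrib]
  exact Finset.sum_congr rfl fun β _ => by rw [MvPolynomial.coeff_add, add_smul]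

theorem algEval_smul (c : ℝ) (P : MvPolynomial (Idx p) ℝ) (O : Idx p → X) :
    algEval (c • P) O = c • algEval P O := by
  rw [algEval_eq_sum (S := P.support) MvPolynomial.support_smul O, algEval, Finset.smul_sum]
  exact Finset.sum_congr rfl fun β _ => by rw [MvPolynomial.coeff_smul, smul_assoc]

theorem algEval_mem_sep {ι : Type*} {R : Subalgebra ℝ (ι → ℝ)} {U : Subalgebra ℝ X}
    {P : ι → MvPolynomial (Idx p) ℝ} (hP : P ∈ sep R ⊤) {O : ι → Idx p → X}
    (hO : ∀ k, (fun i => O i k) ∈ sep R U.toSubmodule) :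
    (fun i => algEval (P i) (O i)) ∈ sep R U.toSubmodule := by
  refine sep_induction (P := fun P => (fun i => algEval (P i) (O i)) ∈ sep R U.toSubmodule)
    (fun c hc Q _ => ?_) (fun P Q _ _ h1 h2 => ?_) hP
  · simp only [algEval_smul]
    refine sep_smul hc (sep_sum _ fun β _ => ?_)
    have := sep_list_prod (R := R) (U := U) (idxList p) (f := fun i k => O i k ^ β k)
      fun k => sep_pow (hO k) (β k)
    exact (sep R U.toSubmodule).smul_mem (Q.coeff β) this
  · simp only [algEval_add]
    exact sep_add h1 h2

theorem intertwine_list_prod {V V' : Type*} [AddCommGroup V] [Module ℝ V] [AddCommGroup V']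
    [Module ℝ V'] (L : V →ₗ[ℝ] V') {κ : Type*} (l : List κ) {O : κ → Module.End ℝ V}
    {O' : κ → Module.End ℝ V'} (h : ∀ k v, L (O k v) = O' k (L v)) (v : V) :
    L ((l.map O).prod v) = (l.map O').prod (L v) := by
  induction l generalizing v with
  | nil => simp
  | cons k l ih => simp [h, ih]

theorem intertwine_pow {V V' : Type*} [AddCommGroup V] [Module ℝ V] [AddCommGroup V']
    [Module ℝ V'] (L : V →ₗ[ℝ] V') {O : Module.End ℝ V}
    {O' : Module.End ℝ V'} (h : ∀ v, L (O v) = O' (L v)) (n : ℕ) (v : V) :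
    L ((O ^ n) v) = (O' ^ n) (L v) := by
  induction n generalizing v with
  | zero => simp
  | succ n ih => simp [pow_succ, h, ih]

/-- This is how 𝒢_n travels between its three realizations, on functions of x, on functions of (θ,
y) and on symbols: it is enough to intertwine its building blocks ℳ and e^{-tB*}∇. -/
theorem intertwine_algEval {V V' : Type*} [AddCommGroup V] [Module ℝ V] [AddCommGroup V']
    [Module ℝ V'] (L : V →ₗ[ℝ] V') {O : Idx p → Module.End ℝ V}
    {O' : Idx p → Module.End ℝ V'} (h : ∀ k v, L (O k v) = O' k (L v))
    (P : MvPolynomial (Idx p) ℝ) (v : V) :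
    L (algEval P O v) = algEval P O' (L v) := by
  simp only [algEval, LinearMap.sum_apply, map_sum, LinearMap.smul_apply, map_smul]
  refine Finset.sum_congr rfl fun β _ => ?_
  rw [intertwine_list_prod L (O' := fun k => O' k ^ β k)]
  exact fun k v => intertwine_pow L (h k) _ _

end OpEval

theorem idxList_map_prod {X : Type*} [CommMonoid X] (f : Idx p → X) :
    ((idxList p).map f).prod = ∏ k, f k := by
  rw [idxList, List.map_flatMap, Fintype.prod_sigma]
  simp only [List.map_map, Function.comp_def, List.flatMap, List.prod_flatten]
  rw [← List.prod_ofFn, List.ofFn_eq_map]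
  congr 1

/-! ### The operators 𝒢_n as an expression in an arbitrary algebra, and on smooth functions. -/

namespace KolmogorovOp

variable (K : KolmogorovOp p) (ζ : ℝ × Sp p)

section GenG

variable {X : Type*} [Ring X] [Algebra ℝ X]

/-- The expression defining `𝒢_n`, evaluated in an algebra; the first order part carries
the weight `κ`. -/
def genG (n : ℕ) (s κ : ℝ) (Mo Wo : Idx p → X) : X :=
  (1 / 2 : ℝ) • ∑ i, ∑ j,
      algEval (K.taylorPoly n (K.a₂ i j) ζ s - K.taylorPoly ((n : ℤ) - 1) (K.a₂ i j) ζ s) Mo *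
        (Wo (fst₀ i) * Wo (fst₀ j))
    + κ • ∑ i,
      algEval (K.taylorPoly ((n : ℤ) - 1) (K.a₁ i) ζ s - K.taylorPoly ((n : ℤ) - 2) (K.a₁ i) ζ s)
        Mo * Wo (fst₀ i)

/-- The second order part is quadratic in `Wo`, the first order part only linear; the extra weight κ
on the latter makes the whole homogeneous of degree two. It is used with κ = ε = √(T - t). -/
theorem genG_smul (n : ℕ) (s κ : ℝ) (Mo Wo : Idx p → X) :
    K.genG ζ n s κ Mo (fun k => κ • Wo k) = κ ^ 2 • K.genG ζ n s 1 Mo Wo := by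
  simp only [genG, smul_add, Finset.smul_sum, smul_mul_assoc, mul_smul_comm, smul_smul]
  congr 1
  · refine Finset.sum_congr rfl fun i _ => Finset.sum_congr rfl fun j _ => ?_
    congr 1; ring
  · refine Finset.sum_congr rfl fun i _ => ?_
    congr 1; ring

/-- Time enters the Taylor polynomial only through powers of s minus the base time and through the
entries of e^{·B}ξ at that difference, all of them continuous scalars. -/
theorem taylorPoly_mem_sep {ι : Type*} {R : Subalgebra ℝ (ι → ℝ)} {s : ι → ℝ}
    (hs : ∀ c : ℝ → ℝ, Continuous c → (fun i => c (s i)) ∈ R) (n : ℤ) (f : ℝ × Sp p → ℝ) :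
    (fun i => K.taylorPoly n f ζ (s i)) ∈ sep R (⊤ : Submodule ℝ (MvPolynomial (Idx p) ℝ)) := by
  have hC : ∀ c : ℝ → ℝ, Continuous c → (fun i => MvPolynomial.C (c (s i))) ∈
      sep R (⊤ : Subalgebra ℝ (MvPolynomial (Idx p) ℝ)).toSubmodule := by
    intro c hc
    have := sep_mk (hs c hc) (Submodule.mem_top (R := ℝ) (x := (1 : MvPolynomial (Idx p) ℝ)))
    simpa [MvPolynomial.smul_eq_C_mul] using this
  have hP : ∀ (l : List (Idx p)) (β : Idx p → ℕ), (fun i => (l.map fun k =>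
      (MvPolynomial.X k - MvPolynomial.C ((expB K.B (s i - ζ.1) *ᵥ ζ.2) k)) ^ β k).prod) ∈
        sep R (⊤ : Subalgebra ℝ (MvPolynomial (Idx p) ℝ)).toSubmodule := by
    intro l β
    refine sep_list_prod (R := R) (U := ⊤) l (f := fun i k =>
      (MvPolynomial.X k - MvPolynomial.C ((expB K.B (s i - ζ.1) *ᵥ ζ.2) k)) ^ β k) fun k => ?_
    refine sep_pow (sep_sub (sep_const (by simp)) (hC (fun u => (expB K.B (u - ζ.1) *ᵥ ζ.2) k) ?_))
        _
    have := continuous_expB_apply K.B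
    simp only [Matrix.mulVec, dotProduct]
    fun_prop
  unfold taylorPoly
  refine sep_sum _ fun q _ => ?_
  have := sep_mul (hC (fun u => (1 / ((q.1.factorial : ℝ) * ∏ i, ((q.2 i).factorial : ℝ))) *
        ((lieY K.B univ)^[q.1] (dxPow q.2 f)) ζ * (u - ζ.1) ^ q.1) (by fun_prop))
        (hP (idxList p) q.2)
  simpa only [idxList_map_prod, Algebra.top_toSubmodule] using this

theorem genG_mem_sep {ι : Type*} {R : Subalgebra ℝ (ι → ℝ)} {U : Subalgebra ℝ X} {s κ : ι → ℝ}
    (hs : ∀ c : ℝ → ℝ, Continuous c → (fun i => c (s i)) ∈ R) (hκ : κ ∈ R) {Mo Wo : ι → Idx p → X}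
    (hM : ∀ k, (fun i => Mo i k) ∈ sep R U.toSubmodule)
    (hW : ∀ k, (fun i => Wo i k) ∈ sep R U.toSubmodule) (n : ℕ) :
    (fun i => K.genG ζ n (s i) (κ i) (Mo i) (Wo i)) ∈ sep R U.toSubmodule := by
  refine sep_add ((sep R U.toSubmodule).smul_mem (1 / 2 : ℝ) (sep_sum _ fun i _ =>
    sep_sum _ fun j _ => sep_mul (algEval_mem_sep (sep_sub (K.taylorPoly_mem_sep ζ hs _ _)
      (K.taylorPoly_mem_sep ζ hs _ _)) hM) (sep_mul (hW _) (hW _)))) (sep_smul hκ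
    (sep_sum _ fun i _ => sep_mul (algEval_mem_sep (sep_sub (K.taylorPoly_mem_sep ζ hs _ _)
      (K.taylorPoly_mem_sep ζ hs _ _)) hM) (hW _)))

theorem intertwine_genG {V V' : Type*} [AddCommGroup V] [Module ℝ V] [AddCommGroup V']
    [Module ℝ V'] (L : V →ₗ[ℝ] V') {Mo Wo : Idx p → Module.End ℝ V}
    {Mo' Wo' : Idx p → Module.End ℝ V'} (hM : ∀ k v, L (Mo k v) = Mo' k (L v))
    (hW : ∀ i v, L (Wo (fst₀ i) v) = Wo' (fst₀ i) (L v)) (n : ℕ) (s κ : ℝ) (v : V) :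
    L (K.genG ζ n s κ Mo Wo v) = K.genG ζ n s κ Mo' Wo' (L v) := by
  simp only [genG, LinearMap.add_apply, map_add, LinearMap.smul_apply, map_smul,
    LinearMap.sum_apply, map_sum, Module.End.mul_apply, intertwine_algEval L hM, hW]

end GenG

/-- The components of `ℳ(t, x)`, acting on smooth functions. -/
def smM (t : ℝ) (k : Idx p) : Module.End ℝ (Sm (Sp p)) :=
  ∑ l, expB K.B t k l • (Sm.mul (Sm.coord l) + ∑ m, K.matM ζ t l m • Sm.dd (Pi.single m 1))

/-- The components of `e^{-tB*} ∇_x`, acting on smooth functions. -/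
def smW (t : ℝ) (k : Idx p) : Module.End ℝ (Sm (Sp p)) :=
  ∑ l, expB K.Bᵀ (-t) k l • Sm.dd (Pi.single l 1)

theorem smM_coe (t : ℝ) (k : Idx p) (f : Sm (Sp p)) :
    K.opM ζ t k (f : Sp p → ℝ) = (K.smM ζ t k f : Sp p → ℝ) := by
  ext x
  simp [opM, smM, Sm.pd_eq, mul_add]

theorem smW_coe (t : ℝ) (k : Idx p) (f : Sm (Sp p)) :
    K.opW t k (f : Sp p → ℝ) = (K.smW t k f : Sp p → ℝ) := by
  ext x
  simp [opW, smW, Sm.pd_eq]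

theorem foldr_coe {κ : Type*} (l : List κ) (O : κ → (Sp p → ℝ) → (Sp p → ℝ))
    (O' : κ → Module.End ℝ (Sm (Sp p)))
    (h : ∀ k (f : Sm (Sp p)), O k (f : Sp p → ℝ) = (O' k f : Sp p → ℝ)) (f : Sm (Sp p)) :
    l.foldr (fun k g => O k g) (f : Sp p → ℝ) = ((l.map O').prod f : Sp p → ℝ) := by
  induction l with
  | nil => simp
  | cons k l ih => simp [ih, h]

theorem iterate_coe (O : (Sp p → ℝ) → (Sp p → ℝ)) (O' : Module.End ℝ (Sm (Sp p)))
    (h : ∀ f : Sm (Sp p), O (f : Sp p → ℝ) = (O' f : Sp p → ℝ)) (n : ℕ) (f : Sm (Sp p)) :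
    O^[n] (f : Sp p → ℝ) = ((O' ^ n) f : Sp p → ℝ) := by
  induction n with
  | zero => simp
  | succ n ih => rw [Function.iterate_succ_apply', ih, h, pow_succ', Module.End.mul_apply]

theorem opEval_coe (P : MvPolynomial (Idx p) ℝ) (O : Idx p → (Sp p → ℝ) → (Sp p → ℝ))
    (O' : Idx p → Module.End ℝ (Sm (Sp p)))
    (h : ∀ k (f : Sm (Sp p)), O k (f : Sp p → ℝ) = (O' k f : Sp p → ℝ)) (f : Sm (Sp p)) :
    opEval P O (f : Sp p → ℝ) = (algEval P O' f : Sp p → ℝ) := by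
  ext x
  simp only [opEval, algEval, LinearMap.sum_apply, LinearMap.smul_apply, Sm.coe_sum,
    Finset.sum_apply, Sm.coe_smul, Pi.smul_apply, smul_eq_mul]
  refine Finset.sum_congr rfl fun β _ => ?_
  rw [foldr_coe _ (fun k g => (O k)^[β k] g) (fun k => O' k ^ β k)
    fun k f => iterate_coe _ _ (h k) _ _]

/-- `𝒢_n(t, s, x)`, acting on smooth functions. -/
def smG (n : ℕ) (t s : ℝ) : Module.End ℝ (Sm (Sp p)) :=
  K.genG ζ n s 1 (K.smM ζ (s - t)) (K.smW (s - t))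

theorem smG_coe (n : ℕ) (t s : ℝ) (f : Sm (Sp p)) :
    K.opG ζ n t s (f : Sp p → ℝ) = (K.smG ζ n t s f : Sp p → ℝ) := by
  ext x
  simp only [opG, smG, genG, smW_coe, opEval_coe _ _ _ (K.smM_coe ζ (s - t)), one_smul]
  simp

/-- `𝒢_{i_1}(t, s_1, x) ⋯ 𝒢_{i_h}(t, s_h, x)`, acting on smooth functions. -/
theorem prodG_coe (t : ℝ) {h : ℕ} (i : Fin h → ℕ) (s : Fin h → ℝ) (f : Sm (Sp p)) :
    K.prodG ζ t i s (f : Sp p → ℝ) =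
      ((List.ofFn fun k => K.smG ζ (i k) t (s k)).prod f : Sp p → ℝ) := by
  have hl : (List.ofFn fun k => K.opG ζ (i k) t (s k)) =
      (List.finRange h).map fun k => K.opG ζ (i k) t (s k) := List.ofFn_eq_map
  rw [prodG, hl, List.foldr_map, List.ofFn_eq_map]
  exact foldr_coe (List.finRange h) (fun k => K.opG ζ (i k) t (s k)) _
    (fun k f => K.smG_coe ζ _ _ _ f) f

theorem smW_const (t : ℝ) (k : Idx p) (f : Sm (Sp p)) (c : ℝ) (hf : ∀ x, (f : Sp p → ℝ) x = c) :
    K.smW t k f = 0 := by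
  have hf' : (f : Sp p → ℝ) = fun _ => c := funext hf
  ext x
  simp [smW, Sm.dd_apply, hf']

theorem smG_const (n : ℕ) (t s : ℝ) (f : Sm (Sp p)) (c : ℝ) (hf : ∀ x, (f : Sp p → ℝ) x = c) :
    K.smG ζ n t s f = 0 := by
  simp [smG, genG, K.smW_const _ _ f c hf]

/-- In 𝒢_n a derivative acts first, so one factor already kills constants. This will allow a
constant to be subtracted from the final datum when h ≥ 1. -/
theorem prod_smG_const (t : ℝ) {h : ℕ} (i : Fin (h + 1) → ℕ) (s : Fin (h + 1) → ℝ) (f : Sm (Sp p))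
    (c : ℝ) (hf : ∀ x, (f : Sp p → ℝ) x = c) :
    (List.ofFn fun k => K.smG ζ (i k) t (s k)).prod f = 0 := by
  induction h with
  | zero => simp [K.smG_const ζ _ _ _ f c hf]
  | succ h ih =>
    rw [List.ofFn_succ, List.prod_cons, Module.End.mul_apply,
      ih (fun k => i k.succ) (fun k => s k.succ), map_zero]

theorem smM_zero (k : Idx p) (f : Sm (Sp p)) (x : Sp p) :
    (K.smM ζ 0 k f : Sp p → ℝ) x = x k * (f : Sp p → ℝ) x := by
  simp [smM, matM, Matrix.one_apply]

theorem smW_zero (k : Idx p) (f : Sm (Sp p)) : K.smW 0 k f = Sm.dd (Pi.single k 1) f := by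
  simp [smW, Matrix.one_apply, expB_zero]

/-- Applies to ℳ(0, x), which is multiplication by x because M(0) = 0: there the operator polynomial
is an ordinary value. -/
theorem algEval_mul_apply (P : MvPolynomial (Idx p) ℝ) (O : Idx p → Module.End ℝ (Sm (Sp p)))
    (h : ∀ k (f : Sm (Sp p)) x, (O k f : Sp p → ℝ) x = x k * (f : Sp p → ℝ) x) (f : Sm (Sp p))
    (x : Sp p) : (algEval P O f : Sp p → ℝ) x = P.eval x * (f : Sp p → ℝ) x := by
  have hp : ∀ k (n : ℕ) (f : Sm (Sp p)),
      ((O k ^ n) f : Sp p → ℝ) x = x k ^ n * (f : Sp p → ℝ) x := by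
    intro k n f
    induction n with
    | zero => simp
    | succ n ih => rw [pow_succ', Module.End.mul_apply, h, ih]; ring
  have hl : ∀ (l : List (Idx p)) (β : Idx p →₀ ℕ), ((l.map fun k => O k ^ β k).prod f : Sp p → ℝ) x
      =
      (l.map fun k => x k ^ β k).prod * (f : Sp p → ℝ) x := by
    intro l β
    induction l with
    | nil => simp
    | cons k l ih => simp [hp, ih, mul_assoc]
  rw [MvPolynomial.eval_eq', Finset.sum_mul]
  simp only [algEval, LinearMap.sum_apply, LinearMap.smul_apply, Sm.coe_sum,
    Finset.sum_apply, Sm.coe_smul, Pi.smul_apply, smul_eq_mul, hl, idxList_map_prod,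
    mul_assoc]

/-- At coinciding times `𝒢_n` is the difference of two approximating operators. -/
theorem smG_self (n : ℕ) (t : ℝ) (f : Sm (Sp p)) (x : Sp p) :
    (K.smG ζ n t t f : Sp p → ℝ) x =
      1 / 2 * ∑ i, ∑ j, ((K.taylorPoly n (K.a₂ i j) ζ t).eval x -
          (K.taylorPoly ((n : ℤ) - 1) (K.a₂ i j) ζ t).eval x) *
        (Sm.dd (Pi.single (fst₀ i) 1) (Sm.dd (Pi.single (fst₀ j) 1) f) : Sp p → ℝ) x
      + ∑ i, ((K.taylorPoly ((n : ℤ) - 1) (K.a₁ i) ζ t).eval x -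
          (K.taylorPoly ((n : ℤ) - 2) (K.a₁ i) ζ t).eval x) *
        (Sm.dd (Pi.single (fst₀ i) 1) f : Sp p → ℝ) x := by
  simp only [smG, genG, sub_self, one_smul, LinearMap.add_apply, LinearMap.smul_apply,
    LinearMap.sum_apply, Module.End.mul_apply, smW_zero, Sm.coe_add, Sm.coe_smul,
    Sm.coe_sum, Pi.add_apply, Pi.smul_apply, Finset.sum_apply, smul_eq_mul,
    algEval_mul_apply _ _ (K.smM_zero ζ), map_sub]

end KolmogorovOp

/-! ### Gaussian densities, dilations, and bounds on kernels with polynomial symbols. -/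

section Kernel

theorem integrable_exp_neg_norm {ι : Type*} [Fintype ι] :
    Integrable fun w : ι → ℝ => Real.exp (-‖w‖) := by
  -- One more than the dimension makes (1 + ‖w‖)^{-n} integrable; the comparison with e^{-‖w‖} is
  -- y^n / n! ≤ e^y at y = 1 + ‖w‖.
  set n := Module.finrank ℝ (ι → ℝ) + 1
  have h := (integrable_one_add_norm (E := ι → ℝ) (μ := volume) (r := n)
    (by simp [n])).const_mul (n.factorial * Real.exp 1)
  refine h.mono' (by fun_prop) (Filter.Eventually.of_forall fun w => ?_)
  have hpos : 0 < 1 + ‖w‖ := by positivity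
  have h1 := Real.pow_div_factorial_le_exp _ hpos.le n
  rw [Real.norm_of_nonneg (Real.exp_pos _).le, Real.rpow_neg hpos.le, Real.rpow_natCast,
    ← div_eq_mul_inv, le_div_iff₀ (by positivity)]
  rw [div_le_iff₀ (by positivity), Real.exp_add] at h1
  calc _ ≤ Real.exp (-‖w‖) * (Real.exp 1 * Real.exp ‖w‖ * n.factorial) := by gcongr
    _ = Real.exp (-‖w‖) * Real.exp ‖w‖ * (n.factorial * Real.exp 1) := by ring
    _ = _ := by rw [← Real.exp_add]; simp

variable (p) in
/-- A positive definite quadratic form, given by a symmetric matrix. -/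
structure GaussForm where
  R : Matrix (Idx p) (Idx p) ℝ
  c : ℝ
  c_pos : 0 < c
  lower : ∀ z : Sp p, c * ‖z‖ ^ 2 ≤ z ⬝ᵥ (R *ᵥ z)
  symm : ∀ k l, R k l = R l k

variable (p) in
/-- Polynomials in the end point `w` (left variables) and the normalized displacement `z` (right
variables). -/
abbrev Symb : Type := MvPolynomial (Idx p ⊕ Idx p) ℝ

/-- Half of the homogeneity exponent. -/
def hw (k : Idx p) : ℝ := (k.1 : ℕ) + 1 / 2

theorem hw_pos (k : Idx p) : 0 < hw k := by unfold hw; positivity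

/-- The dilation of `ℝ^d` with factor `e^θ`. -/
def sc (θ : ℝ) (v : Sp p) : Sp p := fun k => Real.exp (θ * hw k) * v k

theorem sc_neg_sc (θ : ℝ) (v : Sp p) : sc (-θ) (sc θ v) = v := by
  ext k
  simp [sc, ← mul_assoc, ← Real.exp_add]

theorem continuous_sc : Continuous fun q : ℝ × Sp p => sc q.1 q.2 := by
  unfold sc
  fun_prop

theorem hw_le_sum (k : Idx p) : hw k ≤ ∑ l : Idx p, hw l :=
  Finset.single_le_sum (f := hw) (fun l _ => (hw_pos l).le) (Finset.mem_univ k)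

theorem norm_sc_le {θ₁ θ : ℝ} (h1 : 0 ≤ θ₁) (h : θ ≤ θ₁) (v : Sp p) :
    ‖sc θ v‖ ≤ Real.exp (θ₁ * ∑ l : Idx p, hw l) * ‖v‖ := by
  refine (pi_norm_le_iff_of_nonneg (by positivity)).2 fun k => ?_
  rw [sc, norm_mul, Real.norm_of_nonneg (Real.exp_pos _).le]
  have h2 : θ * hw k ≤ θ₁ * ∑ l : Idx p, hw l :=
    (mul_le_mul_of_nonneg_right h (hw_pos k).le).trans
      (mul_le_mul_of_nonneg_left (hw_le_sum k) h1)
  gcongr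
  exact norm_le_pi_norm v k

namespace GaussForm

variable (G : GaussForm p)

/-- The unnormalized Gaussian weight. -/
def wt (z : Sp p) : ℝ := Real.exp (-(1 / 2) * (z ⬝ᵥ (G.R *ᵥ z)))

theorem wt_pos (z : Sp p) : 0 < G.wt z := Real.exp_pos _

theorem continuous_wt : Continuous G.wt := by
  unfold wt
  simp only [Matrix.mulVec, dotProduct]
  fun_prop

theorem wt_le (K : ℝ) : ∃ C, 0 ≤ C ∧ ∀ z, G.wt z ≤ C * Real.exp (-K * ‖z‖) := by
  -- The constant comes from completing the square: -c‖z‖²/2 ≤ -K‖z‖ + K²/(2c).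
  refine ⟨Real.exp (K ^ 2 / (2 * G.c)), (Real.exp_pos _).le, fun z => ?_⟩
  rw [wt, ← Real.exp_add]
  refine Real.exp_le_exp.2 ?_
  have h := G.lower z
  have hc := G.c_pos
  have h2 : 0 ≤ (G.c * ‖z‖ - K) ^ 2 / (2 * G.c) := by positivity
  have h3 : (G.c * ‖z‖ - K) ^ 2 / (2 * G.c) =
      G.c * ‖z‖ ^ 2 / 2 - K * ‖z‖ + K ^ 2 / (2 * G.c) := by
    field_simp
    ring
  linarith

/-- The total mass of the Gaussian weight. -/
def mass : ℝ := ∫ z, G.wt z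

/-- The Gaussian density. -/
def gd (z : Sp p) : ℝ := G.wt z / G.mass

theorem integrable_wt : Integrable G.wt := by
  obtain ⟨C, hC, h⟩ := G.wt_le 1
  refine (integrable_exp_neg_norm.const_mul C).mono' G.continuous_wt.aestronglyMeasurable
    (Filter.Eventually.of_forall fun z => ?_)
  rw [Real.norm_of_nonneg (G.wt_pos z).le]
  simpa using h z

theorem mass_pos : 0 < G.mass := by
  rw [mass, integral_pos_iff_support_of_nonneg (fun z => (G.wt_pos z).le) G.integrable_wt]
  have : Function.support G.wt = univ := by
    ext z; simp [(G.wt_pos z).ne']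
  rw [this]
  exact isOpen_univ.measure_pos volume univ_nonempty

theorem integral_gd : ∫ z, G.gd z = 1 := by
  unfold gd
  rw [integral_div]
  exact div_self G.mass_pos.ne'

theorem continuous_gd : Continuous G.gd := G.continuous_wt.div_const _

theorem gd_nonneg (z : Sp p) : 0 ≤ G.gd z := div_nonneg (G.wt_pos z).le G.mass_pos.le

theorem gd_le (K : ℝ) : ∃ C, 0 ≤ C ∧ ∀ z, G.gd z ≤ C * Real.exp (-K * ‖z‖) := by
  obtain ⟨C, hC, h⟩ := G.wt_le K
  refine ⟨C / G.mass, div_nonneg hC G.mass_pos.le, fun z => ?_⟩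
  rw [gd, div_mul_eq_mul_div]
  exact div_le_div_of_nonneg_right (h z) G.mass_pos.le

theorem hasFDerivAt_gd (z : Sp p) :
    HasFDerivAt G.gd (∑ k, (-(G.R *ᵥ z) k * G.gd z) •
      (ContinuousLinearMap.proj k : Sp p →L[ℝ] ℝ)) z := by
  have h1 : HasFDerivAt (fun z : Sp p => z ⬝ᵥ (G.R *ᵥ z))
      (∑ k, (2 * (G.R *ᵥ z) k) • (ContinuousLinearMap.proj k : Sp p →L[ℝ] ℝ)) z := by
    have h2 : ∀ k, HasFDerivAt (fun z : Sp p => z k)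
        (ContinuousLinearMap.proj k : Sp p →L[ℝ] ℝ) z := fun k => hasFDerivAt_apply k z
    have h3 : ∀ k, HasFDerivAt (fun z : Sp p => (G.R *ᵥ z) k)
        (∑ l, G.R k l • (ContinuousLinearMap.proj l : Sp p →L[ℝ] ℝ)) z := fun k => by
      simp only [Matrix.mulVec, dotProduct]
      exact HasFDerivAt.fun_sum fun l _ => (h2 l).const_mul _
    have h4 : HasFDerivAt (fun z : Sp p => ∑ k, z k * (G.R *ᵥ z) k) _ z :=
      HasFDerivAt.fun_sum fun k (_ : k ∈ Finset.univ) => (h2 k).mul (h3 k)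
    refine h4.congr_fderiv ?_
    rw [Finset.sum_add_distrib]
    simp only [two_mul, add_smul]
    rw [Finset.sum_add_distrib]
    congr 1
    simp only [Finset.smul_sum, smul_smul]
    rw [Finset.sum_comm]
    refine Finset.sum_congr rfl fun k _ => ?_
    rw [← Finset.sum_smul]
    congr 1
    simp only [Matrix.mulVec, dotProduct]
    exact Finset.sum_congr rfl fun l _ => by rw [G.symm k l, mul_comm]
  have h5 := ((h1.const_mul (-(1 / 2))).exp).mul_const (G.mass)⁻¹
  refine (h5.congr_fderiv ?_).congr_of_eventuallyEq
    (Filter.Eventually.of_forall fun z => by rw [gd, wt, div_eq_mul_inv])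
  simp only [Finset.smul_sum, smul_smul]
  refine Finset.sum_congr rfl fun k _ => ?_
  congr 1
  rw [gd, wt]
  ring

end GaussForm

theorem hasFDerivAt_eval_symb (Q : Symb p) (w z : Sp p) :
    HasFDerivAt (fun z : Sp p => MvPolynomial.eval (Sum.elim w z) Q)
      (∑ k, MvPolynomial.eval (Sum.elim w z) (MvPolynomial.pderiv (Sum.inr k) Q) •
        (ContinuousLinearMap.proj k : Sp p →L[ℝ] ℝ)) z := by
  induction Q using MvPolynomial.induction_on with
  | C a => simpa using hasFDerivAt_const a z
  | add P Q hP hQ =>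
    simp only [map_add, add_smul, Finset.sum_add_distrib]
    exact hP.add hQ
  | mul_X Q i hQ =>
    simp only [map_mul, MvPolynomial.eval_X]
    rcases i with i | i
    · refine (hQ.mul_const (w i)).congr_fderiv ?_
      simp only [Finset.smul_sum, smul_smul, Derivation.leibniz, MvPolynomial.pderiv_X]
      refine Finset.sum_congr rfl fun k _ => ?_
      congr 1
      simp
    · refine (hQ.mul (hasFDerivAt_apply (𝕜 := ℝ) i z)).congr_fderiv ?_
      simp only [Derivation.leibniz, MvPolynomial.pderiv_X, Finset.smul_sum, map_add, add_smul,
        Finset.sum_add_distrib, smul_eq_mul, map_mul, MvPolynomial.eval_X, Sum.elim_inr, smul_smul]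
      congr 1
      rw [Finset.sum_eq_single i]
      · simp
      · intro k _ hk
        rw [Pi.single_apply, if_neg (fun h => hk (Sum.inr_injective h).symm)]
        simp
      · simp

theorem continuous_eval_symb (Q : Symb p) :
    Continuous fun q : Sp p × Sp p => MvPolynomial.eval (Sum.elim q.1 q.2) Q := by
  refine (MvPolynomial.continuous_eval Q).comp (continuous_pi fun i => ?_)
  rcases i with i | i <;> simp only [Sum.elim_inl, Sum.elim_inr] <;> fun_prop

theorem eval_symb_le (Q : Symb p) : ∃ C K : ℝ, 0 ≤ C ∧ 0 ≤ K ∧ ∀ w z : Sp p,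
    |MvPolynomial.eval (Sum.elim w z) Q| ≤ C * Real.exp (K * (‖w‖ + ‖z‖)) := by
  induction Q using MvPolynomial.induction_on with
  | C a => exact ⟨|a|, 0, abs_nonneg _, le_rfl, fun w z => by simp⟩
  | add P Q hP hQ =>
    obtain ⟨C, K, hC, hK, h⟩ := hP
    obtain ⟨C', K', hC', hK', h'⟩ := hQ
    refine ⟨C + C', K + K', by positivity, by positivity, fun w z => ?_⟩
    rw [map_add, add_mul]
    refine (abs_add_le _ _).trans (add_le_add ((h w z).trans ?_) ((h' w z).trans ?_)) <;> gcongr <;>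
      linarith
  | mul_X Q i hQ =>
    obtain ⟨C, K, hC, hK, h⟩ := hQ
    refine ⟨C, K + 1, hC, by positivity, fun w z => ?_⟩
    have h1 : |Sum.elim w z i| ≤ Real.exp (‖w‖ + ‖z‖) := by
      have h2 : |Sum.elim w z i| ≤ ‖w‖ + ‖z‖ := by
        rcases i with i | i
        · exact (norm_le_pi_norm w i).trans (le_add_of_nonneg_right (norm_nonneg _))
        · exact (norm_le_pi_norm z i).trans (le_add_of_nonneg_left (norm_nonneg _))
      linarith [Real.add_one_le_exp (‖w‖ + ‖z‖)]
    rw [map_mul, MvPolynomial.eval_X, abs_mul, add_mul, Real.exp_add, one_mul, ← mul_assoc]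
    exact mul_le_mul (h w z) h1 (abs_nonneg _) (by positivity)

/-- Continuous functions of at most exponential growth. -/
structure ExpGrowth (φ : Sp p → ℝ) : Prop where
  cont : Continuous φ
  bound : ∃ C K : ℝ, 0 ≤ C ∧ 0 ≤ K ∧ ∀ x, |φ x| ≤ C * Real.exp (K * ‖x‖)

namespace GaussForm

variable (G : GaussForm p) {φ : Sp p → ℝ}

/-- The integrand `φ(w) Q(w, z) ρ(z)`. -/
def kern (φ : Sp p → ℝ) (Q : Symb p) (w z : Sp p) : ℝ :=
  φ w * (MvPolynomial.eval (Sum.elim w z) Q * G.gd z)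

theorem continuous_kern (hφ : ExpGrowth φ) (Q : Symb p) :
    Continuous fun q : Sp p × Sp p => G.kern φ Q q.1 q.2 :=
  (hφ.cont.comp continuous_fst).mul
    ((continuous_eval_symb Q).mul (G.continuous_gd.comp continuous_snd))

/-- The Gaussian beats every exponential: the rate K in w is fixed first and the decay rate L in z
is arbitrary, so that L can be adapted to dilations afterwards. -/
theorem kern_le (hφ : ExpGrowth φ) (Q : Symb p) : ∃ C K : ℝ, 0 ≤ C ∧ 0 ≤ K ∧ ∀ L : ℝ, 0 ≤ L →
    ∃ D, 0 ≤ D ∧ ∀ w z, |G.kern φ Q w z| ≤ C * D * Real.exp (K * ‖w‖ - L * ‖z‖) := by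
  obtain ⟨C, K, hC, hK, h⟩ := eval_symb_le Q
  obtain ⟨C', K', hC', hK', h'⟩ := hφ.bound
  refine ⟨C' * C, K' + K, by positivity, by positivity, fun L hL => ?_⟩
  obtain ⟨D, hD, h''⟩ := G.gd_le (L + K)
  refine ⟨D, hD, fun w z => ?_⟩
  rw [kern, abs_mul, abs_mul, abs_of_nonneg (G.gd_nonneg z)]
  calc _ ≤ (C' * Real.exp (K' * ‖w‖)) * ((C * Real.exp (K * (‖w‖ + ‖z‖))) *
        (D * Real.exp (-(L + K) * ‖z‖))) := by
        have := G.gd_nonneg z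
        gcongr
        · exact h' w
        · exact h w z
        · exact h'' z
    _ = C' * C * D * (Real.exp (K' * ‖w‖) * (Real.exp (K * (‖w‖ + ‖z‖)) *
        Real.exp (-(L + K) * ‖z‖))) := by ring
    _ = _ := by
      rw [← Real.exp_add, ← Real.exp_add]
      congr 2
      ring

/-- For bounded θ the inverse dilation is bounded by some E, so decay e^{-(K+1)E‖z‖} in z = sc θ (w
- y) is decay of rate K + 1 in w - y; this absorbs e^{K‖w‖} and leaves e^{-‖w‖}. -/
theorem kern_sc_le (hφ : ExpGrowth φ) (Q : Symb p) (θ₁ Y : ℝ) (h1 : 0 ≤ θ₁) :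
    ∃ C, 0 ≤ C ∧ ∀ θ (y w : Sp p), |θ| ≤ θ₁ → ‖y‖ ≤ Y →
      |G.kern φ Q w (sc θ (w - y))| ≤ C * Real.exp (-‖w‖) := by
  obtain ⟨C, K, hC, hK, h⟩ := G.kern_le hφ Q
  set E := Real.exp (θ₁ * ∑ l : Idx p, hw l) with hE
  have hEpos : 0 < E := Real.exp_pos _
  obtain ⟨D, hD, hb⟩ := h ((K + 1) * E) (by positivity)
  refine ⟨C * D * Real.exp ((K + 1) * Y), by positivity, fun θ y w hθ hy => ?_⟩
  refine (hb w _).trans ?_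
  have h2 : ‖w - y‖ ≤ E * ‖sc θ (w - y)‖ := by
    have := norm_sc_le h1 ((neg_le_abs θ).trans hθ) (sc θ (w - y))
    rwa [sc_neg_sc] at this
  have h3 : ‖w‖ ≤ ‖w - y‖ + ‖y‖ := by
    simpa using norm_add_le (w - y) y
  rw [mul_assoc (C * D), ← Real.exp_add]
  gcongr
  nlinarith [mul_le_mul_of_nonneg_left h2 (by positivity : 0 ≤ K + 1)]

end GaussForm

end Kernel

/-! ### Differentiation of Gaussian integrals, expressed on symbols. -/

namespace GaussForm

variable (G : GaussForm p) {φ : Sp p → ℝ}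

/-- The derivative in the `k`-th displacement variable, relative to the Gaussian density. -/
def dh (k : Idx p) : Module.End ℝ (Symb p) :=
  (MvPolynomial.pderiv (Sum.inr k)).toLinearMap -
    LinearMap.mulLeft ℝ (∑ l, MvPolynomial.C (G.R k l) * MvPolynomial.X (Sum.inr l))

theorem eval_dh (k : Idx p) (Q : Symb p) (w z : Sp p) :
    MvPolynomial.eval (Sum.elim w z) (G.dh k Q) =
      MvPolynomial.eval (Sum.elim w z) (MvPolynomial.pderiv (Sum.inr k) Q) -
        (G.R *ᵥ z) k * MvPolynomial.eval (Sum.elim w z) Q := by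
  simp [dh, Matrix.mulVec, dotProduct]

/-- The infinitesimal generator of the dilations, on symbols. -/
def dil (Q : Symb p) : Symb p :=
  (∑ l : Idx p, hw l) • Q + ∑ k, hw k • (MvPolynomial.X (Sum.inr k) * G.dh k Q)

theorem hasFDerivAt_kern (Q : Symb p) (w z : Sp p) :
    HasFDerivAt (fun z => G.kern φ Q w z)
      (∑ k, G.kern φ (G.dh k Q) w z • (ContinuousLinearMap.proj k : Sp p →L[ℝ] ℝ)) z := by
  have h := ((hasFDerivAt_eval_symb Q w z).mul (G.hasFDerivAt_gd z)).const_mul (φ w)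
  refine h.congr_fderiv ?_
  simp only [Finset.smul_sum, smul_smul, ← Finset.sum_add_distrib, ← add_smul]
  refine Finset.sum_congr rfl fun k _ => ?_
  congr 1
  rw [kern, eval_dh]
  ring

theorem hasFDerivAt_sc (θ : ℝ) (w y : Sp p) (k : Idx p) :
    HasFDerivAt (fun q : ℝ × Sp p => sc q.1 (w - q.2) k)
      ((hw k * sc θ (w - y) k) • ContinuousLinearMap.fst ℝ ℝ (Sp p) -
        Real.exp (θ * hw k) • (ContinuousLinearMap.proj k : Sp p →L[ℝ] ℝ).comp
          (ContinuousLinearMap.snd ℝ ℝ (Sp p))) (θ, y) := by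
  have h1 : HasFDerivAt (fun q : ℝ × Sp p => Real.exp (q.1 * hw k))
      (Real.exp (θ * hw k) • (hw k • ContinuousLinearMap.fst ℝ ℝ (Sp p))) (θ, y) :=
    ((hasFDerivAt_fst (𝕜 := ℝ) (p := ((θ, y) : ℝ × Sp p))).mul_const (hw k)).exp
  have h2 : HasFDerivAt (fun q : ℝ × Sp p => (w - q.2) k)
      (-(ContinuousLinearMap.proj k : Sp p →L[ℝ] ℝ).comp
          (ContinuousLinearMap.snd ℝ ℝ (Sp p))) (θ, y) :=
    ((ContinuousLinearMap.proj k : Sp p →L[ℝ] ℝ).comp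
      (ContinuousLinearMap.snd ℝ ℝ (Sp p))).hasFDerivAt.const_sub (w k)
  refine (h1.mul h2).congr_fderiv ?_
  ext q <;> simp [sc]
  ring

/-- The integrand of the Gaussian integrals. -/
def gInt₀ (φ : Sp p → ℝ) (Q : Symb p) (q : ℝ × Sp p) (w : Sp p) : ℝ :=
  Real.exp (q.1 * ∑ l : Idx p, hw l) * G.kern φ Q w (sc q.1 (w - q.2))

theorem kern_dil (Q : Symb p) (w z : Sp p) :
    G.kern φ (G.dil Q) w z = (∑ l : Idx p, hw l) * G.kern φ Q w z +
      ∑ k, hw k * z k * G.kern φ (G.dh k Q) w z := by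
  simp only [kern, dil, map_add, MvPolynomial.smul_eval, map_sum, map_mul, MvPolynomial.eval_X,
    Sum.elim_inr]
  simp only [add_mul, mul_add, Finset.sum_mul, Finset.mul_sum]
  congr 1
  · exact Finset.sum_congr rfl fun k _ => by ring
  · exact Finset.sum_congr rfl fun k _ => by ring

/-- The derivative of the Gaussian integrals and of their integrands, from their values on
symbols. -/
def symbDeriv (Φ : Symb p → ℝ) (Q : Symb p) (θ : ℝ) : ℝ × Sp p →L[ℝ] ℝ :=
  Φ (G.dil Q) • ContinuousLinearMap.fst ℝ ℝ (Sp p) -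
    ∑ k, (Real.exp (θ * hw k) * Φ (G.dh k Q)) •
      (ContinuousLinearMap.proj k : Sp p →L[ℝ] ℝ).comp (ContinuousLinearMap.snd ℝ ℝ (Sp p))

theorem hasFDerivAt_gInt₀ (Q : Symb p) (q : ℝ × Sp p) (w : Sp p) :
    HasFDerivAt (fun q => G.gInt₀ φ Q q w)
      (G.symbDeriv (fun Q => G.gInt₀ φ Q q w) Q q.1) q := by
  obtain ⟨θ, y⟩ := q
  have h1 : HasFDerivAt (fun q : ℝ × Sp p => Real.exp (q.1 * ∑ l : Idx p, hw l))
      (Real.exp (θ * ∑ l : Idx p, hw l) •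
        ((∑ l : Idx p, hw l) • ContinuousLinearMap.fst ℝ ℝ (Sp p))) (θ, y) :=
    ((hasFDerivAt_fst (𝕜 := ℝ) (p := ((θ, y) : ℝ × Sp p))).mul_const _).exp
  have h2 : HasFDerivAt (fun q : ℝ × Sp p => sc q.1 (w - q.2)) _ (θ, y) :=
    hasFDerivAt_pi.2 fun k => hasFDerivAt_sc θ w y k
  have h3 := (G.hasFDerivAt_kern (φ := φ) Q w (sc θ (w - y))).comp (θ, y) h2
  refine (h1.mul h3).congr_fderiv ?_
  refine ContinuousLinearMap.ext fun v => ?_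
  simp only [Function.comp_apply, _root_.add_apply, _root_.smul_apply,
    ContinuousLinearMap.comp_apply, _root_.sum_apply,
    ContinuousLinearMap.proj_apply, ContinuousLinearMap.pi_apply, _root_.sub_apply,
    ContinuousLinearMap.coe_fst', ContinuousLinearMap.coe_snd', smul_eq_mul, symbDeriv, gInt₀,
    kern_dil]
  simp only [mul_add, mul_sub, add_mul, Finset.mul_sum, Finset.sum_mul, Finset.sum_sub_distrib]
  rw [add_comm, add_sub_assoc]
  congr 1
  · exact Finset.sum_congr rfl fun k _ => by ring
  · congr 1
    · exact Finset.sum_congr rfl fun k _ => by ring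
    · exact Finset.sum_congr rfl fun k _ => by ring

theorem continuous_gInt₀ (hφ : ExpGrowth φ) (Q : Symb p) (q : ℝ × Sp p) :
    Continuous (G.gInt₀ φ Q q) := by
  refine continuous_const.mul ((G.continuous_kern hφ Q).comp (continuous_id.prodMk ?_))
  exact continuous_sc.comp (continuous_const.prodMk (continuous_id.sub continuous_const))

theorem gInt₀_le (hφ : ExpGrowth φ) (Q : Symb p) (r : ℝ) : ∃ C, 0 ≤ C ∧
    ∀ q : ℝ × Sp p, ‖q‖ ≤ r → ∀ w, ‖G.gInt₀ φ Q q w‖ ≤ C * Real.exp (-‖w‖) := by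
  obtain ⟨C, hC, h⟩ := G.kern_sc_le hφ Q (max r 0) (max r 0) (le_max_right _ _)
  have hs : 0 ≤ ∑ l : Idx p, hw l := Finset.sum_nonneg fun l _ => (hw_pos l).le
  refine ⟨Real.exp (max r 0 * ∑ l : Idx p, hw l) * C, by positivity, fun q hq w => ?_⟩
  have h1 : |q.1| ≤ max r 0 := ((norm_fst_le q).trans hq).trans (le_max_left _ _)
  have h2 : ‖q.2‖ ≤ max r 0 := ((norm_snd_le q).trans hq).trans (le_max_left _ _)
  rw [gInt₀, norm_mul, Real.norm_of_nonneg (Real.exp_pos _).le, mul_assoc]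
  gcongr
  · exact (le_abs_self _).trans h1
  · exact h _ _ _ h1 h2

theorem integrable_gInt₀ (hφ : ExpGrowth φ) (Q : Symb p) (q : ℝ × Sp p) :
    Integrable (G.gInt₀ φ Q q) := by
  obtain ⟨C, hC, h⟩ := G.gInt₀_le hφ Q ‖q‖
  exact (integrable_exp_neg_norm.const_mul C).mono'
    (G.continuous_gInt₀ hφ Q q).aestronglyMeasurable (Filter.Eventually.of_forall (h q le_rfl))

/-- The Gaussian integrals. -/
def gInt (φ : Sp p → ℝ) (Q : Symb p) (q : ℝ × Sp p) : ℝ := ∫ w, G.gInt₀ φ Q q w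

theorem hasFDerivAt_gInt (hφ : ExpGrowth φ) (Q : Symb p) (q : ℝ × Sp p) :
    HasFDerivAt (G.gInt φ Q) (G.symbDeriv (fun Q => G.gInt φ Q q) Q q.1) q := by
  choose C hC hCb using fun Q => G.gInt₀_le hφ Q (‖q‖ + 1)
  have hball : ∀ q' ∈ Metric.ball q 1, ‖q'‖ ≤ ‖q‖ + 1 := by
    intro q' hq'
    have := norm_le_norm_add_norm_sub q q'
    rw [norm_sub_rev] at this
    rw [Metric.mem_ball, dist_eq_norm] at hq'
    linarith
  have hint : Integrable fun w => G.symbDeriv (fun Q => G.gInt₀ φ Q q w) Q q.1 := by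
    refine Integrable.sub ((G.integrable_gInt₀ hφ _ q).smul_const _) (integrable_finsetSum _
      fun k _ => ((G.integrable_gInt₀ hφ _ q).const_mul _).smul_const _)
  have key := hasFDerivAt_integral_of_dominated_of_fderiv_le (μ := volume) (x₀ := q) (𝕜 := ℝ)
    (F := fun q w => G.gInt₀ φ Q q w)
    (F' := fun q w => G.symbDeriv (fun Q => G.gInt₀ φ Q q w) Q q.1)
    (bound := fun w => (C (G.dil Q) * ‖ContinuousLinearMap.fst ℝ ℝ (Sp p)‖ +
      ∑ k, (Real.exp ((‖q‖ + 1) * hw k) * C (G.dh k Q)) *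
        ‖(ContinuousLinearMap.proj k : Sp p →L[ℝ] ℝ).comp (ContinuousLinearMap.snd ℝ ℝ (Sp p))‖) *
        Real.exp (-‖w‖))
    (Metric.ball_mem_nhds q one_pos)
    (Filter.Eventually.of_forall fun q' => (G.continuous_gInt₀ hφ Q q').aestronglyMeasurable)
    (G.integrable_gInt₀ hφ Q q) hint.aestronglyMeasurable
    (Filter.Eventually.of_forall fun w q' hq' => ?_)
    (integrable_exp_neg_norm.const_mul _)
    (Filter.Eventually.of_forall fun w q' _ => G.hasFDerivAt_gInt₀ Q q' w)
  · refine key.congr_fderiv ?_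
    unfold symbDeriv gInt
    rw [integral_sub ((G.integrable_gInt₀ hφ _ q).smul_const _) (integrable_finsetSum _
      fun k _ => ((G.integrable_gInt₀ hφ _ q).const_mul _).smul_const _),
      integral_smul_const, integral_finsetSum _
      fun k _ => ((G.integrable_gInt₀ hφ _ q).const_mul _).smul_const _]
    simp only [integral_smul_const, integral_const_mul]
  · rw [add_mul, Finset.sum_mul]
    refine (norm_sub_le _ _).trans (add_le_add ?_ ((norm_sum_le _ _).trans
      (Finset.sum_le_sum fun k _ => ?_)))
    · rw [norm_smul, mul_right_comm]
      gcongr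
      exact hCb _ _ (hball q' hq') w
    · have h1 : q'.1 ≤ ‖q‖ + 1 := (le_abs_self _).trans ((norm_fst_le q').trans (hball q' hq'))
      have h2 := hCb (G.dh k Q) _ (hball q' hq') w
      have := hw_pos k
      rw [norm_smul, norm_mul, Real.norm_of_nonneg (Real.exp_pos _).le, mul_right_comm _ _
        (Real.exp (-‖w‖)), mul_assoc (Real.exp ((‖q‖ + 1) * hw k))]
      gcongr

/-- All derivatives fall on the kernel, none on φ, and symbols are stable under `dh` and `dil`; so
the formula of `hasFDerivAt_gInt` can be iterated. -/
theorem contDiff_gInt (hφ : ExpGrowth φ) (Q : Symb p) : ContDiff ℝ ∞ (G.gInt φ Q) := by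
  rw [contDiff_infty]
  intro n
  induction n generalizing Q with
  | zero => exact contDiff_zero.2 (continuous_iff_continuousAt.2
      fun q => (G.hasFDerivAt_gInt hφ Q q).continuousAt)
  | succ n ih =>
    push_cast
    refine contDiff_succ_iff_hasFDerivAt.2 ⟨_, ?_, G.hasFDerivAt_gInt hφ Q⟩
    unfold symbDeriv
    refine ((ih _).smul contDiff_const).sub (ContDiff.sum fun k _ => ?_)
    exact ((Real.contDiff_exp.comp (contDiff_fst.mul contDiff_const)).mul (ih _)).smul
      contDiff_const

/-- The Gaussian integrals as smooth functions of `(θ, y)`, depending linearly on the symbol. -/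
def Phi (hφ : ExpGrowth φ) : Symb p →ₗ[ℝ] Sm (ℝ × Sp p) where
  toFun Q := ⟨G.gInt φ Q, (G.contDiff_gInt hφ Q)⟩
  map_add' P Q := by
    ext q
    change G.gInt φ (P + Q) q = G.gInt φ P q + G.gInt φ Q q
    unfold gInt
    rw [← integral_add (G.integrable_gInt₀ hφ _ q) (G.integrable_gInt₀ hφ _ q)]
    congr 1
    ext w
    simp only [gInt₀, kern, map_add]
    ring
  map_smul' c Q := by
    ext q
    change G.gInt φ (c • Q) q = c * G.gInt φ Q q
    unfold gInt
    rw [← integral_const_mul]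
    congr 1
    ext w
    simp only [gInt₀, kern, MvPolynomial.smul_eval]
    ring

theorem Phi_apply (hφ : ExpGrowth φ) (Q : Symb p) (q : ℝ × Sp p) :
    (G.Phi hφ Q : ℝ × Sp p → ℝ) q = G.gInt φ Q q := rfl

theorem dd_snd_Phi (hφ : ExpGrowth φ) (Q : Symb p) (k : Idx p) (q : ℝ × Sp p) :
    (Sm.dd (0, Pi.single k 1) (G.Phi hφ Q) : ℝ × Sp p → ℝ) q =
      -Real.exp (q.1 * hw k) * G.gInt φ (G.dh k Q) q := by
  rw [Sm.dd_apply]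
  change fderiv ℝ (G.gInt φ Q) q _ = _
  rw [(G.hasFDerivAt_gInt hφ Q q).fderiv]
  simp [symbDeriv, Pi.single_apply]

theorem dd_fst_Phi (hφ : ExpGrowth φ) (Q : Symb p) (q : ℝ × Sp p) :
    (Sm.dd (1, 0) (G.Phi hφ Q) : ℝ × Sp p → ℝ) q = G.gInt φ (G.dil Q) q := by
  rw [Sm.dd_apply]
  change fderiv ℝ (G.gInt φ Q) q _ = _
  rw [(G.hasFDerivAt_gInt hφ Q q).fderiv]
  simp [symbDeriv]

/-- For z = sc θ (w - y) one has y = w - sc (-θ) z; hence multiplication by y also acts on symbols.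
-/
theorem coord_mul_gInt (hφ : ExpGrowth φ) (Q : Symb p) (k : Idx p) (q : ℝ × Sp p) :
    q.2 k * G.gInt φ Q q = G.gInt φ (MvPolynomial.X (Sum.inl k) * Q) q -
      Real.exp (-(q.1 * hw k)) * G.gInt φ (MvPolynomial.X (Sum.inr k) * Q) q := by
  unfold gInt
  rw [← integral_const_mul, ← integral_const_mul, ← integral_sub (G.integrable_gInt₀ hφ _ q)
    ((G.integrable_gInt₀ hφ _ q).const_mul _)]
  congr 1
  ext w
  simp only [gInt₀, kern, map_mul, MvPolynomial.eval_X, Sum.elim_inl, Sum.elim_inr]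
  have : Real.exp (-(q.1 * hw k)) * sc q.1 (w - q.2) k = w k - q.2 k := by
    rw [sc, ← mul_assoc, ← Real.exp_add]
    simp
  linear_combination (Real.exp (q.1 * ∑ l : Idx p, hw l) * φ w *
    MvPolynomial.eval (Sum.elim w (sc q.1 (w - q.2))) Q * G.gd (sc q.1 (w - q.2))) * this

end GaussForm

/-! ### Gaussian integrals in the normalized variable: growth and limit as θ → ∞. -/

namespace GaussForm

variable (G : GaussForm p) {φ : Sp p → ℝ}

theorem integral_sc (g : Sp p → ℝ) (hg : Continuous g) (θ : ℝ) :
    ∫ z, g z = Real.exp (θ * ∑ l : Idx p, hw l) * ∫ w, g (sc θ w) := by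
  classical
  have hdet : (Matrix.diagonal fun k : Idx p => Real.exp (θ * hw k)).det =
      Real.exp (θ * ∑ l : Idx p, hw l) := by
    rw [Matrix.det_diagonal, ← Real.exp_sum, Finset.mul_sum]
  have h := Real.smul_map_diagonal_volume_pi (D := fun k : Idx p => Real.exp (θ * hw k))
    (by rw [hdet]; exact (Real.exp_pos _).ne')
  rw [hdet, abs_of_pos (Real.exp_pos _)] at h
  have hL : ∀ w, Matrix.toLin' (Matrix.diagonal fun k : Idx p => Real.exp (θ * hw k)) w =
      sc θ w := by
    intro w
    ext k
    simp [sc, Matrix.mulVec_diagonal]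
  conv_lhs => rw [← h]
  rw [integral_smul_measure, integral_map (LinearMap.continuous_on_pi _).aemeasurable
    hg.aestronglyMeasurable, ENNReal.toReal_ofReal (Real.exp_pos _).le, smul_eq_mul]
  simp only [hL]

/-- The substitution z = sc θ (w - y) moves θ and y out of the density; its Jacobian is the
exponential prefactor of `gInt₀`. This form suits the limit θ → ∞ and bounds uniform in large θ. -/
theorem gInt_eq (hφ : ExpGrowth φ) (Q : Symb p) (q : ℝ × Sp p) :
    G.gInt φ Q q = ∫ z, G.kern φ Q (q.2 + sc (-q.1) z) z := by
  have hc : Continuous fun z => G.kern φ Q (q.2 + sc (-q.1) z) z :=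
    (G.continuous_kern hφ Q).comp ((continuous_const.add
      (continuous_sc.comp (continuous_const.prodMk continuous_id))).prodMk continuous_id)
  rw [integral_sc _ hc q.1, ← integral_sub_right_eq_self _ q.2, ← integral_const_mul]
  unfold gInt gInt₀
  congr 1
  ext w
  rw [sc_neg_sc, add_sub_cancel]

theorem kern_shift_le (hφ : ExpGrowth φ) (Q : Symb p) {θ₁ : ℝ} (h1 : 0 ≤ θ₁) :
    ∃ C K : ℝ, 0 ≤ C ∧ 0 ≤ K ∧ ∀ q : ℝ × Sp p, -q.1 ≤ θ₁ → ∀ z,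
      ‖G.kern φ Q (q.2 + sc (-q.1) z) z‖ ≤ C * Real.exp (K * ‖q.2‖) * Real.exp (-‖z‖) := by
  obtain ⟨C, K, hC, hK, h⟩ := G.kern_le hφ Q
  set E := Real.exp (θ₁ * ∑ l : Idx p, hw l)
  have hE : 0 < E := Real.exp_pos _
  obtain ⟨D, hD, hb⟩ := h (K * E + 1) (by positivity)
  refine ⟨C * D, K, by positivity, hK, fun q hq z => (hb _ z).trans ?_⟩
  rw [mul_assoc _ (Real.exp _), ← Real.exp_add]
  have h2 := (norm_add_le q.2 (sc (-q.1) z)).trans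
    (add_le_add_right (norm_sc_le h1 hq z) _)
  have h3 := mul_le_mul_of_nonneg_left h2 hK
  gcongr
  linarith

theorem gInt_growth (hφ : ExpGrowth φ) (Q : Symb p) {θ₁ : ℝ} (h1 : 0 ≤ θ₁) :
    ∃ C K : ℝ, 0 ≤ C ∧ 0 ≤ K ∧ ∀ q : ℝ × Sp p, -q.1 ≤ θ₁ →
      |G.gInt φ Q q| ≤ C * Real.exp (K * ‖q.2‖) := by
  obtain ⟨C, K, hC, hK, h⟩ := G.kern_shift_le hφ Q h1
  refine ⟨C * ∫ z : Sp p, Real.exp (-‖z‖), K,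
    mul_nonneg hC (integral_nonneg fun _ => (Real.exp_pos _).le), hK, fun q hq => ?_⟩
  rw [G.gInt_eq hφ, ← Real.norm_eq_abs]
  refine (norm_integral_le_of_norm_le (integrable_exp_neg_norm.const_mul _)
    (Filter.Eventually.of_forall (h q hq))).trans (le_of_eq ?_)
  rw [integral_const_mul]
  ring

theorem tendsto_sc_neg (z : Sp p) :
    Filter.Tendsto (fun θ => sc (-θ) z) Filter.atTop (nhds 0) := by
  refine tendsto_pi_nhds.2 fun k => ?_
  have h1 : Filter.Tendsto (fun θ : ℝ => Real.exp (-θ * hw k)) Filter.atTop (nhds 0) := by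
    refine Real.tendsto_exp_atBot.comp ?_
    simp only [neg_mul]
    exact Filter.tendsto_neg_atTop_atBot.comp (Filter.tendsto_id.atTop_mul_const (hw_pos k))
  simpa [sc] using h1.mul_const (z k)

/-- As θ → ∞ the end point y + sc (-θ) z collapses to x₀. The symbol Q need not have mean one or
zero, so it is φ x₀ = 0 that gives the limit, by dominated convergence. -/
theorem tendsto_gInt (hφ : ExpGrowth φ) (Q : Symb p) {x₀ : Sp p} (h0 : φ x₀ = 0) :
    Filter.Tendsto (G.gInt φ Q) (Filter.atTop ×ˢ nhds x₀) (nhds 0) := by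
  obtain ⟨C, K, hC, hK, h⟩ := G.kern_shift_le hφ Q le_rfl
  have hev : ∀ᶠ q : ℝ × Sp p in Filter.atTop ×ˢ nhds x₀, 0 ≤ q.1 ∧ ‖q.2‖ ≤ ‖x₀‖ + 1 := by
    have h' : ∀ᶠ y in nhds x₀, ‖y‖ ≤ ‖x₀‖ + 1 :=
      (continuous_norm.tendsto x₀).eventually (ge_mem_nhds (by linarith))
    exact (Filter.eventually_ge_atTop (0 : ℝ)).prod_mk h'
  rw [show (G.gInt φ Q) = _ from funext (G.gInt_eq hφ Q)]
  have : (0 : ℝ) = ∫ z : Sp p, G.kern φ Q x₀ z := by simp [kern, h0]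
  rw [this]
  refine tendsto_integral_filter_of_dominated_convergence
    (fun z => C * Real.exp (K * (‖x₀‖ + 1)) * Real.exp (-‖z‖))
    (Filter.Eventually.of_forall fun q => ?_) (hev.mono fun q hq => ?_)
    (integrable_exp_neg_norm.const_mul _) (Filter.Eventually.of_forall fun z => ?_)
  · exact ((G.continuous_kern hφ Q).comp ((continuous_const.add
      (continuous_sc.comp (continuous_const.prodMk continuous_id))).prodMk
        continuous_id)).aestronglyMeasurable
  · refine Filter.Eventually.of_forall fun z => (h q (by linarith [hq.1]) z).trans ?_
    gcongr
    exact hq.2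
  · have h1 : Filter.Tendsto (fun q : ℝ × Sp p => q.2 + sc (-q.1) z) (Filter.atTop ×ˢ nhds x₀)
        (nhds (x₀ + 0)) :=
      Filter.tendsto_snd.add ((tendsto_sc_neg z).comp Filter.tendsto_fst)
    rw [add_zero] at h1
    have h2 : Continuous fun w => G.kern φ Q w z :=
      (G.continuous_kern hφ Q).comp (continuous_id.prodMk continuous_const)
    exact (h2.tendsto x₀).comp h1

theorem ExpGrowth.sub_const (hφ : ExpGrowth φ) (c : ℝ) : ExpGrowth fun x => φ x - c := by
  obtain ⟨C, K, hC, hK, h⟩ := hφ.bound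
  refine ⟨hφ.cont.sub continuous_const, C + |c|, K, by positivity, hK, fun x => ?_⟩
  have h1 : (1 : ℝ) ≤ Real.exp (K * ‖x‖) := Real.one_le_exp (by positivity)
  have h2 : |c| ≤ |c| * Real.exp (K * ‖x‖) := le_mul_of_one_le_right (abs_nonneg c) h1
  rw [add_mul]
  exact (abs_sub _ _).trans (add_le_add (h x) h2)

/-- The symbol 1 integrates to the total mass one of the density. -/
theorem gInt_sub_const (hφ : ExpGrowth φ) (c : ℝ) (q : ℝ × Sp p) :
    G.gInt (fun x => φ x - c) 1 q = G.gInt φ 1 q - c := by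
  have h1 : ∀ ψ : Sp p → ℝ, ∀ z : Sp p, G.kern ψ 1 (q.2 + sc (-q.1) z) z =
      ψ (q.2 + sc (-q.1) z) * G.gd z := fun ψ z => by simp [kern]
  have hi : Integrable fun z => φ (q.2 + sc (-q.1) z) * G.gd z := by
    obtain ⟨C, K, hC, hK, h⟩ := G.kern_shift_le hφ 1 (abs_nonneg q.1)
    replace h := h q (neg_le_abs _)
    simp only [h1] at h
    refine (integrable_exp_neg_norm.const_mul (C * Real.exp (K * ‖q.2‖))).mono' ?_
      (Filter.Eventually.of_forall h)
    exact ((hφ.cont.comp (continuous_const.add (continuous_sc.comp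
      (continuous_const.prodMk continuous_id)))).mul G.continuous_gd).aestronglyMeasurable
  rw [G.gInt_eq (ExpGrowth.sub_const hφ c), G.gInt_eq hφ]
  simp only [h1, sub_mul]
  have hg : Integrable G.gd := G.integrable_wt.div_const _
  rw [integral_sub hi (hg.const_mul c), integral_const_mul,
    G.integral_gd, mul_one]

end GaussForm

/-- The algebra of continuous functions. -/
def contSub (ι : Type*) [TopologicalSpace ι] : Subalgebra ℝ (ι → ℝ) where
  carrier := {c | Continuous c}
  mul_mem' h h' := by simp only [Set.mem_ofPred_eq] at *; exact h.mul h'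
  add_mem' h h' := by simp only [Set.mem_ofPred_eq] at *; exact h.add h'
  algebraMap_mem' a := by simp only [Set.mem_ofPred_eq]; exact continuous_const

theorem mem_contSub {ι : Type*} [TopologicalSpace ι] {c : ι → ℝ} :
    c ∈ contSub ι ↔ Continuous c := Iff.rfl

/-! ### Calculus of smooth functions of (θ, y). -/

namespace Sm

theorem dd_comp {F F' : Type*} [NormedAddCommGroup F] [NormedSpace ℝ F] [NormedAddCommGroup F']
    [NormedSpace ℝ F'] (g : F' → F) (hg : ContDiff ℝ ∞ g) (g' : F' →L[ℝ] F)
    (h : ∀ x, HasFDerivAt g g' x) (v : F') (f : Sm F) :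
    dd v (comp g hg f) = comp g hg (dd (g' v) f) := by
  ext x
  have h1 : HasFDerivAt (fun x => (f : F → ℝ) (g x)) _ x :=
    ((Sm.differentiable f (g x)).hasFDerivAt).comp x (h x)
  rw [dd_apply]
  change fderiv ℝ (fun x => (f : F → ℝ) (g x)) x v = _
  rw [h1.fderiv]
  rfl

/-- The derivatives in the space variables. -/
def dy (k : Idx p) : Module.End ℝ (Sm (ℝ × Sp p)) := dd (0, Pi.single k 1)

/-- The derivative in the time variable. -/
def dθ : Module.End ℝ (Sm (ℝ × Sp p)) := dd (1, 0)

theorem dy_comm (k l : Idx p) (f : Sm (ℝ × Sp p)) : dy k (dy l f) = dy l (dy k f) := dd_comm _ _ _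

theorem dθ_dy (k : Idx p) (f : Sm (ℝ × Sp p)) : dθ (dy k f) = dy k (dθ f) := dd_comm _ _ _

/-- The space coordinates. -/
def yc (k : Idx p) : Sm (ℝ × Sp p) :=
  ⟨fun q => q.2 k, ((contDiff_apply ℝ ℝ k).comp contDiff_snd)⟩

/-- A smooth function of time. -/
def ofTime (c : ℝ → ℝ) (hc : ContDiff ℝ ∞ c) : Sm (ℝ × Sp p) :=
  ⟨fun q => c q.1, (hc.comp contDiff_fst)⟩

theorem dd_yc (k : Idx p) (v : ℝ × Sp p) (q : ℝ × Sp p) :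
    (dd v (yc k) : ℝ × Sp p → ℝ) q = v.2 k := by
  have h : HasFDerivAt (fun q : ℝ × Sp p => q.2 k)
      ((ContinuousLinearMap.proj k : Sp p →L[ℝ] ℝ).comp (ContinuousLinearMap.snd ℝ ℝ (Sp p))) q :=
    ((ContinuousLinearMap.proj k : Sp p →L[ℝ] ℝ).comp
      (ContinuousLinearMap.snd ℝ ℝ (Sp p))).hasFDerivAt
  rw [dd_apply]
  change fderiv ℝ (fun q : ℝ × Sp p => q.2 k) q v = _
  rw [h.fderiv]
  rfl

theorem dd_ofTime (c : ℝ → ℝ) (hc : ContDiff ℝ ∞ c) (v : ℝ × Sp p) (q : ℝ × Sp p) :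
    (dd v (ofTime c hc) : ℝ × Sp p → ℝ) q = deriv c q.1 * v.1 := by
  have h : HasFDerivAt (fun q : ℝ × Sp p => c q.1)
      (deriv c q.1 • ContinuousLinearMap.fst ℝ ℝ (Sp p)) q :=
    ((hc.differentiable (by simp)) q.1).hasDerivAt.comp_hasFDerivAt q hasFDerivAt_fst
  rw [dd_apply]
  change fderiv ℝ (fun q : ℝ × Sp p => c q.1) q v = _
  rw [h.fderiv]
  rfl

theorem dy_ofTime_mul (c : ℝ → ℝ) (hc : ContDiff ℝ ∞ c) (k : Idx p) (f : Sm (ℝ × Sp p)) :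
    dy k (mul (ofTime c hc) f) = mul (ofTime c hc) (dy k f) := by
  rw [dy, dd_mul]
  ext q
  simp [dd_ofTime]

theorem dθ_yc_mul (k : Idx p) (f : Sm (ℝ × Sp p)) :
    dθ (mul (yc k) f) = mul (yc k) (dθ f) := by
  rw [dθ, dd_mul]
  ext q
  simp [dd_yc]

theorem dy_yc_mul (k l : Idx p) (f : Sm (ℝ × Sp p)) :
    dy l (mul (yc k) f) = (Pi.single l 1 : Sp p) k • f + mul (yc k) (dy l f) := by
  rw [dy, dd_mul]
  ext q
  simp [dd_yc]

end Sm

/-! ### The heat operator in (θ, y) and the operators commuting with it. -/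

namespace KolmogorovOp

variable (K : KolmogorovOp p) (ζ : ℝ × Sp p)

open Sm

theorem contDiff_heatC (k l : Idx p) :
    ContDiff ℝ ∞ fun θ : ℝ => Real.exp (-(θ * (hw k + hw l))) * K.covC ζ 1 k l := by
  fun_prop

/-- The covariance at time `e^{-θ}`, as a function of `θ`. -/
def heatQ (k l : Idx p) : Sm (ℝ × Sp p) := ofTime _ (K.contDiff_heatC ζ k l)

/-- The sum of two half exponents `hw` is the degree of homogeneity in `covC_scaling`. -/
theorem heatQ_apply (hB : K.BlockStructure) (k l : Idx p) (q : ℝ × Sp p) :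
    (K.heatQ ζ k l : ℝ × Sp p → ℝ) q = K.covC ζ (Real.exp (-q.1)) k l := by
  rw [covC_scaling K ζ hB.zero, ← Real.exp_nat_mul]
  change Real.exp (-(q.1 * (hw k + hw l))) * K.covC ζ 1 k l = _
  congr 2
  simp only [hw]
  push_cast
  ring

theorem heatQ_symm (hs : ∀ i j z, K.a₂ i j z = K.a₂ j i z) (k l : Idx p) :
    K.heatQ ζ k l = K.heatQ ζ l k := by
  ext q
  change Real.exp (-(q.1 * (hw k + hw l))) * K.covC ζ 1 k l =
    Real.exp (-(q.1 * (hw l + hw k))) * K.covC ζ 1 l k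
  rw [covC_symm K ζ hs, add_comm (hw k)]

/-- The heat operator `∂_θ - ½ ∑ Q'_{kl} ∂_k ∂_l` with time dependent coefficients. -/
def heat : Module.End ℝ (Sm (ℝ × Sp p)) :=
  dθ - (1 / 2 : ℝ) • ∑ k, ∑ l, mul (dθ (K.heatQ ζ k l)) * (dy k * dy l)

theorem dθ_heatQ (k l : Idx p) : ∃ c : ℝ → ℝ, ∃ hc : ContDiff ℝ ∞ c,
    dθ (K.heatQ ζ k l) = (ofTime c hc : Sm (ℝ × Sp p)) := by
  refine ⟨deriv fun θ : ℝ => Real.exp (-(θ * (hw k + hw l))) * K.covC ζ 1 k l,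
    ((contDiff_infty_iff_deriv (𝕜 := ℝ)).1 (K.contDiff_heatC ζ k l)).2, ?_⟩
  ext q
  rw [dθ, heatQ, dd_ofTime]
  simp [ofTime]

theorem heat_apply (f : Sm (ℝ × Sp p)) : K.heat ζ f =
    dθ f - (1 / 2 : ℝ) • ∑ k, ∑ l, mul (dθ (K.heatQ ζ k l)) (dy k (dy l f)) := by
  simp [heat]

/-- The coefficients of the heat operator depend on θ alone. -/
theorem heat_dy (m : Idx p) (f : Sm (ℝ × Sp p)) : K.heat ζ (dy m f) = dy m (K.heat ζ f) := by
  simp only [heat_apply, map_sub, map_smul, map_sum, dθ_dy]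
  congr 2
  refine Finset.sum_congr rfl fun k _ => Finset.sum_congr rfl fun l _ => ?_
  obtain ⟨c, hc, h⟩ := K.dθ_heatQ ζ k l
  rw [h, dy_ofTime_mul, dy_comm l m, dy_comm k m]

theorem heat_heatQ_mul (k l : Idx p) (f : Sm (ℝ × Sp p)) :
    K.heat ζ (mul (K.heatQ ζ k l) f) =
      mul (dθ (K.heatQ ζ k l)) f + mul (K.heatQ ζ k l) (K.heat ζ f) := by
  have h1 : ∀ m (g : Sm (ℝ × Sp p)),
      dy m (mul (K.heatQ ζ k l) g) = mul (K.heatQ ζ k l) (dy m g) := fun m g =>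
    dy_ofTime_mul _ _ _ _
  simp only [heat_apply, map_sub, map_smul, map_sum, h1, mul_comm' _ (K.heatQ ζ k l)]
  have h2 : dθ (mul (K.heatQ ζ k l) f) =
      mul (dθ (K.heatQ ζ k l)) f + mul (K.heatQ ζ k l) (dθ f) := dd_mul _ _ _
  rw [h2, add_sub_assoc]

theorem heat_yc_mul (hs : ∀ i j z, K.a₂ i j z = K.a₂ j i z) (m : Idx p) (f : Sm (ℝ × Sp p)) :
    K.heat ζ (mul (yc m) f) =
      mul (yc m) (K.heat ζ f) - ∑ l, mul (dθ (K.heatQ ζ m l)) (dy l f) := by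
  simp only [heat_apply, dθ_yc_mul, dy_yc_mul, map_add, map_smul, map_sub, map_sum, smul_add,
    Finset.sum_add_distrib]
  -- The two cross terms of the second order Leibniz rule coincide by symmetry of Q, which cancels
  -- the factor ½.
  have h1 : ∑ k, ∑ l, (Pi.single l 1 : Sp p) m • mul (dθ (K.heatQ ζ k l)) (dy k f) =
      ∑ l, mul (dθ (K.heatQ ζ m l)) (dy l f) := by
    refine Finset.sum_congr rfl fun k _ => ?_
    rw [Finset.sum_eq_single m]
    · rw [K.heatQ_symm ζ hs k m]; simp
    · intro l _ hl
      simp [hl.symm]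
    · simp
  have h2 : ∑ k, ∑ l, (Pi.single k 1 : Sp p) m • mul (dθ (K.heatQ ζ k l)) (dy l f) =
      ∑ l, mul (dθ (K.heatQ ζ m l)) (dy l f) := by
    rw [Finset.sum_eq_single m]
    · simp
    · intro k _ hk
      refine Finset.sum_eq_zero fun l _ => ?_
      simp [hk.symm]
    · simp
  have h3 : ∑ k, ∑ l, mul (dθ (K.heatQ ζ k l)) (mul (yc m) (dy k (dy l f))) =
      ∑ k, ∑ l, mul (yc m) (mul (dθ (K.heatQ ζ k l)) (dy k (dy l f))) :=
    Finset.sum_congr rfl fun k _ => Finset.sum_congr rfl fun l _ => mul_comm' _ _ _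
  rw [h1, h2, h3]
  have h4 : ∀ a b c : Sm (ℝ × Sp p), a - ((1 / 2 : ℝ) • b + ((1 / 2 : ℝ) • b + c)) = a - c - b := by
    intro a b c
    rw [← add_assoc, ← add_smul]
    norm_num
    abel
  exact h4 _ _ _

/-- The constants of motion `y + Q ∇_y` of the heat operator. -/
def opX (k : Idx p) : Module.End ℝ (Sm (ℝ × Sp p)) :=
  mul (yc k) + ∑ l, mul (K.heatQ ζ k l) * dy l

/-- The commutator of the heat operator with y_k is -∑ Q'_{kl} ∂_l, and with ∑ Q_{kl} ∂_l it is ∑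
Q'_{kl} ∂_l; they cancel. -/
theorem heat_opX (hs : ∀ i j z, K.a₂ i j z = K.a₂ j i z) (k : Idx p) (f : Sm (ℝ × Sp p)) :
    K.heat ζ (K.opX ζ k f) = K.opX ζ k (K.heat ζ f) := by
  simp only [opX, LinearMap.add_apply, LinearMap.sum_apply, Module.End.mul_apply, map_add, map_sum,
    K.heat_yc_mul ζ hs, heat_heatQ_mul, Finset.sum_add_distrib, heat_dy]
  abel

/-- The operators commuting with the heat operator. -/
def heatCentralizer : Subalgebra ℝ (Module.End ℝ (Sm (ℝ × Sp p))) :=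
  Subalgebra.centralizer ℝ {K.heat ζ}

theorem mem_heatCentralizer {O : Module.End ℝ (Sm (ℝ × Sp p))} :
    O ∈ K.heatCentralizer ζ ↔ ∀ f, K.heat ζ (O f) = O (K.heat ζ f) := by
  rw [heatCentralizer, Subalgebra.mem_centralizer_iff]
  simp only [Set.mem_singleton_iff, forall_eq]
  exact LinearMap.ext_iff

/-- `ℳ(s - t, x)` in the coordinates `(θ, y)`. -/
def heatM (T s : ℝ) (k : Idx p) : Module.End ℝ (Sm (ℝ × Sp p)) :=
  ∑ l, expB K.B (-(T - s)) k l • (K.opX ζ l - ∑ m, K.covC ζ (T - s) l m • dy m)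

/-- `e^{-(s-t)B*} ∇_x` in the coordinates `(θ, y)`. -/
def heatW (T s : ℝ) (k : Idx p) : Module.End ℝ (Sm (ℝ × Sp p)) :=
  ∑ l, expB K.B (T - s) l k • dy l

/-- Time s enters only through the scalar coefficients, while the operators themselves are `opX` and
`dy`, both in the centralizer. -/
theorem heatM_mem_sep (hs : ∀ i j z, K.a₂ i j z = K.a₂ j i z) (T : ℝ) {ι : Type*}
    [TopologicalSpace ι] {s : ι → ℝ} (hsc : Continuous s) (k : Idx p) :
    (fun i => K.heatM ζ T (s i) k) ∈ sep (contSub ι) (K.heatCentralizer ζ).toSubmodule := by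
  have hE := continuous_expB_apply K.B
  have hC := continuous_covC_apply K ζ
  refine sep_sum _ fun l _ => sep_smul (c := fun i => expB K.B (-(T - s i)) k l)
    (mem_contSub.2 (by fun_prop)) (sep_sub (sep_const ?_) (sep_sum _ fun m _ => ?_))
  · exact (K.mem_heatCentralizer ζ).2 (K.heat_opX ζ hs l)
  · exact sep_mk (c := fun i => K.covC ζ (T - s i) l m) (mem_contSub.2 (by fun_prop))
      ((K.mem_heatCentralizer ζ).2 (K.heat_dy ζ m))

theorem heatW_mem_sep (T : ℝ) {ι : Type*} [TopologicalSpace ι] {s : ι → ℝ} (hsc : Continuous s)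
    (k : Idx p) :
    (fun i => K.heatW T (s i) k) ∈ sep (contSub ι) (K.heatCentralizer ζ).toSubmodule := by
  have hE := continuous_expB_apply K.B
  exact sep_sum _ fun l _ => sep_mk (c := fun i => expB K.B (T - s i) l k)
    (mem_contSub.2 (by fun_prop)) ((K.mem_heatCentralizer ζ).2 (K.heat_dy ζ l))

/-- `𝒢_n(t, s, x)` in the coordinates `(θ, y)`. -/
def heatG (T : ℝ) (n : ℕ) (s : ℝ) : Module.End ℝ (Sm (ℝ × Sp p)) :=
  K.genG ζ n s 1 (K.heatM ζ T s) (K.heatW T s)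

theorem heatG_mem_sep (hs : ∀ i j z, K.a₂ i j z = K.a₂ j i z) (T : ℝ) {ι : Type*}
    [TopologicalSpace ι] {s : ι → ℝ} (hsc : Continuous s) (n : ℕ) :
    (fun i => K.heatG ζ T n (s i)) ∈ sep (contSub ι) (K.heatCentralizer ζ).toSubmodule := by
  have h1 := K.heatM_mem_sep ζ hs T hsc
  have h2 := K.heatW_mem_sep ζ T hsc
  have h3 := @genG_mem_sep r p K ζ (Module.End ℝ (Sm (ℝ × Sp p))) _ _ ι (contSub ι)
    (K.heatCentralizer ζ) s (fun _ => 1) (fun _ hc => mem_contSub.2 (hc.comp hsc))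
    (contSub ι).one_mem (fun i => K.heatM ζ T (s i)) (fun i => K.heatW T (s i))
  have := h3 h1 h2 n
  unfold heatG
  exact this

/-! ### Return from (θ, y) to x at a fixed time t. -/

section Slice

/-- The passage from `(θ, y)` to `x` at the time `t = T - τ`. -/
def sliceMap (τ : ℝ) (x : Sp p) : ℝ × Sp p := (-Real.log τ, expB K.B τ *ᵥ x)

theorem hasFDerivAt_sliceMap (τ : ℝ) (x : Sp p) : HasFDerivAt (K.sliceMap τ)
    ((ContinuousLinearMap.inr ℝ ℝ (Sp p)).comp
      (LinearMap.toContinuousLinearMap (Matrix.mulVecLin (expB K.B τ)))) x := by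
  have h := (LinearMap.toContinuousLinearMap (Matrix.mulVecLin (expB K.B τ))).hasFDerivAt (x := x)
  have h2 := (hasFDerivAt_const (-Real.log τ) x).prodMk h
  refine h2.congr_fderiv ?_
  ext v <;> simp

theorem contDiff_sliceMap (τ : ℝ) : ContDiff ℝ ∞ (K.sliceMap τ) :=
  contDiff_const.prodMk
    (LinearMap.toContinuousLinearMap (Matrix.mulVecLin (expB K.B τ))).contDiff

/-- The function of `x` given by a function of `(θ, y)` at the time `t = T - τ`. -/
def slice (τ : ℝ) : Sm (ℝ × Sp p) →ₗ[ℝ] Sm (Sp p) := comp (K.sliceMap τ) (K.contDiff_sliceMap τ)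

theorem slice_apply (τ : ℝ) (f : Sm (ℝ × Sp p)) (x : Sp p) :
    (K.slice τ f : Sp p → ℝ) x = (f : ℝ × Sp p → ℝ) (-Real.log τ, expB K.B τ *ᵥ x) := rfl

theorem dd_slice (τ : ℝ) (m : Idx p) (f : Sm (ℝ × Sp p)) :
    dd (Pi.single m 1) (K.slice τ f) = ∑ n, expB K.B τ n m • K.slice τ (dy n f) := by
  rw [slice, dd_comp _ _ _ (K.hasFDerivAt_sliceMap τ), ← slice]
  have h : ((ContinuousLinearMap.inr ℝ ℝ (Sp p)).comp
      (LinearMap.toContinuousLinearMap (Matrix.mulVecLin (expB K.B τ)))) (Pi.single m 1) =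
      ∑ n, expB K.B τ n m • ((0 : ℝ), (Pi.single n 1 : Sp p)) := by
    refine Prod.ext ?_ ?_
    · simp [Prod.fst_sum]
    · ext i
      simp [Prod.snd_sum, Pi.single_apply]
  rw [h, map_sum, LinearMap.sum_apply, map_sum]
  refine Finset.sum_congr rfl fun n _ => ?_
  rw [map_smul, LinearMap.smul_apply, map_smul]
  rfl

theorem slice_heatW {T t : ℝ} (s : ℝ) (k : Idx p) (f : Sm (ℝ × Sp p)) :
    K.slice (T - t) (K.heatW T s k f) = K.smW (s - t) k (K.slice (T - t) f) := by
  simp only [heatW, smW, LinearMap.sum_apply, LinearMap.smul_apply, map_sum, map_smul, dd_slice,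
    Finset.smul_sum, smul_smul]
  rw [Finset.sum_comm]
  refine Finset.sum_congr rfl fun n _ => ?_
  rw [← Finset.sum_smul]
  congr 1
  have : expB K.B (T - s) = expB K.B (T - t) * expB K.B (-(s - t)) := by
    rw [← expB_add]; congr 1; ring
  rw [this, Matrix.mul_apply]
  refine Finset.sum_congr rfl fun l _ => ?_
  rw [expB_transpose, Matrix.transpose_apply, mul_comm]

/-- The time t enters the left side only through the slice. After evaluation, Q becomes C(T-t), and
C(T-t) - C(T-s) is a conjugate of C(s-t). No order between s and t is needed. -/
theorem slice_heatM (hB : K.BlockStructure) {T t : ℝ} (ht : t < T) (s : ℝ) (k : Idx p)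
    (f : Sm (ℝ × Sp p)) :
    K.slice (T - t) (K.heatM ζ T s k f) = K.smM ζ (s - t) k (K.slice (T - t) f) := by
  ext x
  set τ := T - t with hτ
  set q : ℝ × Sp p := (-Real.log τ, expB K.B τ *ᵥ x) with hq
  set v : Sp p := fun n => (dy n f : ℝ × Sp p → ℝ) q with hv
  have h1 : (K.slice τ (K.heatM ζ T s k f) : Sp p → ℝ) x =
      (expB K.B (-(T - s)) *ᵥ (expB K.B τ *ᵥ x)) k * (f : ℝ × Sp p → ℝ) q +
        (expB K.B (-(T - s)) *ᵥ ((K.covC ζ τ - K.covC ζ (T - s)) *ᵥ v)) k := by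
    rw [slice_apply]
    have hQ : ∀ a b, (K.heatQ ζ a b : ℝ × Sp p → ℝ) q = K.covC ζ τ a b := fun a b => by
      rw [heatQ_apply K ζ hB]
      simp only [hq, neg_neg]
      rw [Real.exp_log (sub_pos.2 ht)]
    simp only [heatM, opX, LinearMap.sum_apply, LinearMap.smul_apply, LinearMap.sub_apply,
      LinearMap.add_apply, Sm.coe_sum, Finset.sum_apply, Sm.coe_smul, Pi.smul_apply,
      Sm.coe_sub, Pi.sub_apply, Sm.coe_add, Pi.add_apply, smul_eq_mul,
      Module.End.mul_apply, mul_apply, ← hq, hQ]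
    simp only [Matrix.mulVec, dotProduct, Matrix.sub_apply, Finset.sum_mul, sub_mul,
      Finset.sum_sub_distrib, mul_add, mul_sub, Finset.sum_add_distrib, Finset.mul_sum]
    rw [add_sub_assoc]
    congr 1
    refine Finset.sum_congr rfl fun l _ => ?_
    change _ * ((expB K.B τ *ᵥ x) l * _) = _
    simp only [Matrix.mulVec, dotProduct, Finset.sum_mul, Finset.mul_sum]
    exact Finset.sum_congr rfl fun m _ => by ring
  have h2 : (K.smM ζ (s - t) k (K.slice τ f) : Sp p → ℝ) x =
      (expB K.B (s - t) *ᵥ x) k * (f : ℝ × Sp p → ℝ) q +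
        (expB K.B (s - t) *ᵥ (K.matM ζ (s - t) *ᵥ ((expB K.B τ)ᵀ *ᵥ v))) k := by
    simp only [smM, LinearMap.sum_apply, LinearMap.smul_apply, LinearMap.add_apply,
      Sm.coe_sum, Finset.sum_apply, Sm.coe_smul, Pi.smul_apply,
      Sm.coe_add, Pi.add_apply, smul_eq_mul, mul_apply, dd_slice, slice_apply, ← hq]
    simp only [Matrix.mulVec, dotProduct, Finset.sum_mul, mul_add, Finset.sum_add_distrib,
      Matrix.transpose_apply, coord_apply, hv]
    congr 1
    exact Finset.sum_congr rfl fun m _ => by ring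
  have e1 : expB K.B (-(T - s)) * expB K.B τ = expB K.B (s - t) := by
    rw [← expB_add]; congr 1; rw [hτ]; ring
  have e2 : expB K.B (-(T - s)) * (K.covC ζ τ - K.covC ζ (T - s)) =
      expB K.B (s - t) * (K.matM ζ (s - t) * (expB K.B τ)ᵀ) := by
    -- With this splitting `covC_add` gives C(τ) - C(T-s) = e^{(T-s)B} C(s-t) e^{(T-s)B*}; the
    -- remaining exponentials recombine into M(s-t).
    have e3 : τ = (T - s) + (s - t) := by rw [hτ]; ring
    have e4 : (expB K.B τ)ᵀ = (expB K.B (s - t))ᵀ * (expB K.B (T - s))ᵀ := by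
      rw [← Matrix.transpose_mul, ← expB_add, ← e3]
    rw [e4, e3, covC_add, add_sub_cancel_left, matM, expB_transpose]
    have e5 : (expB K.B (-(s - t)))ᵀ * (expB K.B (s - t))ᵀ = 1 := by
      rw [← Matrix.transpose_mul, expB_mul_neg, Matrix.transpose_one]
    calc _ = (expB K.B (-(T - s)) * expB K.B (T - s)) * K.covC ζ (s - t) * (expB K.B (T - s))ᵀ := by
          simp only [Matrix.mul_assoc]
      _ = (expB K.B (s - t) * expB K.B (-(s - t))) * K.covC ζ (s - t) *
          ((expB K.B (-(s - t)))ᵀ * (expB K.B (s - t))ᵀ) * (expB K.B (T - s))ᵀ := by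
          rw [expB_neg_mul, expB_mul_neg, e5, Matrix.mul_one]
      _ = _ := by simp only [Matrix.mul_assoc]
  rw [h1, h2]
  simp only [Matrix.mulVec_mulVec]
  rw [e1, e2]

theorem slice_heatG (hB : K.BlockStructure) {T t : ℝ} (ht : t < T) (n : ℕ) (s : ℝ)
    (f : Sm (ℝ × Sp p)) :
    K.slice (T - t) (K.heatG ζ T n s f) = K.smG ζ n t s (K.slice (T - t) f) :=
  K.intertwine_genG ζ (K.slice (T - t)) (K.slice_heatM ζ hB ht s)
    (fun i => K.slice_heatW s (fst₀ i)) n s 1 f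

/-- The product `𝒢_{i_1}(s_1) ⋯ 𝒢_{i_h}(s_h)` in the coordinates `(θ, y)`. -/
def heatProd (T : ℝ) {h : ℕ} (i : Fin h → ℕ) (s : Fin h → ℝ) :
    Module.End ℝ (Sm (ℝ × Sp p)) :=
  ((List.finRange h).map fun k => K.heatG ζ T (i k) (s k)).prod

theorem prodG_slice (hB : K.BlockStructure) {T t : ℝ} (ht : t < T) {h : ℕ} (i : Fin h → ℕ)
    (s : Fin h → ℝ) (f : Sm (ℝ × Sp p)) :
    K.prodG ζ t i s (K.slice (T - t) f : Sp p → ℝ) =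
      (K.slice (T - t) (K.heatProd ζ T i s f) : Sp p → ℝ) := by
  rw [prodG_coe, List.ofFn_eq_map]
  exact congrArg DFunLike.coe (intertwine_list_prod (K.slice (T - t)) (List.finRange h)
    (O := fun k => K.heatG ζ T (i k) (s k)) (O' := fun k => K.smG ζ (i k) t (s k))
    (fun k f => K.slice_heatG ζ hB ht _ _ _) f).symm

theorem heatProd_mem_sep (hs : ∀ i j z, K.a₂ i j z = K.a₂ j i z) (T : ℝ) {h : ℕ}
    (i : Fin h → ℕ) : (fun s : Fin h → ℝ => K.heatProd ζ T i s) ∈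
      sep (contSub (Fin h → ℝ)) (K.heatCentralizer ζ).toSubmodule := by
  have h1 : ∀ k, (fun s : Fin h → ℝ => K.heatG ζ T (i k) (s k)) ∈
      sep (contSub (Fin h → ℝ)) (K.heatCentralizer ζ).toSubmodule := fun k => by
    have := K.heatG_mem_sep ζ hs T (s := fun s : Fin h → ℝ => s k) (continuous_apply k) (i k)
    exact this
  have h2 := @sep_list_prod (Fin h → ℝ) (contSub (Fin h → ℝ)) (Module.End ℝ (Sm (ℝ × Sp p))) _ _
    (K.heatCentralizer ζ) (Fin h) (List.finRange h) (fun s k => K.heatG ζ T (i k) (s k))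
  have := h2 h1
  unfold heatProd
  exact this

theorem heatProd_cons (T : ℝ) {h : ℕ} (n : ℕ) (i : Fin h → ℕ) (σ : ℝ) (s : Fin h → ℝ) :
    K.heatProd ζ T (Fin.cons n i : Fin (h + 1) → ℕ) (Fin.cons σ s : Fin (h + 1) → ℝ) =
      K.heatG ζ T n σ * K.heatProd ζ T i s := by
  simp [heatProd, List.finRange_succ, Function.comp_def]

end Slice

end KolmogorovOp

/-! ### Nested integrals and compositions of an integer. -/

namespace KolmogorovOp

/-- The parameter space X is arbitrary so that the induction can absorb the outermost integration
variable into it. -/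
theorem continuous_nestedIntegral (T : ℝ) {X : Type*} [TopologicalSpace X] (h : ℕ)
    {F : X → (Fin h → ℝ) → ℝ} (hF : Continuous fun q : X × (Fin h → ℝ) => F q.1 q.2)
    {a : X → ℝ} (ha : Continuous a) : Continuous fun x => nestedIntegral T h (a x) (F x) := by
  induction h generalizing X with
  | zero =>
    simp only [nestedIntegral]
    exact hF.comp (continuous_id.prodMk continuous_const)
  | succ h ih =>
    simp only [nestedIntegral]
    have h1 : Continuous fun q : X × ℝ =>
        nestedIntegral T h q.2 fun v => F q.1 (Fin.cons q.2 v) := by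
      refine ih (X := X × ℝ) (F := fun q v => F q.1 (Fin.cons q.2 v)) ?_ continuous_snd
      refine hF.comp ((continuous_fst.comp continuous_fst).prodMk ?_)
      exact Continuous.finCons (A := fun _ => ℝ) (continuous_snd.comp continuous_fst) continuous_snd
    have h2 := intervalIntegral.continuous_parametric_intervalIntegral_of_continuous
      (μ := volume) (a₀ := T) (f := fun x s => nestedIntegral T h s fun v => F x (Fin.cons s v)) h1
          ha
    simp only [intervalIntegral.integral_symm T]
    exact h2.neg

theorem nestedIntegral_sum (T : ℝ) {κ : Type*} (S : Finset κ) (h : ℕ)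
    {F : κ → (Fin h → ℝ) → ℝ} (hF : ∀ m ∈ S, Continuous (F m)) (a : ℝ) :
    nestedIntegral T h a (fun v => ∑ m ∈ S, F m v) = ∑ m ∈ S, nestedIntegral T h a (F m) := by
  induction h generalizing a with
  | zero => rfl
  | succ h ih =>
    have hc : ∀ m ∈ S, Continuous fun q : ℝ × (Fin h → ℝ) => F m (Fin.cons q.1 q.2) := by
      intro m hm
      exact (hF m hm).comp (Continuous.finCons (A := fun _ => ℝ) continuous_fst continuous_snd)
    simp only [nestedIntegral]
    have hi : ∀ m ∈ S, IntervalIntegrable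
        (fun s => nestedIntegral T h s fun v => F m (Fin.cons s v)) volume a T := fun m hm =>
      (continuous_nestedIntegral T h (F := fun s v => F m (Fin.cons s v)) (hc m hm)
        continuous_id).intervalIntegrable _ _
    rw [← intervalIntegral.integral_finsetSum hi]
    congr 1
    ext s
    exact ih (fun m hm => (hc m hm).comp (continuous_const.prodMk continuous_id)) s

/-- The factor (T-t)^h compensates the singularity (T-t)^{-h} of h factors 𝒢; the sharper 1/h! is
not needed. -/
theorem abs_nestedIntegral_le {T t : ℝ} (ht : t ≤ T) (h : ℕ) {F : (Fin h → ℝ) → ℝ} {b : ℝ}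
    (hF : ∀ s : Fin h → ℝ, (∀ k, s k ∈ Icc t T) → |F s| ≤ b) {a : ℝ} (ha : a ∈ Icc t T) :
    |nestedIntegral T h a F| ≤ (T - t) ^ h * b := by
  induction h generalizing a with
  | zero => simpa [nestedIntegral] using hF Fin.elim0 (fun k => k.elim0)
  | succ h ih =>
    rw [nestedIntegral]
    have h1 := intervalIntegral.norm_integral_le_of_norm_le_const (a := a) (b := T)
      (f := fun s => nestedIntegral T h s fun v => F (Fin.cons s v)) (C := (T - t) ^ h * b) ?_
    · rw [Real.norm_eq_abs, abs_of_nonneg (sub_nonneg.2 ha.2)] at h1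
      refine h1.trans ?_
      have hb : 0 ≤ (T - t) ^ h * b := by
        refine mul_nonneg (pow_nonneg (sub_nonneg.2 ht) _) ?_
        exact (abs_nonneg _).trans (hF (fun _ => T) fun _ => ⟨ht, le_rfl⟩)
      calc _ ≤ (T - t) ^ h * b * (T - t) :=
            mul_le_mul_of_nonneg_left (by linarith [ha.1]) hb
        _ = _ := by ring
    · intro s hs
      rw [uIoc_of_le ha.2] at hs
      have hs' : s ∈ Icc t T := ⟨ha.1.trans hs.1.le, hs.2⟩
      refine ih (fun v hv => hF _ fun k => ?_) hs'
      refine Fin.cases ?_ (fun k => ?_) k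
      · simpa using hs'
      · simpa using hv k

theorem mem_compIdx {n h : ℕ} {i : Fin h → ℕ} :
    i ∈ compIdx n h ↔ (∀ k, 1 ≤ i k) ∧ ∑ k, i k = n := by
  simp only [compIdx, Finset.mem_filter, Fintype.mem_piFinset, Finset.mem_Icc]
  constructor
  · rintro ⟨h1, h2⟩
    exact ⟨fun k => (h1 k).1, h2⟩
  · rintro ⟨h1, h2⟩
    refine ⟨fun k => ⟨h1 k, ?_⟩, h2⟩
    rw [← h2]
    exact Finset.single_le_sum (f := i) (fun _ _ => Nat.zero_le _) (Finset.mem_univ k)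

/-- Splitting off the first part matches peeling the outermost integral and the leftmost operator.
-/
theorem sum_compIdx_succ {β : Type*} [AddCommMonoid β] (n h : ℕ) (F : (Fin (h + 1) → ℕ) → β) :
    ∑ i ∈ compIdx n (h + 1), F i =
      ∑ m ∈ Finset.Icc 1 n, ∑ i ∈ compIdx (n - m) h, F (Fin.cons m i) := by
  rw [Finset.sum_sigma']
  refine Finset.sum_nbij' (fun i => ⟨i 0, fun k => i k.succ⟩) (fun q => Fin.cons q.1 q.2)
    ?_ ?_ ?_ ?_ ?_
  · intro i hi
    obtain ⟨h1, h2⟩ := mem_compIdx.1 hi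
    rw [Fin.sum_univ_succ] at h2
    rw [Finset.mem_sigma, Finset.mem_Icc, mem_compIdx]
    have h3 : i 0 ≤ n := by omega
    have h4 : ∑ k : Fin h, i k.succ = n - i 0 := by omega
    exact ⟨⟨h1 0, h3⟩, fun k => h1 k.succ, h4⟩
  · rintro ⟨m, i⟩ hq
    rw [Finset.mem_sigma, Finset.mem_Icc, mem_compIdx] at hq
    simp only at hq
    obtain ⟨⟨h1, h2⟩, h3, h4⟩ := hq
    rw [mem_compIdx, Fin.sum_univ_succ]
    refine ⟨fun k => Fin.cases (by simpa using h1) (fun k => by simpa using h3 k) k, ?_⟩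
    simp only [Fin.cons_zero, Fin.cons_succ, h4]
    omega
  · intro i _
    exact Fin.cons_self_tail i
  · rintro ⟨m, i⟩ _
    simp
  · intro i _
    exact congrArg F (Fin.cons_self_tail i).symm

end KolmogorovOp

/-! ### Primitives of finite rank families of operators. -/

section Primitive

variable {F : Type*} [NormedAddCommGroup F] [NormedSpace ℝ F]
  {U : Subalgebra ℝ (Module.End ℝ (Sm F))}

theorem continuous_sep_coe {ι : Type*} [TopologicalSpace ι] {A' : Submodule ℝ (Sm F)}
    {f : ι → Sm F} (hf : f ∈ sep (contSub ι) A') :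
    Continuous fun q : ι × F => (f q.1 : F → ℝ) q.2 := by
  refine sep_induction (P := fun f : ι → Sm F => Continuous fun q : ι × F => (f q.1 : F → ℝ) q.2)
    (fun c hc m _ => ?_) (fun f f' _ _ h1 h2 => ?_) hf
  · exact ((mem_contSub.1 hc).comp continuous_fst).mul ((Sm.continuous m).comp continuous_snd)
  · exact h1.add h2

theorem sep_apply_const {ι : Type*} {R : Subalgebra ℝ (ι → ℝ)} {O : ι → Module.End ℝ (Sm F)}
    (hO : O ∈ sep R U.toSubmodule) (L : Module.End ℝ (Sm F)) (f : Sm F) :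
    (fun i => L (O i f)) ∈ sep R (⊤ : Submodule ℝ (Sm F)) :=
  sep_map (L ∘ₗ LinearMap.applyₗ f) (fun _ _ => Submodule.mem_top) hO

theorem continuous_sep_apply {ι : Type*} [TopologicalSpace ι] {O : ι → Module.End ℝ (Sm F)}
    (hO : O ∈ sep (contSub ι) U.toSubmodule) (L : Module.End ℝ (Sm F)) (f : Sm F) :
    Continuous fun q : ι × F => (L (O q.1 f) : F → ℝ) q.2 :=
  continuous_sep_coe (sep_apply_const hO L f)

/-- `N` is the primitive `σ ↦ ∫_σ^T O(s) ds`. -/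
structure IsPrimitive (T : ℝ) (O N : ℝ → Module.End ℝ (Sm F)) : Prop where
  integral : ∀ (L : Module.End ℝ (Sm F)) (f : Sm F) (z : F) (σ : ℝ),
    (L (N σ f) : F → ℝ) z = ∫ s in σ..T, (L (O s f) : F → ℝ) z
  hasDerivAt : ∀ (f : Sm F) (z : ℝ → F) (z' : F) (t : ℝ), HasDerivAt z z' t →
    HasDerivAt (fun t' => (N t' f : F → ℝ) (z t'))
      (-(O t f : F → ℝ) (z t) + (Sm.dd z' (N t f) : F → ℝ) (z t)) t

theorem exists_isPrimitive_smul (T : ℝ) {c : ℝ → ℝ} (hc : c ∈ contSub ℝ) {m : Module.End ℝ (Sm F)}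
    (hm : m ∈ U.toSubmodule) : ∃ N ∈ sep (contSub ℝ) U.toSubmodule, IsPrimitive T (fun i => c i •
        m) N := by
  have hc' : Continuous c := mem_contSub.1 hc
  have hd : ∀ t, HasDerivAt (fun σ => ∫ s in σ..T, c s) (-c t) t := fun t =>
    intervalIntegral.integral_hasDerivAt_left (hc'.intervalIntegrable _ _)
      (hc'.stronglyMeasurableAtFilter _ _) hc'.continuousAt
  have hm' := sep_mk (c := fun σ => ∫ s in σ..T, c s)
    (mem_contSub.2 (continuous_iff_continuousAt.2 fun t => (hd t).continuousAt)) hm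
  refine ⟨_, hm', ?_, ?_⟩
  · intro L f z σ
    simp only [LinearMap.smul_apply, map_smul, Sm.coe_smul, Pi.smul_apply, smul_eq_mul]
    rw [intervalIntegral.integral_mul_const]
  · intro f z z' t hz
    have h2 := ((Sm.differentiable (m f) (z t)).hasFDerivAt).comp_hasDerivAt t hz
    have h3 := (hd t).fun_mul h2
    simp only [Function.comp_apply] at h3
    refine h3.congr_deriv ?_
    simp [Sm.dd_apply]

theorem exists_isPrimitive_add (T : ℝ) {O O' : ℝ → Module.End ℝ (Sm F)}
    (hO : O ∈ sep (contSub ℝ) U.toSubmodule) (hO' : O' ∈ sep (contSub ℝ) U.toSubmodule)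
    (h1 : ∃ N ∈ sep (contSub ℝ) U.toSubmodule, IsPrimitive T O N)
    (h2 : ∃ N ∈ sep (contSub ℝ) U.toSubmodule, IsPrimitive T O' N) :
    ∃ N ∈ sep (contSub ℝ) U.toSubmodule, IsPrimitive T (fun i => O i + O' i) N := by
  obtain ⟨N, hN, h1, h1'⟩ := h1
  obtain ⟨N', hN', h2, h2'⟩ := h2
  refine ⟨fun σ => N σ + N' σ, sep_add hN hN', ?_, ?_⟩
  · intro L f z σ
    have hi : ∀ O : ℝ → Module.End ℝ (Sm F), O ∈ sep (contSub ℝ) U.toSubmodule →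
        IntervalIntegrable (fun s => (L (O s f) : F → ℝ) z) volume σ T := fun O hO => by
      exact ((continuous_sep_apply hO L f).comp
        (continuous_id.prodMk (continuous_const (y := z)))).intervalIntegrable _ _
    simp only [LinearMap.add_apply, map_add, Sm.coe_add, Pi.add_apply]
    rw [intervalIntegral.integral_add (hi O hO) (hi O' hO'), h1, h2]
  · intro f z z' t hz
    refine ((h1' f z z' t hz).fun_add (h2' f z z' t hz)).congr_deriv ?_
    simp only [LinearMap.add_apply, map_add, Sm.coe_add, Pi.add_apply]
    ring

/-- For c(s)·m the primitive is (∫ c)·m: only scalars are integrated, and the result keeps its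
values in U, here the centralizer of the heat operator. -/
theorem exists_isPrimitive (T : ℝ) {O : ℝ → Module.End ℝ (Sm F)} (hO : O ∈ sep (contSub ℝ)
    U.toSubmodule) :
    ∃ N ∈ sep (contSub ℝ) U.toSubmodule, IsPrimitive T O N :=
  sep_induction (R := contSub ℝ) (A := U.toSubmodule) (P := fun O => ∃ N ∈ sep (contSub ℝ)
      U.toSubmodule, IsPrimitive T O N)
    (fun _ hc _ hm => exists_isPrimitive_smul T hc hm)
    (fun _ _ hO hO' h1 h2 => exists_isPrimitive_add T hO hO' h1 h2) hO

end Primitive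

/-! ### The operators ℒ_n in the variables (θ, y) and their evolution in time. -/

namespace KolmogorovOp

variable (K : KolmogorovOp p) (ζ : ℝ × Sp p)

open Sm

/-- The iterated integrals of the products of the operators `𝒢_m`, in the coordinates `(θ, y)`. -/
def heatN (T : ℝ) : ℕ → ℕ → ℝ → Module.End ℝ (Sm (ℝ × Sp p))
  | 0, n => fun _ => if n = 0 then 1 else 0
  | h + 1, n => Classical.epsilon fun N => N ∈ sep (contSub ℝ) (K.heatCentralizer ζ).toSubmodule ∧
      IsPrimitive T (fun s => ∑ m ∈ Finset.Icc 1 n, K.heatG ζ T m s * heatN T h (n - m) s) N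

/-- The operator `ℒ_n` in the coordinates `(θ, y)`. -/
def heatV (T : ℝ) (n : ℕ) (σ : ℝ) : Module.End ℝ (Sm (ℝ × Sp p)) :=
  ∑ h ∈ Finset.range (n + 1), K.heatN ζ T h n σ

/-- The choice by `Classical.epsilon` in `heatN` is meaningful as soon as the integrand has finite
rank, since a primitive then exists. -/
theorem heatN_succ_spec (T : ℝ) {h n : ℕ}
    (hO : (fun s => ∑ m ∈ Finset.Icc 1 n, K.heatG ζ T m s * K.heatN ζ T h (n - m) s) ∈
      sep (contSub ℝ) (K.heatCentralizer ζ).toSubmodule) :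
    K.heatN ζ T (h + 1) n ∈ sep (contSub ℝ) (K.heatCentralizer ζ).toSubmodule ∧
      IsPrimitive T (fun s => ∑ m ∈ Finset.Icc 1 n, K.heatG ζ T m s * K.heatN ζ T h (n - m) s)
        (K.heatN ζ T (h + 1) n) := by
  obtain ⟨N, h1, h2⟩ := exists_isPrimitive (U := K.heatCentralizer ζ) T hO
  exact Classical.epsilon_spec (p := fun N => N ∈ sep (contSub ℝ)
    (K.heatCentralizer ζ).toSubmodule ∧ IsPrimitive T (fun s => ∑ m ∈ Finset.Icc 1 n,
      K.heatG ζ T m s * K.heatN ζ T h (n - m) s) N) ⟨N, h1, h2⟩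

variable (hs : ∀ i j z, K.a₂ i j z = K.a₂ j i z)
include hs

theorem sum_heatG_mul_mem_sep (T : ℝ) (n : ℕ) {O : ℕ → ℝ → Module.End ℝ (Sm (ℝ × Sp p))}
    (hO : ∀ n, O n ∈ sep (contSub ℝ) (K.heatCentralizer ζ).toSubmodule) :
    (fun s => ∑ m ∈ Finset.Icc 1 n, K.heatG ζ T m s * O (n - m) s) ∈
      sep (contSub ℝ) (K.heatCentralizer ζ).toSubmodule :=
  sep_sum _ fun m _ => sep_mul (U := K.heatCentralizer ζ)
    (K.heatG_mem_sep ζ hs T continuous_id m) (hO (n - m))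

theorem heatN_mem_sep (T : ℝ) (h n : ℕ) :
    K.heatN ζ T h n ∈ sep (contSub ℝ) (K.heatCentralizer ζ).toSubmodule := by
  induction h generalizing n with
  | zero =>
    by_cases hn : n = 0
    · simp only [heatN, hn, if_true]
      exact sep_const (K.heatCentralizer ζ).one_mem
    · simp only [heatN, hn, if_false]
      exact sep_const (K.heatCentralizer ζ).zero_mem
  | succ h ih => exact (K.heatN_succ_spec ζ T (K.sum_heatG_mul_mem_sep ζ hs T n ih)).1

theorem heatN_isPrimitive (T : ℝ) (h n : ℕ) :
    IsPrimitive T (fun s => ∑ m ∈ Finset.Icc 1 n, K.heatG ζ T m s * K.heatN ζ T h (n - m) s)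
      (K.heatN ζ T (h + 1) n) :=
  (K.heatN_succ_spec ζ T (K.sum_heatG_mul_mem_sep ζ hs T n (K.heatN_mem_sep ζ hs T h))).2

theorem heatV_mem_sep (T : ℝ) (n : ℕ) :
    K.heatV ζ T n ∈ sep (contSub ℝ) (K.heatCentralizer ζ).toSubmodule := by
  have := sep_sum (Finset.range (n + 1)) fun h _ => K.heatN_mem_sep ζ hs T h n
  exact this

theorem continuous_heatProd (T : ℝ) {h : ℕ} (i : Fin h → ℕ) (L : Module.End ℝ (Sm (ℝ × Sp p)))
    (f : Sm (ℝ × Sp p)) (q : ℝ × Sp p) :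
    Continuous fun s : Fin h → ℝ => (L (K.heatProd ζ T i s f) : ℝ × Sp p → ℝ) q := by
  have h2 := continuous_sep_apply (K.heatProd_mem_sep ζ hs T i) L f
  exact Continuous.comp (f := fun s : Fin h → ℝ => (s, q)) h2 (by fun_prop)

/-- The operator L is there for the induction: once the outer integral is peeled off, a factor
`heatG` stands to the left of the inner iterated integral and is merged into L. -/
theorem heatN_apply (T : ℝ) (h n : ℕ) (L : Module.End ℝ (Sm (ℝ × Sp p)))
    (f : Sm (ℝ × Sp p)) (q : ℝ × Sp p) (σ : ℝ) :
    (L (K.heatN ζ T h n σ f) : ℝ × Sp p → ℝ) q = nestedIntegral T h σ fun s =>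
      ∑ i ∈ compIdx n h, (L (K.heatProd ζ T i s f) : ℝ × Sp p → ℝ) q := by
  induction h generalizing n L σ with
  | zero =>
    by_cases hn : n = 0
    · subst hn
      have : compIdx 0 0 = {Fin.elim0} := by
        ext i
        simp [mem_compIdx, eq_iff_true_of_subsingleton]
      simp [heatN, nestedIntegral, this, heatProd]
    · have : compIdx n 0 = ∅ := by
        ext i
        simp [mem_compIdx, Ne.symm hn]
      simp [heatN, nestedIntegral, this, hn]
  | succ h ih =>
    rw [(K.heatN_isPrimitive ζ hs T h n).integral, nestedIntegral]
    congr 1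
    ext s
    simp only [sum_compIdx_succ, heatProd_cons]
    rw [nestedIntegral_sum]
    · simp only [LinearMap.sum_apply, map_sum, Sm.coe_sum, Finset.sum_apply]
      exact Finset.sum_congr rfl fun m _ => ih (n - m) (L * K.heatG ζ T m s) s
    · intro m _
      exact continuous_finsetSum _ fun i _ =>
        K.continuous_heatProd ζ hs T i (L * K.heatG ζ T m s) f q

/-- An integer n has no composition into more than n positive parts. -/
theorem heatN_eq_zero (T : ℝ) {h n : ℕ} (hn : n < h) (σ : ℝ) : K.heatN ζ T h n σ = 0 := by
  ext f q
  have h1 := K.heatN_apply ζ hs T h n 1 f q σ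
  have h2 : compIdx n h = ∅ := by
    refine Finset.eq_empty_of_forall_notMem fun i hi => ?_
    obtain ⟨h3, h4⟩ := mem_compIdx.1 hi
    have : ∑ _k : Fin h, 1 ≤ ∑ k, i k := Finset.sum_le_sum fun k _ => h3 k
    simp at this
    omega
  have h5 := nestedIntegral_sum T (∅ : Finset ℕ) h (F := fun _ _ => 0) (by simp) σ
  simp only [h2, Finset.sum_empty] at h1 h5
  rw [h5] at h1
  simpa using h1

/-- Differentiating the lower limit removes the outermost integral and leaves 𝒢_m at time t in front
of ℒ_{n-m}; the last term is the motion of the evaluation point. This is the Duhamel structure of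
the nested problems. -/
theorem hasDerivAt_heatV (T : ℝ) (n : ℕ) (f : Sm (ℝ × Sp p)) {z : ℝ → ℝ × Sp p} {z' : ℝ × Sp p}
    {t : ℝ} (hz : HasDerivAt z z' t) :
    HasDerivAt (fun t' => (K.heatV ζ T n t' f : ℝ × Sp p → ℝ) (z t'))
      (-∑ m ∈ Finset.Icc 1 n, (K.heatG ζ T m t (K.heatV ζ T (n - m) t f) : ℝ × Sp p → ℝ) (z t) +
        (dd z' (K.heatV ζ T n t f) : ℝ × Sp p → ℝ) (z t)) t := by
  have h0 : HasDerivAt (fun t' => (K.heatN ζ T 0 n t' f : ℝ × Sp p → ℝ) (z t'))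
      ((dd z' (K.heatN ζ T 0 n t f) : ℝ × Sp p → ℝ) (z t)) t :=
    ((Sm.differentiable (K.heatN ζ T 0 n t f) (z t)).hasFDerivAt).comp_hasDerivAt t hz
  have h1 := fun h => (K.heatN_isPrimitive ζ hs T h n).hasDerivAt f z z' t hz
  have h2 := (HasDerivAt.fun_sum fun h (_ : h ∈ Finset.range n) => h1 h).fun_add h0
  have h3 : ∀ t', (K.heatV ζ T n t' f : ℝ × Sp p → ℝ) (z t') =
      ∑ h ∈ Finset.range n, (K.heatN ζ T (h + 1) n t' f : ℝ × Sp p → ℝ) (z t') +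
        (K.heatN ζ T 0 n t' f : ℝ × Sp p → ℝ) (z t') := fun t' => by
    simp [heatV, Finset.sum_range_succ']
  simp only [h3]
  refine h2.congr_deriv ?_
  rw [Finset.sum_add_distrib, add_assoc]
  congr 1
  · rw [Finset.sum_neg_distrib, neg_inj]
    simp only [LinearMap.sum_apply, Sm.coe_sum, Finset.sum_apply]
    rw [Finset.sum_comm]
    refine Finset.sum_congr rfl fun m hm => ?_
    obtain ⟨hm1, hm2⟩ := Finset.mem_Icc.1 hm
    -- Because m ≥ 1, the terms added when the range is enlarged to n have h > n - m and vanish.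
    have h4 : K.heatV ζ T (n - m) t = ∑ h ∈ Finset.range n, K.heatN ζ T h (n - m) t := by
      rw [heatV]
      refine Finset.sum_subset (fun a ha => ?_) fun a _ ha => K.heatN_eq_zero ζ hs T ?_ t
      · simp only [Finset.mem_range] at *; omega
      · simp only [Finset.mem_range] at *; omega
    simp [h4]
  · simp [heatV, Finset.sum_range_succ']

/-- `heatV` also contains the term h = 0, which vanishes for n ≥ 1 and is the identity for n = 0;
`opL` starts at h = 1. -/
theorem opL_slice (hB : K.BlockStructure) {T t : ℝ} (ht : t < T) {n : ℕ} (hn : 1 ≤ n)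
    (f : Sm (ℝ × Sp p)) (x : Sp p) :
    K.opL ζ n t T (K.slice (T - t) f : Sp p → ℝ) x =
      (K.slice (T - t) (K.heatV ζ T n t f) : Sp p → ℝ) x := by
  have h0 : K.heatN ζ T 0 n t = 0 := by simp [heatN]; omega
  have h1 : K.heatV ζ T n t = ∑ h ∈ Finset.Icc 1 n, K.heatN ζ T h n t := by
    rw [heatV, Finset.sum_range_succ', h0, add_zero, ← Finset.Ico_add_one_right_eq_Icc,
      Finset.sum_Ico_eq_sum_range]
    simp [add_comm]
  rw [opL, h1, slice_apply]
  simp only [LinearMap.sum_apply, Sm.coe_sum, Finset.sum_apply, prodG_slice K ζ hB ht]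
  exact Finset.sum_congr rfl fun h _ =>
    (K.heatN_apply ζ hs T h n 1 f (-Real.log (T - t), expB K.B (T - t) *ᵥ x) t).symm

theorem continuous_prodG_slice (hB : K.BlockStructure) {T t : ℝ} (ht : t < T) {h : ℕ}
    (i : Fin h → ℕ) (f : Sm (ℝ × Sp p)) (x : Sp p) :
    Continuous fun s : Fin h → ℝ => K.prodG ζ t i s (K.slice (T - t) f : Sp p → ℝ) x := by
  simp only [prodG_slice K ζ hB ht]
  exact K.continuous_heatProd ζ hs T i 1 f _

end KolmogorovOp

/-! ### The Gaussian integral of the datum solves the heat equation. -/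

namespace GaussForm

variable (G : GaussForm p) {φ : Sp p → ℝ} (K : KolmogorovOp p) (ζ : ℝ × Sp p)

open Sm

/-- The gradient of half the quadratic form, as a symbol. -/
def rho (k : Idx p) : Symb p := ∑ l, MvPolynomial.C (G.R k l) * MvPolynomial.X (Sum.inr l)

theorem dh_apply (k : Idx p) (Q : Symb p) :
    G.dh k Q = MvPolynomial.pderiv (Sum.inr k) Q - G.rho k * Q := rfl

theorem dh_dh_one (k l : Idx p) :
    G.dh k (G.dh l 1) = G.rho k * G.rho l - MvPolynomial.C (G.R l k) := by
  have h : MvPolynomial.pderiv (Sum.inr k) (G.rho l) = MvPolynomial.C (G.R l k) := by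
    simp [rho, MvPolynomial.pderiv_X, Pi.single_apply]
  simp [dh_apply, h]
  ring

theorem dy_Phi (hφ : ExpGrowth φ) (Q : Symb p) (k : Idx p) : dy k (G.Phi hφ Q) =
    -mul (ofTime (fun θ => Real.exp (θ * hw k)) (by fun_prop)) (G.Phi hφ (G.dh k Q)) := by
  ext q
  rw [dy, dd_snd_Phi]
  simp [ofTime, Phi_apply]

theorem dθ_heatQ_apply (k l : Idx p) (q : ℝ × Sp p) :
    (dθ (K.heatQ ζ k l) : ℝ × Sp p → ℝ) q =
      -(hw k + hw l) * (Real.exp (-(q.1 * (hw k + hw l))) * K.covC ζ 1 k l) := by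
  have h : HasDerivAt (fun θ : ℝ => Real.exp (-(θ * (hw k + hw l))) * K.covC ζ 1 k l)
      (Real.exp (-(q.1 * (hw k + hw l))) * (-(1 * (hw k + hw l))) * K.covC ζ 1 k l) q.1 :=
    ((((hasDerivAt_id q.1).mul_const _).neg).exp).mul_const _
  rw [dθ, KolmogorovOp.heatQ, dd_ofTime, h.deriv]
  ring

/-- Each y_k-derivative contributes e^{θ hw k} and Q' contributes e^{-θ(hw k + hw l)}; they cancel,
and the heat operator acts on symbols independently of θ. -/
theorem heat_Phi_apply (hφ : ExpGrowth φ) (Q : Symb p) (q : ℝ × Sp p) :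
    (K.heat ζ (G.Phi hφ Q) : ℝ × Sp p → ℝ) q = G.gInt φ (G.dil Q + (1 / 2 : ℝ) •
      ∑ k, ∑ l, ((hw k + hw l) * K.covC ζ 1 k l) • G.dh k (G.dh l Q)) q := by
  rw [← G.Phi_apply hφ, K.heat_apply]
  simp only [map_add, map_smul, map_sum, Sm.coe_add, Sm.coe_sub, Sm.coe_smul, Sm.coe_sum,
    Pi.add_apply, Pi.sub_apply, Pi.smul_apply, Finset.sum_apply, mul_apply, smul_eq_mul]
  rw [dθ, dd_fst_Phi, Phi_apply, sub_eq_add_neg, ← mul_neg, ← Finset.sum_neg_distrib]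
  congr 2
  refine Finset.sum_congr rfl fun k _ => ?_
  rw [← Finset.sum_neg_distrib]
  refine Finset.sum_congr rfl fun l _ => ?_
  rw [← dθ, dθ_heatQ_apply, dy_Phi, map_neg, dy_ofTime_mul, dy_Phi]
  simp only [map_neg, neg_neg, mul_apply, ofTime, Phi_apply, Sm.coe_mk]
  have : Real.exp (-(q.1 * (hw k + hw l))) * (Real.exp (q.1 * hw l) * Real.exp (q.1 * hw k)) = 1 :=
      by
    rw [← Real.exp_add, ← Real.exp_add, ← Real.exp_zero]
    congr 1
    ring
  linear_combination ((hw k + hw l) * K.covC ζ 1 k l * G.gInt φ (G.dh k (G.dh l Q)) q) * this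

/-- The Gaussian integral of the datum is annihilated by the heat operator. -/
theorem heat_Phi_one (hs : ∀ i j z, K.a₂ i j z = K.a₂ j i z) (hG : K.covC ζ 1 * G.R = 1)
    (hφ : ExpGrowth φ) : K.heat ζ (G.Phi hφ 1) = 0 := by
  set Cv := K.covC ζ 1 with hCv
  have hsym : ∀ k l, Cv k l = Cv l k := covC_symm K ζ hs 1
  have h1 : ∀ k, ∑ l, Cv k l • G.rho l = MvPolynomial.X (Sum.inr k) := fun k => by
    have : ∀ m, ∑ l, Cv k l * G.R l m = (1 : Matrix (Idx p) (Idx p) ℝ) k m := fun m => by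
      rw [← hG, Matrix.mul_apply]
    simp only [rho, MvPolynomial.smul_eq_C_mul, Finset.mul_sum, ← mul_assoc, ← map_mul]
    rw [Finset.sum_comm]
    simp only [← Finset.sum_mul, ← map_sum, this]
    simp [Matrix.one_apply]
  have h2 : ∀ k, ∑ l, Cv k l * G.R l k = 1 := fun k => by
    rw [← Matrix.mul_apply, hG, Matrix.one_apply_eq]
  -- The remaining factors are symmetric in k and l, so hw k + hw l may be replaced by 2 hw k.
  have h3 : ∑ k, ∑ l, ((hw k + hw l) * Cv k l) • G.dh k (G.dh l 1) =
      (2 : ℝ) • ∑ k, ∑ l, (hw k * Cv k l) • G.dh k (G.dh l 1) := by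
    simp only [add_mul, add_smul, Finset.sum_add_distrib, two_smul]
    congr 1
    rw [Finset.sum_comm]
    refine Finset.sum_congr rfl fun k _ => Finset.sum_congr rfl fun l _ => ?_
    rw [hsym l k, dh_dh_one, dh_dh_one, G.symm k l, mul_comm (G.rho l)]
  have h4 : G.dil 1 + (1 / 2 : ℝ) • ∑ k, ∑ l, ((hw k + hw l) * Cv k l) • G.dh k (G.dh l 1) = 0 := by
    rw [h3, smul_smul, dil, Finset.sum_smul, ← Finset.sum_add_distrib]
    norm_num
    rw [← Finset.sum_add_distrib]
    refine Finset.sum_eq_zero fun k _ => ?_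
    -- As Cv is inverse to R, the l-sum collapses to hw k (ρ_k z_k - 1), where ρ = Rz; the dilation
    -- contributes the opposite, hw k (1 - z_k ρ_k).
    have h5 : ∑ l, (hw k * Cv k l) • G.dh k (G.dh l 1) =
        hw k • (G.rho k * MvPolynomial.X (Sum.inr k) - 1) := by
      simp only [dh_dh_one, mul_smul, ← Finset.smul_sum, smul_sub, Finset.sum_sub_distrib,
        ← mul_smul_comm, ← Finset.mul_sum, h1]
      congr 2
      simp only [MvPolynomial.smul_eq_C_mul, ← map_mul, ← map_sum, h2, map_one]
    rw [h5, dh_apply]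
    simp only [Derivation.map_one_eq_zero, mul_one, zero_sub, MvPolynomial.smul_eq_C_mul]
    ring
  ext q
  rw [heat_Phi_apply, h4, ← G.Phi_apply hφ, map_zero]

end GaussForm

namespace KolmogorovOp

theorem exists_gaussForm (K : KolmogorovOp p) (ζ : ℝ × Sp p) {μ M : ℝ} (hA : K.NonDegenerate μ M)
    (hB : K.BlockStructure) : ∃ G : GaussForm p, K.covC ζ 1 * G.R = 1 := by
  obtain ⟨c, hc, h⟩ := exists_covC_inv_lower ζ hA hB
  refine ⟨⟨(K.covC ζ 1)⁻¹, c, hc, h, fun k l => ?_⟩, Matrix.mul_nonsing_inv _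
    (covC_isUnit_det ζ hA hB)⟩
  have h1 : (K.covC ζ 1)ᵀ = K.covC ζ 1 := by
    ext k l
    exact covC_symm K ζ hA.symm 1 l k
  conv_rhs => rw [← h1, ← Matrix.transpose_nonsing_inv, Matrix.transpose_apply]

end KolmogorovOp

/-- On compact sets, families of finite rank are dominated by finitely many of their values. -/
theorem exists_seminorm_le_of_mem_sep {ι M : Type*} [TopologicalSpace ι] [AddCommGroup M]
    [Module ℝ M] {A : Submodule ℝ M} {f : ι → M} (hf : f ∈ sep (contSub ι) A) {Z : Set ι}
    (hZ : IsCompact Z) : ∃ S : Finset M, ∃ C : ℝ, 0 ≤ C ∧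
      ∀ N : Seminorm ℝ M, ∀ i ∈ Z, N (f i) ≤ C * ∑ m ∈ S, N m := by
  classical
  refine sep_induction (P := fun f : ι → M => ∃ S : Finset M, ∃ C : ℝ, 0 ≤ C ∧
      ∀ N : Seminorm ℝ M, ∀ i ∈ Z, N (f i) ≤ C * ∑ m ∈ S, N m)
    (fun c hc m _ => ?_) (fun f f' _ _ h1 h2 => ?_) hf
  · obtain ⟨C, hC⟩ := hZ.exists_bound_of_continuousOn (mem_contSub.1 hc).continuousOn
    refine ⟨{m}, max C 0, le_max_right _ _, fun N i hi => ?_⟩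
    rw [map_smul_eq_mul, Finset.sum_singleton]
    exact mul_le_mul_of_nonneg_right ((hC i hi).trans (le_max_left _ _)) (apply_nonneg _ _)
  · obtain ⟨S, C, hC, h⟩ := h1
    obtain ⟨S', C', hC', h'⟩ := h2
    refine ⟨S ∪ S', C + C', by positivity, fun N i hi => (map_add_le_add _ _ _).trans ?_⟩
    rw [add_mul]
    have hN : ∀ m, 0 ≤ N m := fun m => apply_nonneg _ _
    refine add_le_add ((h N i hi).trans ?_) ((h' N i hi).trans ?_) <;>
    refine mul_le_mul_of_nonneg_left
      (Finset.sum_le_sum_of_subset_of_nonneg (by simp) fun m _ _ => hN m) (by assumption)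

/-! ### The operators 𝒢 on symbols, and the order of their singularity at the final time. -/

namespace GaussForm

variable (G : GaussForm p) {φ : Sp p → ℝ} (K : KolmogorovOp p) (ζ : ℝ × Sp p)

open Sm

/-- The operator `ℳ` on symbols, at the times `t = T - ε²` and `s = T - ρ ε²`. -/
def symM (ε ρ : ℝ) (k : Idx p) : Module.End ℝ (Symb p) :=
  ∑ l, expB K.B (-(ρ * ε ^ 2)) k l • (LinearMap.mulLeft ℝ (MvPolynomial.X (Sum.inl l)) -
    ε ^ sig l • LinearMap.mulLeft ℝ (MvPolynomial.X (Sum.inr l)) -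
    ∑ m, (ε ^ sig l * (1 - ρ ^ ((l.1 : ℕ) + m.1 + 1)) * K.covC ζ 1 l m) • G.dh m)

/-- The operator `ε e^{-(s-t)B*} ∇` on symbols, at the times `t = T - ε²` and `s = T - ρ ε²`. -/
def symW (ρ : ℝ) (k : Idx p) : Module.End ℝ (Symb p) :=
  -∑ l, (ρ ^ (l.1 : ℕ) * expB K.B 1 l k) • G.dh l

/-- The parameter ε = √(T - t) turns the half-integer powers of T - t into integer powers, hence
into functions continuous at ε = 0 once the exponents are nonnegative. -/
theorem exp_neg_log_mul_hw {ε : ℝ} (hε : 0 < ε) (m : Idx p) :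
    Real.exp (-Real.log (ε ^ 2) * hw m) = (ε ^ sig m)⁻¹ := by
  rw [← Real.exp_log (inv_pos.2 (pow_pos hε (sig m))), Real.log_inv, Real.log_pow, Real.log_pow]
  congr 1
  simp only [hw, sig]
  push_cast
  ring

/-- On symbols y_l is w_l - ε^{sig l} z_l and ∂_m is -ε^{-sig m} `dh m`. The factor C(T-t) - C(T-s)
in front of ∂_m carries ε^{sig l + sig m}, so no negative power of ε survives. -/
theorem slice_symM (hB : K.BlockStructure) (hφ : ExpGrowth φ) {T t s ε ρ : ℝ} (hε : 0 < ε)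
    (ht : T - t = ε ^ 2) (hsρ : T - s = ρ * ε ^ 2) (k : Idx p) (Q : Symb p) :
    K.slice (T - t) (G.Phi hφ (G.symM K ζ ε ρ k Q)) =
      K.smM ζ (s - t) k (K.slice (T - t) (G.Phi hφ Q)) := by
  have htT : t < T := sub_pos.1 (by rw [ht]; positivity)
  rw [← K.slice_heatM ζ hB htT]
  ext x
  rw [K.slice_apply, K.slice_apply]
  set q : ℝ × Sp p := (-Real.log (T - t), expB K.B (T - t) *ᵥ x) with hq
  have hq1 : q.1 = -Real.log (ε ^ 2) := by rw [hq, ht]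
  have hd : ∀ m : Idx p, Real.exp (q.1 * hw m) = (ε ^ sig m)⁻¹ := fun m => by
    rw [hq1, exp_neg_log_mul_hw hε]
  have hQ : ∀ l m, (K.heatQ ζ l m : ℝ × Sp p → ℝ) q =
      ε ^ sig l * ε ^ sig m * K.covC ζ 1 l m := fun l m => by
    rw [K.heatQ_apply ζ hB, hq1, neg_neg, Real.exp_log (by positivity), covC_scaling K ζ hB.zero]
    simp only [sig]
    ring
  have hC : ∀ l m, K.covC ζ (T - s) l m =
      ρ ^ ((l.1 : ℕ) + m.1 + 1) * (ε ^ sig l * ε ^ sig m * K.covC ζ 1 l m) := fun l m => by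
    rw [hsρ, covC_scaling K ζ hB.zero, mul_pow]
    simp only [sig]
    ring
  have hX : ∀ l, G.gInt φ (MvPolynomial.X (Sum.inl l) * Q) q =
      (yc l : ℝ × Sp p → ℝ) q * G.gInt φ Q q +
        ε ^ sig l * G.gInt φ (MvPolynomial.X (Sum.inr l) * Q) q := fun l => by
    have h1 := G.coord_mul_gInt hφ Q l q
    rw [Real.exp_neg, hd, inv_inv] at h1
    change _ = q.2 l * _ + _
    linarith
  simp only [symM, KolmogorovOp.heatM, KolmogorovOp.opX, LinearMap.sum_apply, map_sum,
    LinearMap.smul_apply, map_smul, LinearMap.sub_apply, map_sub, LinearMap.add_apply, Sm.coe_sum,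
    Finset.sum_apply, Sm.coe_smul, Sm.coe_sub, Sm.coe_add, Pi.smul_apply, Pi.sub_apply,
    Pi.add_apply, smul_eq_mul, Module.End.mul_apply, mul_apply, LinearMap.mulLeft_apply,
    Phi_apply, hQ, hC, hX]
  refine Finset.sum_congr rfl fun l _ => ?_
  rw [hsρ]
  congr 1
  have h2 : ∀ m, (dy m (G.Phi hφ Q) : ℝ × Sp p → ℝ) q =
      -((ε ^ sig m)⁻¹ * G.gInt φ (G.dh m Q) q) := fun m => by
    rw [dy, dd_snd_Phi, hd, neg_mul]
  simp only [h2]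
  rw [add_sub_cancel_right, add_sub_assoc, sub_eq_add_neg, ← Finset.sum_sub_distrib,
    ← Finset.sum_neg_distrib]
  congr 1
  refine Finset.sum_congr rfl fun m _ => ?_
  have hne : ε ^ sig m ≠ 0 := by positivity
  field_simp
  ring

/-- For a coordinate i of block 0, the entry of e^{(T-s)B} in row l contributes (ρε²)^{block of l},
while ∂_l costs ε^{-sig l}: exactly one power ε^{-1} is left, and the factor ε removes it. -/
theorem slice_symW (hB : K.BlockStructure) (hφ : ExpGrowth φ) {T t s ε ρ : ℝ} (hε : 0 < ε)
    (ht : T - t = ε ^ 2) (hsρ : T - s = ρ * ε ^ 2) (i : Fin (p 0)) (Q : Symb p) :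
    K.slice (T - t) (G.Phi hφ (G.symW K ρ (fst₀ i) Q)) =
      ε • K.smW (s - t) (fst₀ i) (K.slice (T - t) (G.Phi hφ Q)) := by
  rw [← K.slice_heatW s]
  ext x
  rw [Sm.coe_smul, Pi.smul_apply, K.slice_apply, K.slice_apply]
  set q : ℝ × Sp p := (-Real.log (T - t), expB K.B (T - t) *ᵥ x) with hq
  have hq1 : q.1 = -Real.log (ε ^ 2) := by rw [hq, ht]
  simp only [symW, KolmogorovOp.heatW, LinearMap.neg_apply, map_neg, LinearMap.sum_apply, map_sum,
    LinearMap.smul_apply, map_smul, Sm.coe_sum, Sm.coe_neg, Pi.neg_apply,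
    Finset.sum_apply, Sm.coe_smul, Pi.smul_apply, smul_eq_mul, Phi_apply, hsρ]
  rw [← Finset.sum_neg_distrib, Finset.mul_sum]
  refine Finset.sum_congr rfl fun l _ => ?_
  rw [dy, dd_snd_Phi, hq1, exp_neg_log_mul_hw hε,
    expB_scaling_zero hB.zero (ρ * ε ^ 2) (k := l) (l := fst₀ i) rfl, mul_pow]
  simp only [sig]
  field_simp
  ring

/-- The operator `ε² 𝒢_n` on symbols, at the times `t = T - ε²` and `s = T - ρ ε²`. -/
def symG (T ε : ℝ) (n : ℕ) (ρ : ℝ) : Module.End ℝ (Symb p) :=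
  K.genG ζ n (T - ρ * ε ^ 2) ε (G.symM K ζ ε ρ) (G.symW K ρ)

theorem slice_symG (hB : K.BlockStructure) (hφ : ExpGrowth φ) {T t s ε ρ : ℝ} (hε : 0 < ε)
    (ht : T - t = ε ^ 2) (hsρ : T - s = ρ * ε ^ 2) (n : ℕ) (Q : Symb p) :
    K.slice (T - t) (G.Phi hφ (G.symG K ζ T ε n ρ Q)) =
      (ε ^ 2 • K.smG ζ n t s) (K.slice (T - t) (G.Phi hφ Q)) := by
  have h := K.intertwine_genG ζ (K.slice (T - t) ∘ₗ G.Phi hφ)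
    (Wo' := fun k => ε • K.smW (s - t) k)
    (G.slice_symM K ζ hB hφ hε ht hsρ) (G.slice_symW K hB hφ hε ht hsρ) n s ε Q
  rw [K.genG_smul] at h
  rw [symG, show T - ρ * ε ^ 2 = s by linarith]
  exact h

theorem symM_mem_sep {ι : Type*} [TopologicalSpace ι] {ε ρ : ι → ℝ} (hε : Continuous ε)
    (hρ : Continuous ρ) (k : Idx p) : (fun i => G.symM K ζ (ε i) (ρ i) k) ∈
      sep (contSub ι) (⊤ : Subalgebra ℝ (Module.End ℝ (Symb p))).toSubmodule := by
  have hE := continuous_expB_apply K.B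
  refine sep_sum _ fun l _ => sep_smul (c := fun i => expB K.B (-(ρ i * ε i ^ 2)) k l)
    (mem_contSub.2 (by fun_prop)) (sep_sub (sep_sub (sep_const trivial) ?_)
      (sep_sum _ fun m _ => ?_))
  · exact sep_mk (c := fun i => ε i ^ sig l) (mem_contSub.2 (by fun_prop)) trivial
  · exact sep_mk (c := fun i => ε i ^ sig l * (1 - ρ i ^ ((l.1 : ℕ) + m.1 + 1)) * K.covC ζ 1 l m)
      (mem_contSub.2 (by fun_prop)) trivial

theorem symW_mem_sep {ι : Type*} [TopologicalSpace ι] {ρ : ι → ℝ} (hρ : Continuous ρ)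
    (k : Idx p) : (fun i => G.symW K (ρ i) k) ∈
      sep (contSub ι) (⊤ : Subalgebra ℝ (Module.End ℝ (Symb p))).toSubmodule := by
  refine Submodule.neg_mem _ (sep_sum _ fun l _ => ?_)
  exact sep_mk (c := fun i => ρ i ^ (l.1 : ℕ) * expB K.B 1 l k) (mem_contSub.2 (by fun_prop))
      trivial

theorem symG_mem_sep (T : ℝ) {ι : Type*} [TopologicalSpace ι] {ε ρ : ι → ℝ} (hε : Continuous ε)
    (hρ : Continuous ρ) (n : ℕ) : (fun i => G.symG K ζ T (ε i) n (ρ i)) ∈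
      sep (contSub ι) (⊤ : Subalgebra ℝ (Module.End ℝ (Symb p))).toSubmodule := by
  have h3 := @KolmogorovOp.genG_mem_sep r p K ζ (Module.End ℝ (Symb p)) _ _ ι (contSub ι)
    ⊤ (fun i => T - ρ i * ε i ^ 2) ε
    (fun _ hc => mem_contSub.2 (hc.comp (by fun_prop : Continuous fun i => T - ρ i * ε i ^ 2)))
    (mem_contSub.2 hε) (fun i => G.symM K ζ (ε i) (ρ i)) (fun i => G.symW K (ρ i))
  have := h3 (G.symM_mem_sep K ζ hε hρ) (G.symW_mem_sep K hρ) n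
  unfold symG
  exact this

/-- The product of the operators `ε² 𝒢_{i_k}`, on symbols. -/
def symProd (T : ℝ) {h : ℕ} (i : Fin h → ℕ) (a : ℝ × (Fin h → ℝ)) : Module.End ℝ (Symb p) :=
  ((List.finRange h).map fun k => G.symG K ζ T a.1 (i k) (a.2 k)).prod

theorem symProd_mem_sep (T : ℝ) {h : ℕ} (i : Fin h → ℕ) : G.symProd K ζ T i ∈
    sep (contSub (ℝ × (Fin h → ℝ))) (⊤ : Subalgebra ℝ (Module.End ℝ (Symb p))).toSubmodule := by
  have h1 : ∀ k, (fun a : ℝ × (Fin h → ℝ) => G.symG K ζ T a.1 (i k) (a.2 k)) ∈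
      sep (contSub (ℝ × (Fin h → ℝ)))
        (⊤ : Subalgebra ℝ (Module.End ℝ (Symb p))).toSubmodule := fun k => by
    have := G.symG_mem_sep K ζ T (ι := ℝ × (Fin h → ℝ)) (ε := fun a => a.1) (ρ := fun a => a.2 k)
      (by fun_prop) (by fun_prop) (i k)
    exact this
  have h2 := @sep_list_prod (ℝ × (Fin h → ℝ)) (contSub _) (Module.End ℝ (Symb p)) _ _
    ⊤ (Fin h) (List.finRange h) (fun a k => G.symG K ζ T a.1 (i k) (a.2 k))
  have := h2 h1
  unfold symProd
  exact this

theorem slice_symProd (hB : K.BlockStructure) (hφ : ExpGrowth φ) {T t ε : ℝ} (hε : 0 < ε)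
    (ht : T - t = ε ^ 2) {h : ℕ} (i : Fin h → ℕ) {s ρ : Fin h → ℝ}
    (hsρ : ∀ k, T - s k = ρ k * ε ^ 2) (Q : Symb p) :
    K.slice (T - t) (G.Phi hφ (G.symProd K ζ T i (ε, ρ) Q)) =
      ε ^ (2 * h) • (List.ofFn fun k => K.smG ζ (i k) t (s k)).prod
        (K.slice (T - t) (G.Phi hφ Q)) := by
  have h1 := intertwine_list_prod (K.slice (T - t) ∘ₗ G.Phi hφ) (List.finRange h)
    (O := fun k => G.symG K ζ T ε (i k) (ρ k)) (O' := fun k => ε ^ 2 • K.smG ζ (i k) t (s k))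
    (fun k Q => G.slice_symG K ζ hB hφ hε ht (hsρ k) (i k) Q) Q
  have h2 : ∀ (l : List (Fin h)), (l.map fun k => ε ^ 2 • K.smG ζ (i k) t (s k)).prod =
      (ε ^ 2) ^ l.length • (l.map fun k => K.smG ζ (i k) t (s k)).prod := by
    intro l
    induction l with
    | nil => simp
    | cons k l ih =>
      rw [List.map_cons, List.prod_cons, ih, smul_mul_smul_comm, List.map_cons, List.prod_cons,
        List.length_cons, pow_succ' _ l.length]
  rw [h2, List.length_finRange, ← pow_mul, LinearMap.smul_apply] at h1
  rw [List.ofFn_eq_map]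
  exact h1

/-- The products of the operators `𝒢_{i_k}`, applied to a Gaussian integral, have at most a
singularity of order `(T - t)^{-h}` at the final time. -/
theorem exists_prodG_le (hB : K.BlockStructure) {T : ℝ} {h : ℕ} (i : Fin h → ℕ) :
    ∃ S : Finset (Symb p), ∃ C : ℝ, 0 ≤ C ∧ ∀ (φ : Sp p → ℝ) (hφ : ExpGrowth φ), ∀ t ∈ Ico 0 T,
      ∀ s : Fin h → ℝ, (∀ k, s k ∈ Icc t T) → ∀ x,
        (T - t) ^ h * |K.prodG ζ t i s (K.slice (T - t) (G.Phi hφ 1) : Sp p → ℝ) x| ≤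
          C * ∑ Q ∈ S, |G.gInt φ Q (-Real.log (T - t), expB K.B (T - t) *ᵥ x)| := by
  have h1 := sep_map (A' := ⊤) (LinearMap.applyₗ (1 : Symb p)) (fun _ _ => Submodule.mem_top)
    (G.symProd_mem_sep K ζ T i)
  -- The compact box contains ε = 0, whence uniformity up to the final time. The finite set S and
  -- the constant C are found before the datum φ is chosen.
  obtain ⟨S, C, hC, hS⟩ := exists_seminorm_le_of_mem_sep h1
    ((isCompact_Icc (a := (0 : ℝ)) (b := √T)).prod
      (isCompact_Icc (a := (0 : Fin h → ℝ)) (b := 1)))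
  refine ⟨S, C, hC, fun φ hφ t ht s hs x => ?_⟩
  have hτ : 0 < T - t := sub_pos.2 ht.2
  have hε : 0 < √(T - t) := Real.sqrt_pos.2 hτ
  have hsq : T - t = √(T - t) ^ 2 := (Real.sq_sqrt hτ.le).symm
  -- These ratios lie in [0, 1] because t ≤ s_k ≤ T.
  set ρ : Fin h → ℝ := fun k => (T - s k) / (T - t) with hρ
  have h2 := G.slice_symProd K ζ hB hφ hε hsq i (s := s) (ρ := ρ)
    (fun k => by rw [← hsq, hρ]; field_simp) 1
  have h3 := congrArg (fun f : Sm (Sp p) => |f x|) h2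
  simp only [Sm.coe_smul, Pi.smul_apply, smul_eq_mul, abs_mul] at h3
  rw [pow_mul, ← hsq, abs_of_pos (pow_pos hτ h), ← K.prodG_coe] at h3
  rw [← h3]
  -- Evaluation at the given point is linear in the symbol, so its absolute value is a seminorm to
  -- which the compactness bound applies.
  let E : Symb p →ₗ[ℝ] ℝ :=
    { toFun := fun Q => G.Phi hφ Q (-Real.log (T - t), expB K.B (T - t) *ᵥ x)
      map_add' := fun P Q => by simp
      map_smul' := fun c Q => by simp }
  refine hS ((normSeminorm ℝ ℝ).comp E) (√(T - t), ρ) ⟨⟨hε.le, Real.sqrt_le_sqrt (by linarith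
      [ht.1])⟩,
    fun k => ?_, fun k => ?_⟩
  · exact div_nonneg (sub_nonneg.2 (hs k).2) hτ.le
  · exact (div_le_one hτ).2 (by linarith [(hs k).1])

end GaussForm

section SepMem

variable {F : Type*} [NormedAddCommGroup F] [NormedSpace ℝ F]

theorem mem_of_mem_sep {ι M : Type*} [AddCommGroup M] [Module ℝ M] {R : Subalgebra ℝ (ι → ℝ)}
    {A : Submodule ℝ M} {f : ι → M} (hf : f ∈ sep R A) (i : ι) : f i ∈ A :=
  sep_induction (P := fun f => f i ∈ A) (fun _ _ _ hm => A.smul_mem _ hm)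
    (fun _ _ _ _ h1 h2 => A.add_mem h1 h2) hf

end SepMem

/-! ### The candidate solutions satisfy the nested equations. -/

namespace KolmogorovOp

variable (K : KolmogorovOp p) (ζ : ℝ × Sp p)

open Sm

theorem taylorPoly_zero_eval (f : ℝ × Sp p → ℝ) (t : ℝ) (x : Sp p) :
    (K.taylorPoly 0 f ζ t).eval x = f ζ := by
  have h : (Finset.range ((0 : ℤ).toNat + 1) ×ˢ
      Fintype.piFinset fun _ : Idx p => Finset.range ((0 : ℤ).toNat + 1)).filter
        (fun q => 2 * (q.1 : ℤ) + (lenB q.2 : ℤ) ≤ 0) = {(0, fun _ => 0)} := by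
    ext q
    simp only [Finset.mem_filter, Finset.mem_product, Finset.mem_range, Fintype.mem_piFinset,
      Finset.mem_singleton, Int.toNat_zero, zero_add, Nat.lt_one_iff]
    constructor
    · rintro ⟨⟨h1, h2⟩, -⟩
      exact Prod.ext h1 (funext h2)
    · rintro rfl
      simp [lenB]
  have h0 : dxPow (fun _ => 0) f = f := by
    unfold dxPow
    induction idxList p with
    | nil => rfl
    | cons a l _ => simp
  rw [taylorPoly, h]
  simp [h0]

theorem taylorPoly_neg_one (f : ℝ × Sp p → ℝ) (t : ℝ) : K.taylorPoly (-1) f ζ t = 0 := by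
  rw [taylorPoly, Finset.filter_false_of_mem, Finset.sum_empty]
  intro q _
  have : (0 : ℤ) ≤ 2 * (q.1 : ℤ) + (lenB q.2 : ℤ) := by positivity
  omega

/-- The functions `u_n`, in terms of the Gaussian integral `f` and of the final datum. -/
def sol (T : ℝ) (f : Sm (ℝ × Sp p)) (φ : Sp p → ℝ) (n : ℕ) (z : ℝ × Sp p) : ℝ :=
  if z.1 < T then (K.slice (T - z.1) (K.heatV ζ T n z.1 f) : Sp p → ℝ) z.2
  else if n = 0 then φ z.2 else 0

variable {T : ℝ} (f : Sm (ℝ × Sp p)) (φ : Sp p → ℝ) (n : ℕ)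

theorem sol_of_lt {t : ℝ} (ht : t < T) :
    (fun y => K.sol ζ T f φ n (t, y)) = (K.slice (T - t) (K.heatV ζ T n t f) : Sp p → ℝ) := by
  ext y
  simp [sol, ht]

theorem dx_sol {t : ℝ} (ht : t < T) (i : Idx p) :
    (fun y => dx i (K.sol ζ T f φ n) (t, y)) =
      (dd (Pi.single i 1) (K.slice (T - t) (K.heatV ζ T n t f)) : Sp p → ℝ) := by
  ext y
  simp only [dx, K.sol_of_lt ζ f φ n ht]
  exact pd_eq _ _ _

theorem dx_dx_sol {t : ℝ} (ht : t < T) (i j : Idx p) :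
    (fun y => dx i (dx j (K.sol ζ T f φ n)) (t, y)) =
      (dd (Pi.single i 1) (dd (Pi.single j 1)
        (K.slice (T - t) (K.heatV ζ T n t f))) : Sp p → ℝ) := by
  ext y
  rw [dx]
  simp only [K.dx_sol ζ f φ n ht]
  exact pd_eq _ _ _

theorem dxDiff_sol {t : ℝ} (ht : t < T) (i : Idx p) (x : Sp p) :
    DxDiff i (K.sol ζ T f φ n) (t, x) := by
  simp only [DxDiff, K.sol_of_lt ζ f φ n ht]
  exact ((Sm.differentiable _) x).lineDifferentiableAt

theorem dxDiff_dx_sol {t : ℝ} (ht : t < T) (i j : Idx p) (x : Sp p) :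
    DxDiff i (dx j (K.sol ζ T f φ n)) (t, x) := by
  simp only [DxDiff, K.dx_sol ζ f φ n ht]
  exact ((Sm.differentiable _) x).lineDifferentiableAt

theorem dd_dd_slice (τ : ℝ) (i j : Idx p) (g : Sm (ℝ × Sp p)) (x : Sp p) :
    (dd (Pi.single i 1) (dd (Pi.single j 1) (K.slice τ g)) : Sp p → ℝ) x =
      ∑ k, ∑ l, expB K.B τ k i * expB K.B τ l j *
        (K.slice τ (dy k (dy l g)) : Sp p → ℝ) x := by
  simp only [dd_slice, map_sum, map_smul, Sm.coe_sum, Finset.sum_apply, Sm.coe_smul,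
    Pi.smul_apply, smul_eq_mul, Finset.mul_sum]
  rw [Finset.sum_comm]
  exact Finset.sum_congr rfl fun k _ => Finset.sum_congr rfl fun l _ => by ring

/-- The factor (T-t)⁻¹ is dθ/dt. At θ = -log(T-t) the matrix Q' is -(T-t) times e^{(T-t)B} A
e^{(T-t)B*}, and the exponentials convert ∂_y back to ∂_x. -/
theorem dθ_slice_of_heat (hB : K.BlockStructure) {t : ℝ} (ht : t < T) {g : Sm (ℝ × Sp p)}
    (hg : K.heat ζ g = 0) (x : Sp p) :
    (T - t)⁻¹ * (K.slice (T - t) (dθ g) : Sp p → ℝ) x = -(1 / 2 * ∑ i, ∑ j, K.a₂ i j ζ *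
      (dd (Pi.single (fst₀ i) 1) (dd (Pi.single (fst₀ j) 1) (K.slice (T - t) g)) : Sp p → ℝ) x) :=
          by
  have hτ : 0 < T - t := sub_pos.2 ht
  have h1 : dθ g = (1 / 2 : ℝ) • ∑ k, ∑ l, mul (dθ (K.heatQ ζ k l)) (dy k (dy l g)) := by
    rw [heat_apply, sub_eq_zero] at hg
    exact hg
  have h2 : ∀ k l, (dθ (K.heatQ ζ k l) : ℝ × Sp p → ℝ) (-Real.log (T - t), expB K.B (T - t) *ᵥ x) =
      -(T - t) * covDensity K ζ (T - t) k l := fun k l => by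
    have h3 : HasDerivAt (fun θ : ℝ => K.covC ζ (Real.exp (-θ)) k l)
        (covDensity K ζ (T - t) k l * (Real.exp (Real.log (T - t)) * -1)) (-Real.log (T - t)) := by
      have h4 := (hasDerivAt_neg (-Real.log (T - t))).exp
      rw [neg_neg] at h4
      refine HasDerivAt.comp (h₂ := fun u => K.covC ζ u k l) _ ?_ h4
      rw [neg_neg, Real.exp_log hτ]
      exact hasDerivAt_covC K ζ _ k l
    have h5 : (fun θ : ℝ => Real.exp (-(θ * (hw k + hw l))) * K.covC ζ 1 k l) =
        fun θ : ℝ => K.covC ζ (Real.exp (-θ)) k l :=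
      funext fun θ => K.heatQ_apply ζ hB k l (θ, 0)
    rw [dθ, heatQ, dd_ofTime, h5, h3.deriv, Real.exp_log hτ]
    ring
  simp only [K.dd_dd_slice]
  rw [h1]
  simp only [slice_apply, Sm.coe_smul, Pi.smul_apply, Sm.coe_sum, Finset.sum_apply, mul_apply,
    smul_eq_mul, h2, covDensity_apply]
  have h6 : ∀ F : Idx p → Idx p → ℝ, ∑ k, ∑ l, (-(T - t) * ∑ i, ∑ j, K.a₂ i j ζ *
      (expB K.B (T - t) k (fst₀ i) * expB K.B (T - t) l (fst₀ j))) * F k l =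
      -(T - t) * ∑ i, ∑ j, K.a₂ i j ζ * ∑ k, ∑ l, expB K.B (T - t) k (fst₀ i) *
        expB K.B (T - t) l (fst₀ j) * F k l := fun F => by
    simp only [Finset.mul_sum, Finset.sum_mul]
    simp_rw [Finset.sum_comm (s := (Finset.univ : Finset (Idx p))) (t := (Finset.univ : Finset (Fin
        (p 0))))]
    refine Finset.sum_congr rfl fun i _ => Finset.sum_congr rfl fun j _ => Finset.sum_congr rfl
      fun k _ => Finset.sum_congr rfl fun l _ => by ring
  rw [h6]
  field_simp

variable (hs : ∀ i j z, K.a₂ i j z = K.a₂ j i z)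
include hs

theorem continuousOn_slice_heatV (L : Module.End ℝ (Sm (ℝ × Sp p))) :
    ContinuousOn (fun z : ℝ × Sp p =>
      (K.slice (T - z.1) (L (K.heatV ζ T n z.1 f)) : Sp p → ℝ) z.2) {z | z.1 < T} := by
  have h2 := continuous_sep_apply (K.heatV_mem_sep ζ hs T n) L f
  simp only [slice_apply]
  have hE := continuous_expB_apply K.B
  set g : ℝ × Sp p → ℝ × (ℝ × Sp p) := fun z =>
    (z.1, (-Real.log (T - z.1), expB K.B (T - z.1) *ᵥ z.2))
  have h3 : ContinuousOn g {z | z.1 < T} := by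
    refine continuousOn_fst.prodMk (ContinuousOn.prodMk (ContinuousOn.neg ?_) ?_)
    · exact ContinuousOn.log (by fun_prop) fun z hz => (sub_pos.2 hz).ne'
    · refine Continuous.continuousOn (continuous_pi fun k => ?_)
      simp only [Matrix.mulVec, dotProduct]
      fun_prop
  exact ContinuousOn.congr (f := (fun q : ℝ × (ℝ × Sp p) =>
    (L (K.heatV ζ T n q.1 f) : ℝ × Sp p → ℝ) q.2) ∘ g) (h2.comp_continuousOn h3) fun z _ => rfl

theorem continuousOn_sol : ContinuousOn (K.sol ζ T f φ n) {z | z.1 < T} :=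
  (K.continuousOn_slice_heatV ζ f n hs 1).congr fun z hz => congrFun (K.sol_of_lt ζ f φ n hz) z.2

theorem continuousOn_dx_sol (i : Idx p) : ContinuousOn (dx i (K.sol ζ T f φ n)) {z | z.1 < T} := by
  have hE := continuous_expB_apply K.B
  have h : ContinuousOn (fun z : ℝ × Sp p => ∑ k, expB K.B (T - z.1) k i *
      (K.slice (T - z.1) (dy k (K.heatV ζ T n z.1 f)) : Sp p → ℝ) z.2) {z | z.1 < T} :=
    continuousOn_finsetSum _ fun k _ => ContinuousOn.mul (by fun_prop)
      (K.continuousOn_slice_heatV ζ f n hs (dy k))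
  refine h.congr fun z hz => (congrFun (K.dx_sol ζ f φ n hz i) z.2).trans ?_
  rw [dd_slice]
  simp

theorem continuousOn_dx_dx_sol (i j : Idx p) :
    ContinuousOn (dx i (dx j (K.sol ζ T f φ n))) {z | z.1 < T} := by
  have hE := continuous_expB_apply K.B
  have h : ContinuousOn (fun z : ℝ × Sp p => ∑ k, ∑ l, expB K.B (T - z.1) k i *
      expB K.B (T - z.1) l j *
      (K.slice (T - z.1) (dy k (dy l (K.heatV ζ T n z.1 f))) : Sp p → ℝ) z.2) {z | z.1 < T} :=
    continuousOn_finsetSum _ fun k _ => continuousOn_finsetSum _ fun l _ =>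
      ContinuousOn.mul (by fun_prop) (K.continuousOn_slice_heatV ζ f n hs (dy k * dy l))
  refine h.congr fun z hz => (congrFun (K.dx_dx_sol ζ f φ n hz i j) z.2).trans ?_
  rw [K.dd_dd_slice]

theorem heat_heatV (hf : K.heat ζ f = 0) (t : ℝ) : K.heat ζ (K.heatV ζ T n t f) = 0 := by
  have h := mem_of_mem_sep (K.heatV_mem_sep ζ hs T n) t
  rw [(K.mem_heatCentralizer ζ).1 h, hf, map_zero]

/-- Along a curve of Y the variable y stays fixed, so only θ and the lower limit of the iterated
integrals move. The former gives the second order term through the heat equation, the latter the sum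
of the 𝒢_m(t,t,x). -/
theorem lieY_sol (hB : K.BlockStructure) (hf : K.heat ζ f = 0) {t : ℝ} (ht : t < T) (x : Sp p) :
    HasDerivAt (alongY K.B (K.sol ζ T f φ n) (t, x))
      (-∑ m ∈ Finset.Icc 1 n, (K.smG ζ m t t (K.slice (T - t) (K.heatV ζ T (n - m) t f)) :
          Sp p → ℝ) x - 1 / 2 * ∑ i, ∑ j, K.a₂ i j ζ * dx (fst₀ i) (dx (fst₀ j)
            (K.sol ζ T f φ n)) (t, x)) t := by
  have hτ : 0 < T - t := sub_pos.2 ht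
  have h1 : HasDerivAt (fun t' : ℝ => ((-Real.log (T - t'), expB K.B (T - t) *ᵥ x) : ℝ × Sp p))
      ((T - t)⁻¹, 0) t := by
    have h2 : HasDerivAt (fun t' : ℝ => -Real.log (T - t')) ((T - t)⁻¹) t := by
      refine (((hasDerivAt_id t).const_sub T).log hτ.ne').neg.congr_deriv ?_
      simp [div_eq_mul_inv]
    exact h2.prodMk (hasDerivAt_const t _)
  have h3 := K.hasDerivAt_heatV ζ hs T n f h1
  -- Here e^{(T-t')B} e^{(t'-t)B} x = e^{(T-t)B} x, independently of t'.
  have h4 : alongY K.B (K.sol ζ T f φ n) (t, x) =ᶠ[nhds t] fun t' =>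
      (K.heatV ζ T n t' f : ℝ × Sp p → ℝ) (-Real.log (T - t'), expB K.B (T - t) *ᵥ x) := by
    filter_upwards [eventually_lt_nhds ht] with t' ht'
    rw [alongY, congrFun (K.sol_of_lt ζ f φ n ht') _, slice_apply, Matrix.mulVec_mulVec, ← expB_add]
    congr 4
    ring
  refine (h3.congr_of_eventuallyEq h4).congr_deriv ?_
  refine Eq.trans ?_ (sub_eq_add_neg _ _).symm
  congr 1
  · congr 1
    refine Finset.sum_congr rfl fun m _ => ?_
    rw [← K.slice_heatG ζ hB ht, slice_apply]
  · have h5 := K.dθ_slice_of_heat ζ hB ht (K.heat_heatV ζ (T := T) f n hs hf t) x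
    have h6 : ∀ i j, dx (fst₀ i) (dx (fst₀ j) (K.sol ζ T f φ n)) (t, x) = _ := fun i j =>
      congrFun (K.dx_dx_sol ζ f φ n ht (fst₀ i) (fst₀ j)) x
    simp only [h6]
    rw [← h5, slice_apply]
    have h7 : (((T - t)⁻¹, 0) : ℝ × Sp p) = (T - t)⁻¹ • (1, 0) := by simp
    rw [h7, map_smul]
    rfl

/-- The two-sided derivative of `lieY_sol` restricts to the one within [0, ∞), and `smG_self`
identifies the sum; for n = 0 that sum is empty. -/
theorem approx_zero_sol (hB : K.BlockStructure) (hf : K.heat ζ f = 0) {t : ℝ} (ht : t ∈ Ico 0 T)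
    (x : Sp p) : K.approx ζ 0 (K.sol ζ T f φ n) (t, x) =
      -∑ h ∈ Finset.Icc 1 n, (K.approx ζ h (K.sol ζ T f φ (n - h)) (t, x) -
        K.approx ζ ((h : ℤ) - 1) (K.sol ζ T f φ (n - h)) (t, x)) := by
  have h1 : lieY K.B (Ici 0) (K.sol ζ T f φ n) (t, x) = _ :=
    ((K.lieY_sol ζ f φ n hs hB hf ht.2 x).hasDerivWithinAt (s := Ici 0)).derivWithin
      (uniqueDiffOn_Ici 0 t ht.1)
  rw [approx]
  simp only [taylorPoly_zero_eval, zero_sub, taylorPoly_neg_one, map_zero, zero_mul,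
    Finset.sum_const_zero, add_zero]
  rw [h1, add_sub_cancel, neg_inj]
  refine Finset.sum_congr rfl fun m _ => ?_
  have h2 : ∀ i j, dx (fst₀ i) (dx (fst₀ j) (K.sol ζ T f φ (n - m))) (t, x) = _ := fun i j =>
      congrFun (K.dx_dx_sol ζ f φ (n - m) ht.2 (fst₀ i) (fst₀ j)) x
  have h3 : ∀ i, dx (fst₀ i) (K.sol ζ T f φ (n - m)) (t, x) = _ := fun i =>
      congrFun (K.dx_sol ζ f φ (n - m) ht.2 (fst₀ i)) x
  rw [smG_self, approx, approx]
  simp only [h2, h3, sub_mul, Finset.sum_sub_distrib, sub_sub]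
  norm_num
  ring

end KolmogorovOp

/-! ### Growth and continuity up to the final time; existence. -/

namespace KolmogorovOp

variable (K : KolmogorovOp p) (ζ : ℝ × Sp p)

open Sm

/-- The products of operators `𝒢` do not see the addition of constants to the datum. -/
theorem prodG_sub_const (G : GaussForm p) {φ : Sp p → ℝ} (hφ : ExpGrowth φ) (c : ℝ) {t : ℝ}
    (τ : ℝ) {h : ℕ} (hh : 1 ≤ h) (i : Fin h → ℕ) (s : Fin h → ℝ) :
    K.prodG ζ t i s (K.slice τ (G.Phi hφ 1) : Sp p → ℝ) =
      K.prodG ζ t i s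
        (K.slice τ (G.Phi (GaussForm.ExpGrowth.sub_const hφ c) 1) : Sp p → ℝ) := by
  obtain ⟨h, rfl⟩ := Nat.exists_eq_add_of_le' hh
  rw [prodG_coe, prodG_coe, ← sub_eq_zero, ← Sm.coe_sub, ← map_sub,
    K.prod_smG_const ζ t i s _ c fun x => ?_, Sm.coe_zero]
  rw [Sm.coe_sub, Pi.sub_apply, slice_apply, slice_apply, G.Phi_apply, G.Phi_apply,
    G.gInt_sub_const hφ, sub_sub_cancel]

/-- S and C do not depend on c: the choice c = 0 yields growth, and c = φ(x₀) yields continuity at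
(T, x₀). -/
theorem exists_sol_le (hs : ∀ i j z, K.a₂ i j z = K.a₂ j i z) (hB : K.BlockStructure)
    (G : GaussForm p) {φ : Sp p → ℝ} (hφ : ExpGrowth φ) (T : ℝ) (n : ℕ) :
    ∃ S : Finset (Symb p), ∃ C : ℝ, 0 ≤ C ∧ ∀ t ∈ Ico 0 T, ∀ (x : Sp p) (c : ℝ),
      |K.sol ζ T (G.Phi hφ 1) φ n (t, x) - if n = 0 then c else 0| ≤
        C * ∑ Q ∈ S, |G.gInt (fun x => φ x - c) Q (-Real.log (T - t), expB K.B (T - t) *ᵥ x)| := by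
  classical
  rcases Nat.eq_zero_or_pos n with rfl | hn
  · refine ⟨{1}, 1, zero_le_one, fun t ht x c => ?_⟩
    rw [congrFun (K.sol_of_lt ζ _ φ 0 ht.2) x, Finset.sum_singleton, G.gInt_sub_const hφ]
    simp [heatV, heatN, slice_apply, G.Phi_apply]
  · choose S C hC hle using fun (h : ℕ) (i : Fin h → ℕ) => G.exists_prodG_le K ζ hB (T := T) i
    refine ⟨(Finset.Icc 1 n).biUnion fun h => (compIdx n h).biUnion fun i => S h i,
      ∑ h ∈ Finset.Icc 1 n, ∑ i ∈ compIdx n h, C h i,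
      Finset.sum_nonneg fun h _ => Finset.sum_nonneg fun i _ => hC h i, fun t ht x c => ?_⟩
    have hτ : 0 < T - t := sub_pos.2 ht.2
    rw [if_neg hn.ne', sub_zero, congrFun (K.sol_of_lt ζ _ φ n ht.2) x,
      ← K.opL_slice ζ hs hB ht.2 hn, opL, Finset.sum_mul]
    refine (Finset.abs_sum_le_sum_abs _ _).trans (Finset.sum_le_sum fun h hh => ?_)
    obtain ⟨h1, h2⟩ := Finset.mem_Icc.1 hh
    set q : ℝ × Sp p := (-Real.log (T - t), expB K.B (T - t) *ᵥ x)
    -- The bound carries ((T-t)^h)⁻¹ from `exists_prodG_le`, cancelled by the factor (T-t)^h of the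
    -- nested integral.
    refine (abs_nestedIntegral_le ht.2.le h (b := ((T - t) ^ h)⁻¹ * ((∑ i ∈ compIdx n h, C h i) *
      ∑ Q ∈ (Finset.Icc 1 n).biUnion fun h => (compIdx n h).biUnion fun i => S h i,
        |G.gInt (fun x => φ x - c) Q q|)) (fun s hs' => ?_) ⟨le_rfl, ht.2.le⟩).trans (le_of_eq ?_)
    · refine (Finset.abs_sum_le_sum_abs _ _).trans ?_
      rw [Finset.sum_mul, Finset.mul_sum]
      refine Finset.sum_le_sum fun i hi => ?_
      rw [K.prodG_sub_const ζ G hφ c (T - t) h1, ← div_eq_inv_mul, le_div_iff₀ (pow_pos hτ h),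
        mul_comm]
      refine (hle h i _ _ t ht s hs' x).trans (mul_le_mul_of_nonneg_left ?_ (hC h i))
      refine Finset.sum_le_sum_of_subset_of_nonneg (fun Q hQ => ?_) fun _ _ _ => abs_nonneg _
      exact Finset.mem_biUnion.2 ⟨h, hh, Finset.mem_biUnion.2 ⟨i, hi, hQ⟩⟩
    · rw [← mul_assoc (_ ^ h), mul_inv_cancel₀ (pow_pos hτ h).ne', one_mul]

theorem exists_norm_expB_mulVec_le (B : Matrix (Idx p) (Idx p) ℝ) (T : ℝ) :
    ∃ C : ℝ, 0 ≤ C ∧ ∀ t ∈ Icc 0 T, ∀ x : Sp p, ‖expB B t *ᵥ x‖ ≤ C * ‖x‖ := by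
  have hE := continuous_expB_apply B
  choose C hC using fun k l => (isCompact_Icc (a := 0) (b := T)).exists_bound_of_continuousOn
    (hE k l).continuousOn
  refine ⟨∑ k, ∑ l, |C k l|, by positivity, fun t ht x => ?_⟩
  refine (pi_norm_le_iff_of_nonneg (by positivity)).2 fun k => ?_
  have h1 : ‖(expB B t *ᵥ x) k‖ ≤ ∑ l, |C k l| * ‖x‖ := by
    refine (norm_sum_le _ _).trans (Finset.sum_le_sum fun l _ => ?_)
    rw [norm_mul]
    exact mul_le_mul ((hC k l t ht).trans (le_abs_self _)) (norm_le_pi_norm x l) (norm_nonneg _)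
      (abs_nonneg _)
  refine h1.trans ?_
  rw [← Finset.sum_mul]
  refine mul_le_mul_of_nonneg_right ?_ (norm_nonneg _)
  exact Finset.single_le_sum (f := fun k => ∑ l, |C k l|)
    (fun k _ => Finset.sum_nonneg fun l _ => abs_nonneg _) (Finset.mem_univ k)

theorem exp_mul_le_exp_sq {K C y : ℝ} (hK : 0 ≤ K) (hC : C ≤ K) :
    C * Real.exp (K * y) ≤ K * Real.exp K * Real.exp (K * y ^ 2) := by
  rw [mul_assoc, ← Real.exp_add]
  gcongr
  nlinarith [sq_nonneg (y - 1)]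

theorem sol_growth (hs : ∀ i j z, K.a₂ i j z = K.a₂ j i z) (hB : K.BlockStructure)
    (G : GaussForm p) {φ : Sp p → ℝ} (hφ : ExpGrowth φ) (T : ℝ) (n : ℕ) :
    ∃ C : ℝ, ∀ t ∈ Icc 0 T, ∀ x,
      |K.sol ζ T (G.Phi hφ 1) φ n (t, x)| ≤ C * Real.exp (C * ‖x‖ ^ 2) := by
  obtain ⟨S, C, hC, h⟩ := K.exists_sol_le ζ hs hB G hφ T n
  -- The bound needs only an upper bound on -θ = log(T-t), namely |log T|; nothing degenerates as θ
  -- → ∞.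
  choose D L hD hL hg using fun Q => G.gInt_growth hφ Q (abs_nonneg (Real.log T))
  obtain ⟨A, hA, hE⟩ := exists_norm_expB_mulVec_le K.B T
  obtain ⟨C', L', hC', hL', hb⟩ := hφ.bound
  set N := C * ∑ Q ∈ S, D Q + C' + ((∑ Q ∈ S, L Q) * A + L') with hN
  have hSD : 0 ≤ C * ∑ Q ∈ S, D Q := mul_nonneg hC (Finset.sum_nonneg fun Q _ => hD Q)
  have hSL : 0 ≤ (∑ Q ∈ S, L Q) * A := mul_nonneg (Finset.sum_nonneg fun Q _ => hL Q) hA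
  have hN0 : 0 ≤ N := by positivity
  refine ⟨N * Real.exp N, fun t ht x => ?_⟩
  have hle : N ≤ N * Real.exp N := le_mul_of_one_le_right hN0 (Real.one_le_exp hN0)
  have key : |K.sol ζ T (G.Phi hφ 1) φ n (t, x)| ≤ N * Real.exp (N * ‖x‖) := by
    rcases ht.2.lt_or_eq with htT | htT
    · have h1 := h t ⟨ht.1, htT⟩ x 0
      simp only [ite_self, sub_zero] at h1
      have hτ : 0 < T - t := sub_pos.2 htT
      refine h1.trans ?_
      calc _ ≤ C * ∑ Q ∈ S, D Q * Real.exp (N * ‖x‖) := by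
            gcongr with Q hQ
            refine (hg Q _ ?_).trans ?_
            · rw [neg_neg]
              exact (Real.log_le_log hτ (by linarith [ht.1])).trans (le_abs_self _)
            · have h2 : L Q ≤ ∑ Q ∈ S, L Q := Finset.single_le_sum (fun Q _ => hL Q) hQ
              have h3 := hE (T - t) ⟨hτ.le, by linarith [ht.1]⟩ x
              have h4 : L Q * ‖expB K.B (T - t) *ᵥ x‖ ≤ N * ‖x‖ :=
                calc _ ≤ (∑ Q ∈ S, L Q) * (A * ‖x‖) :=
                      mul_le_mul h2 h3 (norm_nonneg _) ((hL Q).trans h2)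
                  _ = (∑ Q ∈ S, L Q) * A * ‖x‖ := by ring
                  _ ≤ _ := by gcongr; linarith
              have := hD Q
              gcongr
        _ = (C * ∑ Q ∈ S, D Q) * Real.exp (N * ‖x‖) := by rw [← Finset.sum_mul, mul_assoc]
        _ ≤ _ := by gcongr; linarith
    · have h5 : |K.sol ζ T (G.Phi hφ 1) φ n (t, x)| ≤ |φ x| := by
        rw [sol, if_neg (not_lt.2 htT.ge)]
        split_ifs <;> simp
      refine h5.trans ((hb x).trans ?_)
      gcongr <;> linarith
  refine key.trans ((exp_mul_le_exp_sq hN0 le_rfl).trans ?_)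
  gcongr

/-- At a final point (T, x) the strip is split into t < T and t = T. On the first part the estimate
with c = φ(x) and `tendsto_gInt` give the limit; on the second the function is the datum or zero. -/
theorem continuousOn_sol_Icc (hs : ∀ i j z, K.a₂ i j z = K.a₂ j i z) (hB : K.BlockStructure)
    (G : GaussForm p) {φ : Sp p → ℝ} (hφ : ExpGrowth φ) (T : ℝ) (n : ℕ) :
    ContinuousOn (K.sol ζ T (G.Phi hφ 1) φ n) (Icc 0 T ×ˢ univ) := by
  rintro ⟨t, x⟩ ⟨ht, -⟩
  rcases ht.2.lt_or_eq with htT | rfl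
  · exact ((K.continuousOn_sol ζ (G.Phi hφ 1) φ n hs).continuousAt
      ((isOpen_Iio.preimage continuous_fst).mem_nhds htT)).continuousWithinAt
  obtain ⟨S, C, hC, h⟩ := K.exists_sol_le ζ hs hB G hφ t n
  set v := K.sol ζ t (G.Phi hφ 1) φ n with hv
  have hvT : ∀ y, v (t, y) = if n = 0 then φ y else 0 := fun y => by simp [hv, sol]
  have hI : Icc 0 t ×ˢ (univ : Set (Sp p)) ⊆ (Ico 0 t ×ˢ univ) ∪ ({t} ×ˢ univ) := by
    rintro ⟨s, y⟩ ⟨hs', -⟩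
    rcases hs'.2.lt_or_eq with h1 | h1
    · exact Or.inl ⟨⟨hs'.1, h1⟩, trivial⟩
    · exact Or.inr ⟨h1, trivial⟩
  refine ContinuousWithinAt.mono (ContinuousWithinAt.union ?_ ?_) hI
  · have h1 : Filter.Tendsto (fun z : ℝ × Sp p => (-Real.log (t - z.1), expB K.B (t - z.1) *ᵥ z.2))
        (nhdsWithin (t, x) (Ico 0 t ×ˢ univ)) (Filter.atTop ×ˢ nhds x) := by
      refine Filter.Tendsto.prodMk ?_ ?_
      · have h2 : Filter.Tendsto (fun z : ℝ × Sp p => t - z.1)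
            (nhdsWithin (t, x) (Ico 0 t ×ˢ univ)) (nhdsWithin 0 (Ioi 0)) := by
          refine tendsto_nhdsWithin_iff.2 ⟨?_, ?_⟩
          · have : Continuous fun z : ℝ × Sp p => t - z.1 := by fun_prop
            have := this.tendsto (t, x)
            simp only [sub_self] at this
            exact this.mono_left nhdsWithin_le_nhds
          · filter_upwards [self_mem_nhdsWithin] with z hz
            exact sub_pos.2 hz.1.2
        exact Filter.tendsto_neg_atBot_atTop.comp (Real.tendsto_log_nhdsGT_zero.comp h2)
      · have hE := continuous_expB_apply K.B
        have h2 : Continuous fun z : ℝ × Sp p => expB K.B (t - z.1) *ᵥ z.2 := by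
          refine continuous_pi fun k => ?_
          simp only [Matrix.mulVec, dotProduct]
          fun_prop
        have h3 := h2.tendsto (t, x)
        simp only [sub_self, expB_zero, Matrix.one_mulVec] at h3
        exact h3.mono_left nhdsWithin_le_nhds
    have h2 : Filter.Tendsto (fun z : ℝ × Sp p => C * ∑ Q ∈ S, |G.gInt (fun y => φ y - φ x) Q
        (-Real.log (t - z.1), expB K.B (t - z.1) *ᵥ z.2)|)
        (nhdsWithin (t, x) (Ico 0 t ×ˢ univ)) (nhds 0) := by
      have h3 : ∀ Q, Filter.Tendsto (fun z : ℝ × Sp p => |G.gInt (fun y => φ y - φ x) Q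
          (-Real.log (t - z.1), expB K.B (t - z.1) *ᵥ z.2)|)
          (nhdsWithin (t, x) (Ico 0 t ×ˢ univ)) (nhds 0) := fun Q => by
        have := ((G.tendsto_gInt (GaussForm.ExpGrowth.sub_const hφ (φ x)) Q
          (sub_self (φ x))).comp h1).abs
        rwa [abs_zero] at this
      have := (tendsto_finsetSum S fun Q _ => h3 Q).const_mul C
      simpa using this
    have h4 : Filter.Tendsto (fun z => v z - if n = 0 then φ x else 0)
        (nhdsWithin (t, x) (Ico 0 t ×ˢ univ)) (nhds 0) := by
      refine squeeze_zero_norm' ?_ h2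
      filter_upwards [self_mem_nhdsWithin] with z hz
      exact h z.1 hz.1 z.2 (φ x)
    have h5 := h4.add_const (if n = 0 then φ x else 0)
    simp only [sub_add_cancel, zero_add] at h5
    rw [ContinuousWithinAt, hvT]
    exact h5
  · have h6 : Continuous fun z : ℝ × Sp p => if n = 0 then φ z.2 else 0 := by
      split_ifs
      · exact hφ.cont.comp continuous_snd
      · exact continuous_const
    refine h6.continuousWithinAt.congr (fun z hz => ?_) (hvT x)
    obtain ⟨s, y⟩ := z
    obtain ⟨rfl, -⟩ := hz
    exact hvT y

theorem isExpansion_sol (hs : ∀ i j z, K.a₂ i j z = K.a₂ j i z) (hB : K.BlockStructure)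
    (G : GaussForm p) (hG : K.covC ζ 1 * G.R = 1) {φ : Sp p → ℝ} (hφ : ExpGrowth φ) (T : ℝ)
    (N : ℕ) : K.IsExpansion ζ T N φ (K.sol ζ T (G.Phi hφ 1) φ) := by
  have hf := G.heat_Phi_one K ζ hs hG hφ
  have hsub : Ico 0 T ×ˢ (univ : Set (Sp p)) ⊆ {z | z.1 < T} := fun z hz => hz.1.2
  refine ⟨fun n _ => ⟨K.continuousOn_sol_Icc ζ hs hB G hφ T n,
    fun i z hz => K.dxDiff_sol ζ _ φ n hz.1.2 _ _,
    fun i => (K.continuousOn_dx_sol ζ _ φ n hs _).mono hsub,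
    fun i j z hz => K.dxDiff_dx_sol ζ _ φ n hz.1.2 _ _ _,
    fun i j => (K.continuousOn_dx_dx_sol ζ _ φ n hs _ _).mono hsub,
    fun z hz => (K.lieY_sol ζ _ φ n hs hB hf hz.1.2 z.2).differentiableAt.differentiableWithinAt,
    K.sol_growth ζ hs hB G hφ T n⟩, fun z hz => ?_, fun x => ?_,
    fun n _ _ z hz => K.approx_zero_sol ζ _ φ n hs hB hf hz.1 z.2, fun n hn _ x => ?_⟩
  · have := K.approx_zero_sol ζ _ φ 0 hs hB hf hz.1 z.2
    simpa using this
  · simp [sol]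
  · have : n ≠ 0 := by omega
    simp [sol, this]

end KolmogorovOp

/-! ### Chain rule and optimality conditions for directional derivatives. -/

section LineDeriv

variable {E ι : Type*} [NormedAddCommGroup E] [NormedSpace ℝ E]

/-- Fréchet differentiability is not assumed, as only some partial derivatives exist. The step along
c·w starts from the moved point x + τv, and continuity of g makes its increment cτg(x) + o(τ). -/
theorem hasLineDerivAt_add_of_continuous {f g : E → ℝ} {v w x : E} {a c : ℝ}
    (hv : HasLineDerivAt ℝ f a x v) (hg : Continuous g) (hw : ∀ y, HasLineDerivAt ℝ f (g y) y w) :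
    HasLineDerivAt ℝ f (a + c * g x) x (v + c • w) := by
  have h1 : HasDerivAt (fun τ : ℝ => f (x + τ • (v + c • w)) - f (x + τ • v)) (c * g x) 0 := by
    rw [hasDerivAt_iff_isLittleO, Asymptotics.isLittleO_iff]
    intro ε hε
    have hc : 0 < |c| + 1 := by positivity
    have h2 : ∀ᶠ q : ℝ × ℝ in nhds (0, 0), |g (x + q.1 • v + q.2 • w) - g x| < ε / (|c| + 1) := by
      have : Continuous fun q : ℝ × ℝ => |g (x + q.1 • v + q.2 • w) - g x| := by fun_prop
      refine (this.tendsto (0, 0)).eventually (gt_mem_nhds ?_)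
      simp only [zero_smul, add_zero, sub_self, abs_zero]
      positivity
    obtain ⟨δ, hδ, h3⟩ := Metric.eventually_nhds_iff_ball.1 h2
    have h4 : ∀ᶠ τ : ℝ in nhds 0, |τ| < δ / (|c| + 1) := by
      have : Continuous fun τ : ℝ => |τ| := continuous_abs
      refine (this.tendsto 0).eventually (gt_mem_nhds ?_)
      rw [abs_zero]
      positivity
    filter_upwards [h4] with τ hτ
    have h5 : ∀ σ ∈ uIcc 0 (τ * c), |g (x + τ • v + σ • w) - g x| ≤ ε / (|c| + 1) := by
      intro σ hσ
      refine (h3 (τ, σ) ?_).le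
      have h6 : |σ| ≤ |τ| * |c| := by
        have := abs_sub_left_of_mem_uIcc hσ
        rwa [sub_zero, sub_zero, abs_mul] at this
      rw [lt_div_iff₀ hc] at hτ
      rw [Metric.mem_ball, Prod.dist_eq, max_lt_iff, Real.dist_eq, Real.dist_eq, sub_zero, sub_zero]
      constructor <;> nlinarith [abs_nonneg τ, abs_nonneg c]
    -- The mean value inequality is applied after subtracting the linear function σ g(x), whose
    -- removal leaves a small derivative.
    have h7 : ∀ σ ∈ uIcc 0 (τ * c), HasDerivWithinAt
        (fun σ : ℝ => f (x + τ • v + σ • w) - σ * g x)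
        (g (x + τ • v + σ • w) - g x) (uIcc 0 (τ * c)) σ := by
      intro σ _
      have h8 : HasDerivAt (fun s : ℝ => f (x + τ • v + s • w)) (g (x + τ • v + σ • w)) σ := by
        have h9 := hw (x + τ • v + σ • w)
        have h10 : HasDerivAt (fun s : ℝ => s - σ) 1 σ := (hasDerivAt_id σ).sub_const σ
        have h11 := HasDerivAt.comp (h₂ := fun t : ℝ => f (x + τ • v + σ • w + t • w)) σ
          (by simpa [HasLineDerivAt] using h9) h10
        rw [mul_one] at h11
        refine h11.congr_of_eventuallyEq (Filter.Eventually.of_forall fun s => ?_)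
        simp only [Function.comp_apply]
        congr 1
        rw [sub_smul]
        abel
      have h12 := h8.sub ((hasDerivAt_id σ).mul_const (g x))
      rw [one_mul] at h12
      exact h12.hasDerivWithinAt
    have h13 := (convex_uIcc (0 : ℝ) (τ * c)).norm_image_sub_le_of_norm_hasDerivWithin_le h7 h5
      left_mem_uIcc right_mem_uIcc
    simp only [zero_smul, add_zero, zero_mul, sub_zero, Real.norm_eq_abs, smul_eq_mul,
      sub_self] at h13 ⊢
    have h14 : x + τ • (v + c • w) = x + τ • v + (τ * c) • w := by
      rw [smul_add, smul_smul, add_assoc]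
    rw [h14]
    have h15 : f (x + τ • v + (τ * c) • w) - f (x + τ • v) - τ * (c * g x) =
        f (x + τ • v + (τ * c) • w) - τ * c * g x - f (x + τ • v) := by ring
    rw [h15]
    refine h13.trans ?_
    rw [abs_mul, div_mul_eq_mul_div, div_le_iff₀ hc]
    have := mul_nonneg hε.le (abs_nonneg τ)
    nlinarith
  have h2 := HasDerivAt.fun_add hv h1
  simpa [HasLineDerivAt] using h2

/-- The chain rule along lines, for functions with continuous partial derivatives. -/
theorem hasLineDerivAt_sum_of_continuous [Fintype ι] {e : ι → E} {f : E → ℝ} {g : ι → E → ℝ}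
    (hg : ∀ i, Continuous (g i)) (hf : ∀ i y, HasLineDerivAt ℝ f (g i y) y (e i)) (c : ι → ℝ) (x :
        E) :
    HasLineDerivAt ℝ f (∑ i, c i * g i x) x (∑ i, c i • e i) := by
  classical
  induction (Finset.univ : Finset ι) using Finset.induction_on with
  | empty => simpa [HasLineDerivAt] using hasDerivAt_const (0 : ℝ) (f x)
  | insert a s ha ih =>
    rw [Finset.sum_insert ha, Finset.sum_insert ha, add_comm, add_comm (c a • e a)]
    exact hasLineDerivAt_add_of_continuous ih (hg a) (hf a)

theorem HasLineDerivAt.hasDerivAt_line {f : E → ℝ} {a : ℝ} {x v : E} {τ : ℝ}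
    (h : HasLineDerivAt ℝ f a (x + τ • v) v) : HasDerivAt (fun t : ℝ => f (x + t • v)) a τ := by
  have h10 : HasDerivAt (fun s : ℝ => s - τ) 1 τ := (hasDerivAt_id τ).sub_const τ
  have h11 := HasDerivAt.comp (h₂ := fun t : ℝ => f (x + τ • v + t • v)) τ
    (by simpa [HasLineDerivAt] using h) h10
  rw [mul_one] at h11
  refine h11.congr_of_eventuallyEq (Filter.Eventually.of_forall fun s => ?_)
  simp only [Function.comp_apply]
  congr 1
  rw [sub_smul]
  abel

/-- A positive second derivative would make the maximum also a local minimum; q would be locally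
constant and its second derivative zero. -/
theorem second_deriv_nonpos_of_max {q q' : ℝ → ℝ} {q'' : ℝ} (h1 : ∀ t, HasDerivAt q (q' t) t)
    (h2 : HasDerivAt q' q'' 0) (hmax : ∀ t, q t ≤ q 0) : q'' ≤ 0 := by
  by_contra! hpos
  have hd : deriv q = q' := funext fun t => (h1 t).deriv
  have hlmax : IsLocalMax q 0 := Filter.Eventually.of_forall hmax
  have hlmin : IsLocalMin q 0 := isLocalMin_of_deriv_deriv_pos (by rw [hd, h2.deriv]; exact hpos)
    hlmax.deriv_eq_zero (h1 0).continuousAt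
  have hconst : ∀ᶠ t in nhds (0 : ℝ), q t = q 0 := by
    filter_upwards [hlmin] with t ht
    exact le_antisymm (hmax t) ht
  have hzero : q' =ᶠ[nhds 0] fun _ => 0 := by
    filter_upwards [hconst.eventually_nhds] with t ht
    rw [← hd, (Filter.EventuallyEq.deriv_eq (f := fun _ => q 0) ht)]
    simp
  rw [((hasDerivAt_const (0 : ℝ) (0 : ℝ)).congr_of_eventuallyEq hzero).unique h2] at hpos
  exact lt_irrefl _ hpos

/-- The second order condition at a maximum point. -/
theorem sum_second_partial_nonpos_of_max [Fintype ι] [DecidableEq ι] {e : ι → E} {f : E → ℝ}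
    {g : ι → E → ℝ} {k : ι → ι → E → ℝ} (hg : ∀ i, Continuous (g i)) (hk : ∀ i j, Continuous (k i
        j))
    (hf : ∀ i y, HasLineDerivAt ℝ f (g i y) y (e i))
    (hgk : ∀ i j y, HasLineDerivAt ℝ (g j) (k i j y) y (e i)) {x : E} (hx : ∀ y, f y ≤ f x)
    {a : Matrix ι ι ℝ} (ha : a.PosSemidef) : ∑ i, ∑ j, a i j * k i j x ≤ 0 := by
  have h1 : ∀ c : ι → ℝ, ∑ i, ∑ j, c i * c j * k i j x ≤ 0 := by
    intro c
    have h2 : ∀ τ : ℝ, HasDerivAt (fun t : ℝ => f (x + t • ∑ i, c i • e i))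
        (∑ j, c j * g j (x + τ • ∑ i, c i • e i)) τ := fun τ =>
      (hasLineDerivAt_sum_of_continuous hg hf c _).hasDerivAt_line
    have h3 : HasDerivAt (fun t : ℝ => ∑ j, c j * g j (x + t • ∑ i, c i • e i))
        (∑ j, c j * ∑ i, c i * k i j x) 0 := by
      refine HasDerivAt.fun_sum fun j _ => HasDerivAt.const_mul (c j) ?_
      exact hasLineDerivAt_sum_of_continuous (fun i => hk i j) (fun i => hgk i j) c x
    refine le_of_eq_of_le ?_ (second_deriv_nonpos_of_max h2 h3 fun t => ?_)
    · rw [Finset.sum_comm]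
      refine Finset.sum_congr rfl fun j _ => ?_
      rw [Finset.mul_sum]
      exact Finset.sum_congr rfl fun i _ => by ring
    · simpa using hx _
  -- A positive semidefinite matrix is a sum of squares c cᵀ, and each square is a second derivative
  -- along the single direction ∑ c_i e_i.
  obtain ⟨m, c, rfl⟩ := Matrix.posSemidef_iff_eq_sum_vecMulVec.1 ha
  have h4 : ∑ i, ∑ j, (∑ l, Matrix.vecMulVec (c l) (star (c l))) i j * k i j x =
      ∑ l, ∑ i, ∑ j, c l i * c l j * k i j x := by
    simp only [Matrix.sum_apply, Matrix.vecMulVec_apply, star_trivial, Finset.sum_mul]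
    symm
    rw [Finset.sum_comm]
    refine Finset.sum_congr rfl fun i _ => ?_
    rw [Finset.sum_comm]
  rw [h4]
  exact Finset.sum_nonpos fun l _ => h1 (c l)

theorem HasDerivWithinAt.nonpos_of_forall_le {q : ℝ → ℝ} {q' a b : ℝ} (hab : a < b)
    (h : HasDerivWithinAt q q' (Ici a) a) (hq : ∀ t ∈ Icc a b, q t ≤ q a) : q' ≤ 0 := by
  have h1 := (hasDerivWithinAt_iff_tendsto_slope.1 h)
  rw [show Ici a \ {a} = Ioi a from Ici_sdiff_left] at h1
  refine le_of_tendsto h1 ?_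
  filter_upwards [Ioo_mem_nhdsGT hab] with t ht
  rw [slope_def_field]
  exact div_nonpos_of_nonpos_of_nonneg (sub_nonpos.2 (hq t ⟨ht.1.le, ht.2.le⟩)) (sub_pos.2 ht.1).le

end LineDeriv

/-! ### The Gaussian barrier and its derivatives. -/

section Barrier

/-- The square of the Euclidean norm. -/
def nsq (x : Sp p) : ℝ := ∑ k, x k ^ 2

theorem nsq_nonneg (x : Sp p) : 0 ≤ nsq x := Finset.sum_nonneg fun _ _ => sq_nonneg _

theorem continuous_nsq : Continuous (nsq (p := p)) := by
  unfold nsq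
  fun_prop

theorem norm_sq_le_nsq (x : Sp p) : ‖x‖ ^ 2 ≤ nsq x := by
  have h : ‖x‖ ≤ √(nsq x) := by
    refine (pi_norm_le_iff_of_nonneg (Real.sqrt_nonneg _)).2 fun k => ?_
    refine Real.le_sqrt_of_sq_le ?_
    rw [Real.norm_eq_abs, sq_abs]
    exact Finset.single_le_sum (f := fun k => x k ^ 2) (fun k _ => sq_nonneg (x k))
      (Finset.mem_univ k)
  calc _ ≤ √(nsq x) ^ 2 := by gcongr
    _ = _ := Real.sq_sqrt (nsq_nonneg x)

theorem nsq_add_smul_single (x : Sp p) (i : Idx p) (τ : ℝ) :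
    nsq (x + τ • Pi.single i 1) = nsq x + (2 * τ * x i + τ ^ 2) := by
  simp only [nsq, Pi.add_apply, Pi.smul_apply, smul_eq_mul, add_sq, Finset.sum_add_distrib]
  simp [Pi.single_apply, mul_assoc, mul_left_comm]
  ring

theorem hasLineDerivAt_exp_nsq (g d : ℝ) (x : Sp p) (i : Idx p) :
    HasLineDerivAt ℝ (fun y : Sp p => Real.exp (g * nsq y + d))
      (2 * g * x i * Real.exp (g * nsq x + d)) x (Pi.single i 1) := by
  unfold HasLineDerivAt
  simp only [nsq_add_smul_single]
  have h1 : HasDerivAt (fun τ : ℝ => 2 * τ * x i + τ ^ 2) (2 * x i) 0 := by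
    have := (((hasDerivAt_id (0 : ℝ)).const_mul 2).mul_const (x i)).add (hasDerivAt_pow 2 (0 : ℝ))
    refine this.congr_deriv ?_
    simp
  have h2 := (((h1.const_add (nsq x)).const_mul g).add_const d).exp
  refine h2.congr_deriv ?_
  simp
  ring

theorem hasLineDerivAt_mul_exp_nsq (g d : ℝ) (x : Sp p) (i j : Idx p) :
    HasLineDerivAt ℝ (fun y : Sp p => 2 * g * y j * Real.exp (g * nsq y + d))
      ((2 * g * (Pi.single i 1 : Sp p) j + 4 * g ^ 2 * x i * x j) * Real.exp (g * nsq x + d)) x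
      (Pi.single i 1) := by
  have h1 := hasLineDerivAt_exp_nsq g d x i
  unfold HasLineDerivAt at h1 ⊢
  have h2 : HasDerivAt (fun τ : ℝ => 2 * g * (x + τ • (Pi.single i 1 : Sp p)) j)
      (2 * g * (Pi.single i 1 : Sp p) j) 0 := by
    refine HasDerivAt.const_mul (2 * g) ?_
    simp only [Pi.add_apply, Pi.smul_apply, smul_eq_mul]
    simpa using ((hasDerivAt_id (0 : ℝ)).mul_const ((Pi.single i 1 : Sp p) j)).const_add (x j)
  refine (h2.fun_mul h1).congr_deriv ?_
  simp
  ring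

/-- The barrier function. -/
def barrier (k κ ν b : ℝ) (z : ℝ × Sp p) : ℝ :=
  Real.exp ((k + κ * (b - z.1)) * nsq z.2 + ν * (b - z.1))

theorem continuous_barrier (k κ ν b : ℝ) : Continuous (barrier (p := p) k κ ν b) := by
  have := continuous_nsq (p := p)
  unfold barrier
  fun_prop

theorem hasDerivAt_alongY_barrier (B : Matrix (Idx p) (Idx p) ℝ) (k κ ν b t : ℝ) (x : Sp p) :
    HasDerivAt (alongY B (barrier k κ ν b) (t, x))
      ((-κ * nsq x + 2 * (k + κ * (b - t)) * ∑ l, x l * (B *ᵥ x) l - ν) *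
        barrier k κ ν b (t, x)) t := by
  have h1 : HasDerivAt (fun s => expB B (s - t) *ᵥ x) (B *ᵥ x) t := by
    have h2 := HasDerivAt.scomp t (h := fun s => s - t) (g₁ := fun s => expB B s *ᵥ x)
      (hasDerivAt_expB_mulVec B x (t - t)) ((hasDerivAt_id t).sub_const t)
    rw [sub_self, expB_zero, Matrix.one_mulVec, one_smul] at h2
    exact h2
  have h3 : HasDerivAt (fun s => nsq (expB B (s - t) *ᵥ x)) (2 * ∑ l, x l * (B *ᵥ x) l) t := by
    have h4 := HasDerivAt.fun_sum fun l (_ : l ∈ Finset.univ) => ((hasDerivAt_pi.1 h1) l).pow 2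
    refine h4.congr_deriv ?_
    simp only [sub_self, expB_zero, Matrix.one_mulVec, Finset.mul_sum]
    exact Finset.sum_congr rfl fun l _ => by norm_num; ring
  have h5 : HasDerivAt (fun s => b - s) (-1) t := (hasDerivAt_id t).const_sub b
  have h6 := ((((h5.const_mul κ).const_add k).fun_mul h3).fun_add (h5.const_mul ν)).exp
  refine h6.congr_deriv ?_
  simp only [sub_self, expB_zero, Matrix.one_mulVec, barrier]
  ring

end Barrier

/-! ### Subsolutions of the frozen equation. -/

namespace KolmogorovOp

variable (K : KolmogorovOp p) (ζ : ℝ × Sp p)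

/-- Classical subsolutions of the constant coefficient equation, with their derivatives. -/
structure IsSubsolution (T : ℝ) (w : ℝ × Sp p → ℝ) (w₁ : Fin (p 0) → ℝ × Sp p → ℝ)
    (w₂ : Fin (p 0) → Fin (p 0) → ℝ × Sp p → ℝ) (wY : ℝ × Sp p → ℝ) : Prop where
  cont : ContinuousOn w (Icc 0 T ×ˢ univ)
  deriv₁ : ∀ j, ∀ z ∈ Ico 0 T ×ˢ (univ : Set (Sp p)),
    HasLineDerivAt ℝ (fun y => w (z.1, y)) (w₁ j z) z.2 (Pi.single (fst₀ j) 1)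
  cont₁ : ∀ j, ContinuousOn (w₁ j) (Ico 0 T ×ˢ univ)
  deriv₂ : ∀ i j, ∀ z ∈ Ico 0 T ×ˢ (univ : Set (Sp p)),
    HasLineDerivAt ℝ (fun y => w₁ j (z.1, y)) (w₂ i j z) z.2 (Pi.single (fst₀ i) 1)
  cont₂ : ∀ i j, ContinuousOn (w₂ i j) (Ico 0 T ×ˢ univ)
  derivY : ∀ z ∈ Ico 0 T ×ˢ (univ : Set (Sp p)),
    HasDerivWithinAt (alongY K.B w z) (wY z) (Ici 0) z.1
  growth : ∃ C : ℝ, ∀ t ∈ Icc 0 T, ∀ x, w (t, x) ≤ C * Real.exp (C * ‖x‖ ^ 2)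
  nonneg : ∀ z ∈ Ico 0 T ×ˢ (univ : Set (Sp p)),
    0 ≤ 1 / 2 * ∑ i, ∑ j, K.a₂ i j ζ * w₂ i j z + wY z

theorem posSemidef {μ M : ℝ} (hA : K.NonDegenerate μ M) :
    (Matrix.of fun i j => K.a₂ i j ζ).PosSemidef := by
  refine Matrix.PosSemidef.of_dotProduct_mulVec_nonneg (Matrix.ext fun i j => hA.symm j i ζ)
    fun ξ => ?_
  have h : star ξ ⬝ᵥ (Matrix.of fun i j => K.a₂ i j ζ) *ᵥ ξ = ∑ i, ∑ j, K.a₂ i j ζ * ξ i * ξ j := by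
    simp only [dotProduct, Matrix.mulVec, Finset.mul_sum, star_trivial, Matrix.of_apply]
    exact Finset.sum_congr rfl fun i _ => Finset.sum_congr rfl fun j _ => by ring
  rw [h]
  by_cases hξ : ξ = 0
  · simp [hξ]
  · refine le_trans ?_ (hA.lower ζ ξ hξ).le
    exact mul_nonneg (mul_pos hA.pos_μ hA.pos_M).le (Finset.sum_nonneg fun _ _ => sq_nonneg _)

theorem sum_a₂_le {μ M : ℝ} (hA : K.NonDegenerate μ M) (x : Sp p) :
    ∑ i, ∑ j, K.a₂ i j ζ * x (fst₀ i) * x (fst₀ j) ≤ M * nsq x := by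
  have h1 : ∑ i : Fin (p 0), x (fst₀ i) ^ 2 ≤ nsq x := by
    rw [nsq, Fintype.sum_sigma]
    exact Finset.single_le_sum (f := fun j => ∑ a, x ⟨j, a⟩ ^ 2)
      (fun j _ => Finset.sum_nonneg fun _ _ => sq_nonneg _) (Finset.mem_univ 0)
  refine le_trans ?_ (mul_le_mul_of_nonneg_left h1 hA.pos_M.le)
  by_cases hξ : (fun i : Fin (p 0) => x (fst₀ i)) = 0
  · have : ∀ i : Fin (p 0), x (fst₀ i) = 0 := fun i => congrFun hξ i
    simp [this]
  · exact (hA.upper ζ _ hξ).le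

theorem sum_mul_mulVec_le (B : Matrix (Idx p) (Idx p) ℝ) (x : Sp p) :
    ∑ l, x l * (B *ᵥ x) l ≤ (∑ k, ∑ l, |B k l|) * nsq x := by
  simp only [Matrix.mulVec, dotProduct, Finset.mul_sum, Finset.sum_mul]
  refine Finset.sum_le_sum fun k _ => Finset.sum_le_sum fun l _ => ?_
  have h1 : ∀ k, x k ^ 2 ≤ nsq x := fun k =>
    Finset.single_le_sum (f := fun k => x k ^ 2) (fun k _ => sq_nonneg (x k)) (Finset.mem_univ k)
  have h2 : |x k * x l| ≤ nsq x := by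
    rw [abs_mul]
    nlinarith [h1 k, h1 l, sq_nonneg (|x k| - |x l|), sq_abs (x k), sq_abs (x l)]
  calc _ = B k l * (x k * x l) := by ring
    _ ≤ |B k l| * |x k * x l| := by rw [← abs_mul]; exact le_abs_self _
    _ ≤ _ := by gcongr

end KolmogorovOp

/-! ### Maximum principle and uniqueness. -/

namespace KolmogorovOp

variable (K : KolmogorovOp p) (ζ : ℝ × Sp p)

/-- With a suitable choice of its parameters, the barrier is a strict supersolution. -/
theorem exists_barrier {μ M : ℝ} (hA : K.NonDegenerate μ M) {k : ℝ} (hk : 0 ≤ k) :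
    ∃ κ ν : ℝ, 0 < κ ∧ 0 ≤ ν ∧ ∀ (g : ℝ) (x : Sp p), k ≤ g → g ≤ k + 1 →
      1 / 2 * ∑ i, ∑ j, K.a₂ i j ζ * (2 * g * (Pi.single (fst₀ i) 1 : Sp p) (fst₀ j) +
        4 * g ^ 2 * x (fst₀ i) * x (fst₀ j)) +
        (-κ * nsq x + 2 * g * ∑ l, x l * (K.B *ᵥ x) l - ν) < 0 := by
  set β := ∑ k, ∑ l, |K.B k l| with hβ
  have hβ0 : 0 ≤ β := Finset.sum_nonneg fun k _ => Finset.sum_nonneg fun l _ => abs_nonneg _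
  set tr := ∑ i, ∑ j, K.a₂ i j ζ * (Pi.single (fst₀ i) 1 : Sp p) (fst₀ j) with htr
  -- κ dominates the terms proportional to |x|², from the diffusion and from the drift Bx, for all g
  -- ≤ k + 1; ν dominates the trace term, and its summand 1 makes the inequality strict even at x =
  -- 0.
  refine ⟨2 * (k + 1) ^ 2 * M + 2 * (k + 1) * β + 1, (k + 1) * |tr| + 1, ?_, by positivity,
    fun g x h1 h2 => ?_⟩
  · have := hA.pos_M
    positivity
  have h3 : ∑ i, ∑ j, K.a₂ i j ζ * (2 * g * (Pi.single (fst₀ i) 1 : Sp p) (fst₀ j) +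
      4 * g ^ 2 * x (fst₀ i) * x (fst₀ j)) =
      2 * g * tr + 4 * g ^ 2 * ∑ i, ∑ j, K.a₂ i j ζ * x (fst₀ i) * x (fst₀ j) := by
    rw [htr, Finset.mul_sum, Finset.mul_sum, ← Finset.sum_add_distrib]
    refine Finset.sum_congr rfl fun i _ => ?_
    rw [Finset.mul_sum, Finset.mul_sum, ← Finset.sum_add_distrib]
    exact Finset.sum_congr rfl fun j _ => by ring
  have hg : 0 ≤ g := hk.trans h1
  have h4 := K.sum_a₂_le ζ hA x
  have h5 := sum_mul_mulVec_le K.B x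
  have hn := nsq_nonneg x
  have h6 : g * tr ≤ (k + 1) * |tr| :=
    (mul_le_mul_of_nonneg_left (le_abs_self tr) hg).trans
      (mul_le_mul_of_nonneg_right h2 (abs_nonneg _))
  have h7 : 2 * g ^ 2 * ∑ i, ∑ j, K.a₂ i j ζ * x (fst₀ i) * x (fst₀ j) ≤
      2 * (k + 1) ^ 2 * M * nsq x :=
    calc _ ≤ 2 * g ^ 2 * (M * nsq x) := by gcongr
      _ ≤ 2 * (k + 1) ^ 2 * (M * nsq x) := by
        have := mul_nonneg hA.pos_M.le hn
        gcongr
      _ = _ := by ring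
  have h8 : 2 * g * ∑ l, x l * (K.B *ᵥ x) l ≤ 2 * (k + 1) * β * nsq x :=
    calc _ ≤ 2 * g * (β * nsq x) := by gcongr
      _ ≤ 2 * (k + 1) * (β * nsq x) := by
        have := mul_nonneg hβ0 hn
        gcongr
      _ = _ := by ring
  rw [h3]
  linarith

variable {K ζ}

/-- If w were positive somewhere, w - εΨ with Ψ the barrier would have a positive maximum at a time
t₀ < b, where the second order condition in x and the forward derivative along Y contradict the
strict supersolution property. The length δ = 1/κ keeps the exponent k + κ(b - t) below k + 1, and
it does not depend on b, so the step can be iterated. -/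
theorem IsSubsolution.step {μ M : ℝ} (hA : K.NonDegenerate μ M) {T : ℝ} {w : ℝ × Sp p → ℝ}
    {w₁ : Fin (p 0) → ℝ × Sp p → ℝ} {w₂ : Fin (p 0) → Fin (p 0) → ℝ × Sp p → ℝ}
    {wY : ℝ × Sp p → ℝ} (hw : K.IsSubsolution ζ T w w₁ w₂ wY) :
    ∃ δ : ℝ, 0 < δ ∧ ∀ b ∈ Icc 0 T, (∀ x, w (b, x) ≤ 0) → ∀ t ∈ Icc 0 b, b - δ ≤ t →
      ∀ x, w (t, x) ≤ 0 := by
  classical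
  obtain ⟨C, hC⟩ := hw.growth
  -- The rate exceeds |C| by one, so the barrier outgrows w by a factor e^{‖x‖²}.
  obtain ⟨κ, ν, hκ, hν, hbar⟩ := K.exists_barrier ζ hA (k := |C| + 1) (by positivity)
  refine ⟨1 / κ, by positivity, fun b hb hwb t₁ ht₁ hδ x₁ => ?_⟩
  by_contra! hpos
  set Ψ : ℝ × Sp p → ℝ := barrier (|C| + 1) κ ν b with hΨ
  have hΨpos : ∀ z, 0 < Ψ z := fun z => Real.exp_pos _
  -- With this ε the difference w - εΨ at (t₁, x₁) is w(t₁, x₁)/2, still positive.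
  set ε := w (t₁, x₁) / (2 * Ψ (t₁, x₁)) with hε
  have hεpos : 0 < ε := div_pos hpos (mul_pos two_pos (hΨpos _))
  set h : ℝ × Sp p → ℝ := fun z => w z - ε * Ψ z with hh
  have h1 : 0 < h (t₁, x₁) := by
    have : ε * Ψ (t₁, x₁) = w (t₁, x₁) / 2 := by
      rw [hε]
      field_simp [(hΨpos (t₁, x₁)).ne']
    rw [hh]
    simp only [this]
    linarith
  have hsub : Icc t₁ b ⊆ Icc 0 T := fun t ht => ⟨ht₁.1.trans ht.1, ht.2.trans hb.2⟩
  -- outside of a large ball `h` is negative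
  set R := ‖x₁‖ + |C| / ε + 1 with hR
  have hfar : ∀ t ∈ Icc t₁ b, ∀ x : Sp p, R < ‖x‖ → h (t, x) < 0 := by
    intro t ht x hx
    have h2 : |C| / ε < ‖x‖ ^ 2 := by
      have h3 : 1 ≤ ‖x‖ := by
        have : 0 ≤ |C| / ε := by positivity
        linarith [norm_nonneg x₁]
      nlinarith [norm_nonneg x₁]
    have h4 : |C| < ε * Real.exp (‖x‖ ^ 2) := by
      rw [div_lt_iff₀ hεpos] at h2
      nlinarith [Real.add_one_le_exp (‖x‖ ^ 2)]
    have h5 : w (t, x) ≤ |C| * Real.exp (|C| * ‖x‖ ^ 2) := by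
      refine (hC t (hsub ht) x).trans ?_
      have := le_abs_self C
      gcongr
    have h6 : Real.exp (‖x‖ ^ 2) * Real.exp (|C| * ‖x‖ ^ 2) ≤ Ψ (t, x) := by
      rw [← Real.exp_add]
      refine Real.exp_le_exp.2 ?_
      have h7 := norm_sq_le_nsq x
      have h8 : 0 ≤ b - t := sub_nonneg.2 ht.2
      have h9 := mul_nonneg hκ.le h8
      have h10 := mul_nonneg hν h8
      nlinarith [mul_le_mul_of_nonneg_left h7 (by positivity : 0 ≤ |C| + 1),
        mul_nonneg h9 (nsq_nonneg x)]
    have h11 := mul_lt_mul_of_pos_right h4 (Real.exp_pos (|C| * ‖x‖ ^ 2))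
    have h12 := mul_le_mul_of_nonneg_left h6 hεpos.le
    change w (t, x) - ε * Ψ (t, x) < 0
    nlinarith
  -- the maximum point
  have hcomp : IsCompact (Icc t₁ b ×ˢ Metric.closedBall (0 : Sp p) R) :=
    isCompact_Icc.prod (isCompact_closedBall 0 R)
  have hx₁ : (t₁, x₁) ∈ Icc t₁ b ×ˢ Metric.closedBall (0 : Sp p) R := by
    refine ⟨⟨le_rfl, ht₁.2⟩, ?_⟩
    rw [mem_closedBall_zero_iff]
    have : 0 ≤ |C| / ε := by positivity
    linarith
  have hcont : ContinuousOn h (Icc t₁ b ×ˢ Metric.closedBall (0 : Sp p) R) :=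
    (hw.cont.mono fun z hz => ⟨hsub hz.1, trivial⟩).sub
      (continuousOn_const.mul (continuous_barrier _ _ _ _).continuousOn)
  obtain ⟨⟨t₀, x₀⟩, hz₀, hmax⟩ := hcomp.exists_isMaxOn ⟨_, hx₁⟩ hcont
  have h0 : 0 < h (t₀, x₀) := h1.trans_le (hmax hx₁)
  -- Being maximal over all of space, not only over the ball, frees the curve of Y through the
  -- maximum point from having to stay in the ball.
  have hglob : ∀ t ∈ Icc t₁ b, ∀ x, h (t, x) ≤ h (t₀, x₀) := by
    intro t ht x
    rcases le_or_gt ‖x‖ R with hx | hx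
    · exact hmax ⟨ht, mem_closedBall_zero_iff.2 hx⟩
    · exact (hfar t ht x hx).le.trans h0.le
  have ht₀ : t₀ ∈ Icc t₁ b := hz₀.1
  have ht₀b : t₀ < b := by
    refine lt_of_le_of_ne ht₀.2 ?_
    rintro rfl
    have := hwb x₀
    have h2 := mul_pos hεpos (hΨpos (t₀, x₀))
    change 0 < w (t₀, x₀) - ε * Ψ (t₀, x₀) at h0
    linarith
  have ht₀I : t₀ ∈ Ico 0 T := ⟨(hsub ht₀).1, ht₀b.trans_le hb.2⟩
  set g := |C| + 1 + κ * (b - t₀) with hg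
  have hg1 : |C| + 1 ≤ g := by
    have := mul_nonneg hκ.le (sub_nonneg.2 ht₀.2)
    linarith
  have hg2 : g ≤ |C| + 1 + 1 := by
    have h2 : b - t₀ ≤ 1 / κ := by linarith [ht₀.1]
    have h3 := mul_le_mul_of_nonneg_left h2 hκ.le
    rw [mul_one_div_cancel hκ.ne'] at h3
    linarith
  -- the second order condition
  have hline : ∀ f : ℝ × Sp p → ℝ, ContinuousOn f (Ico 0 T ×ˢ univ) →
      Continuous fun y => f (t₀, y) := fun f hf =>
    hf.comp_continuous (f := fun y => (t₀, y)) (by fun_prop) fun y => ⟨ht₀I, trivial⟩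
  have hΨy : ∀ y, Ψ (t₀, y) = Real.exp (g * nsq y + ν * (b - t₀)) := fun y => rfl
  have hΨc : Continuous fun y => Ψ (t₀, y) :=
    (continuous_barrier (|C| + 1) κ ν b).comp (by fun_prop : Continuous fun y : Sp p => (t₀, y))
  have second := sum_second_partial_nonpos_of_max (e := fun i : Fin (p 0) =>
      (Pi.single (fst₀ i) 1 : Sp p)) (f := fun y => h (t₀, y))
    (g := fun j y => w₁ j (t₀, y) - ε * (2 * g * y (fst₀ j) * Ψ (t₀, y)))
    (k := fun i j y => w₂ i j (t₀, y) - ε * ((2 * g * (Pi.single (fst₀ i) 1 : Sp p) (fst₀ j) +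
      4 * g ^ 2 * y (fst₀ i) * y (fst₀ j)) * Ψ (t₀, y)))
    (fun j => (hline _ (hw.cont₁ j)).sub
      (continuous_const.mul (Continuous.mul (by fun_prop) hΨc)))
    (fun i j => (hline _ (hw.cont₂ i j)).sub
      (continuous_const.mul (Continuous.mul (by fun_prop) hΨc)))
    (fun j y => (hw.deriv₁ j (t₀, y) ⟨ht₀I, trivial⟩).fun_sub
      ((hasLineDerivAt_exp_nsq g (ν * (b - t₀)) y (fst₀ j)).const_mul ε))
    (fun i j y => (hw.deriv₂ i j (t₀, y) ⟨ht₀I, trivial⟩).fun_sub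
      ((hasLineDerivAt_mul_exp_nsq g (ν * (b - t₀)) y (fst₀ i) (fst₀ j)).const_mul ε))
    (x := x₀) (fun y => hglob t₀ ht₀ y) (K.posSemidef ζ hA)
  -- the first order condition
  have first := HasDerivWithinAt.nonpos_of_forall_le ht₀b
    (((hw.derivY (t₀, x₀) ⟨ht₀I, trivial⟩).mono (Ici_subset_Ici.2 ht₀I.1)).fun_sub
      ((hasDerivAt_alongY_barrier K.B (|C| + 1) κ ν b t₀ x₀).hasDerivWithinAt.const_mul ε))
    (fun t ht => by
      have h2 := hglob t ⟨ht₀.1.trans ht.1, ht.2⟩ (expB K.B (t - t₀) *ᵥ x₀)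
      simpa [alongY, hh, hΨ] using h2)
  have hfin := hbar g x₀ hg1 hg2
  have hnn := hw.nonneg (t₀, x₀) ⟨ht₀I, trivial⟩
  simp only [Matrix.of_apply, mul_sub, Finset.sum_sub_distrib] at second
  have hsum : ∑ i, ∑ j, K.a₂ i j ζ * (ε * ((2 * g * (Pi.single (fst₀ i) 1 : Sp p) (fst₀ j) +
      4 * g ^ 2 * x₀ (fst₀ i) * x₀ (fst₀ j)) * Ψ (t₀, x₀))) =
      (ε * Ψ (t₀, x₀)) * ∑ i, ∑ j, K.a₂ i j ζ * (2 * g * (Pi.single (fst₀ i) 1 : Sp p) (fst₀ j) +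
        4 * g ^ 2 * x₀ (fst₀ i) * x₀ (fst₀ j)) := by
    simp only [Finset.mul_sum]
    exact Finset.sum_congr rfl fun i _ => Finset.sum_congr rfl fun j _ => by ring
  rw [hsum] at second
  have h3 := mul_neg_of_pos_of_neg (mul_pos hεpos (hΨpos (t₀, x₀))) hfin
  rw [mul_add] at h3
  linarith

/-- The maximum principle. -/
theorem IsSubsolution.nonpos {μ M : ℝ} (hA : K.NonDegenerate μ M) {T : ℝ} {w : ℝ × Sp p → ℝ}
    {w₁ : Fin (p 0) → ℝ × Sp p → ℝ} {w₂ : Fin (p 0) → Fin (p 0) → ℝ × Sp p → ℝ}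
    {wY : ℝ × Sp p → ℝ} (hw : K.IsSubsolution ζ T w w₁ w₂ wY) (hT : ∀ x, w (T, x) ≤ 0) :
    ∀ t ∈ Icc 0 T, ∀ x, w (t, x) ≤ 0 := by
  obtain ⟨δ, hδ, h⟩ := hw.step hA
  -- Backward induction in steps of length δ from the final time; finitely many of them, about T/δ,
  -- reach time 0.
  have key : ∀ k : ℕ, ∀ t ∈ Icc 0 T, T - k * δ ≤ t → ∀ x, w (t, x) ≤ 0 := by
    intro k
    induction k with
    | zero =>
      intro t ht h1
      have : t = T := le_antisymm ht.2 (by simpa using h1)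
      rw [this]
      exact hT
    | succ k ih =>
      intro t ht h1 x
      push_cast at h1
      have hb : min T (t + δ) ∈ Icc 0 T :=
        ⟨le_min (ht.1.trans ht.2) (by linarith [ht.1]), min_le_left _ _⟩
      refine h _ hb (ih _ hb (le_min ?_ (by linarith))) t ⟨ht.1, le_min ht.2 (by linarith)⟩ ?_ x
      · have : 0 ≤ k * δ := by positivity
        linarith
      · linarith [min_le_right T (t + δ)]
  intro t ht x
  obtain ⟨k, hk⟩ := exists_nat_ge (T / δ)
  refine key k t ht ?_ x
  rw [div_le_iff₀ hδ] at hk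
  linarith [ht.1]

/-- Admissible functions are determined by the equation and the final datum. -/
theorem Admissible.le {μ M : ℝ} (hA : K.NonDegenerate μ M) {T : ℝ} {u v : ℝ × Sp p → ℝ}
    (hu : K.Admissible T u) (hv : K.Admissible T v)
    (huv : ∀ z ∈ Ico 0 T ×ˢ (univ : Set (Sp p)), K.approx ζ 0 u z = K.approx ζ 0 v z)
    (hT : ∀ x, u (T, x) = v (T, x)) : ∀ t ∈ Icc 0 T, ∀ x, u (t, x) ≤ v (t, x) := by
  have hw : K.IsSubsolution ζ T (fun z => u z - v z)
      (fun j z => dx (fst₀ j) u z - dx (fst₀ j) v z)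
      (fun i j z => dx (fst₀ i) (dx (fst₀ j) u) z - dx (fst₀ i) (dx (fst₀ j) v) z)
      (fun z => lieY K.B (Ici 0) u z - lieY K.B (Ici 0) v z) := by
    refine ⟨hu.cont.sub hv.cont, fun j z hz => ?_, fun j => (hu.cont₁ j).sub (hv.cont₁ j),
      fun i j z hz => ?_, fun i j => (hu.cont₂ i j).sub (hv.cont₂ i j), fun z hz => ?_, ?_,
      fun z hz => ?_⟩
    · exact HasDerivAt.fun_sub (hu.diff₁ j z hz).hasLineDerivAt (hv.diff₁ j z hz).hasLineDerivAt
    · exact HasDerivAt.fun_sub (hu.diff₂ i j z hz).hasLineDerivAt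
        (hv.diff₂ i j z hz).hasLineDerivAt
    · exact (hu.diffY z hz).hasDerivWithinAt.fun_sub (hv.diffY z hz).hasDerivWithinAt
    · obtain ⟨C, hC⟩ := hu.growth
      obtain ⟨D, hD⟩ := hv.growth
      refine ⟨|C| + |D|, fun t ht x => ?_⟩
      have h1 := (le_abs_self _).trans (hC t ht x)
      have h2 := (neg_le_abs _).trans (hD t ht x)
      have h3 : C * Real.exp (C * ‖x‖ ^ 2) ≤ |C| * Real.exp ((|C| + |D|) * ‖x‖ ^ 2) := by
        have := le_abs_self C
        have := abs_nonneg D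
        gcongr
        linarith
      have h4 : D * Real.exp (D * ‖x‖ ^ 2) ≤ |D| * Real.exp ((|C| + |D|) * ‖x‖ ^ 2) := by
        have := le_abs_self D
        have := abs_nonneg C
        gcongr
        linarith
      rw [add_mul]
      linarith
    · have h1 := huv z hz
      simp only [approx, taylorPoly_zero_eval, zero_sub, taylorPoly_neg_one, map_zero, zero_mul,
        Finset.sum_const_zero, add_zero] at h1
      simp only [mul_sub, Finset.sum_sub_distrib]
      linarith
  intro t ht x
  have := hw.nonpos hA (fun x => by simp [hT]) t ht x
  linarith

theorem Admissible.eq {μ M : ℝ} (hA : K.NonDegenerate μ M) {T : ℝ} {u v : ℝ × Sp p → ℝ}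
    (hu : K.Admissible T u) (hv : K.Admissible T v)
    (huv : ∀ z ∈ Ico 0 T ×ˢ (univ : Set (Sp p)), K.approx ζ 0 u z = K.approx ζ 0 v z)
    (hT : ∀ x, u (T, x) = v (T, x)) : ∀ t ∈ Icc 0 T, ∀ x, u (t, x) = v (t, x) :=
  fun t ht x => le_antisymm (hu.le hA hv huv hT t ht x)
    (hv.le hA hu (fun z hz => (huv z hz).symm) (fun x => (hT x).symm) t ht x)

/-- The Lie derivative at a time in [0, T[ is taken within [0, ∞), so it only sees nearby times in
[0, T[; values outside the strip are irrelevant. -/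
theorem approx_congr {T : ℝ} {u v : ℝ × Sp p → ℝ} (h : ∀ t ∈ Icc 0 T, ∀ x, u (t, x) = v (t, x))
    (n : ℤ) {z : ℝ × Sp p} (hz : z ∈ Ico 0 T ×ˢ (univ : Set (Sp p))) :
    K.approx ζ n u z = K.approx ζ n v z := by
  have h0 : (fun y => u (z.1, y)) = fun y => v (z.1, y) :=
    funext fun y => h z.1 ⟨hz.1.1, hz.1.2.le⟩ y
  have h1 : ∀ i y, dx i u (z.1, y) = dx i v (z.1, y) := fun i y => by simp only [dx, h0]
  have h2 : ∀ i j, dx i (dx j u) z = dx i (dx j v) z := fun i j => by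
    rw [dx, dx]
    simp only [h1]
  have h3 : lieY K.B (Ici 0) u z = lieY K.B (Ici 0) v z := by
    refine Filter.EventuallyEq.derivWithin_eq ?_ ?_
    · have h4 : Ico 0 T ∈ nhdsWithin z.1 (Ici 0) := by
        have := inter_mem_nhdsWithin (Ici (0 : ℝ)) (Iio_mem_nhds hz.1.2)
        rwa [Ici_inter_Iio] at this
      filter_upwards [h4] with t ht
      exact h t ⟨ht.1, ht.2.le⟩ _
    · exact h z.1 ⟨hz.1.1, hz.1.2.le⟩ _
  simp only [approx, h2, h3]
  congr 2
  exact Finset.sum_congr rfl fun i _ => by rw [h1 (fst₀ i) z.2]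

/-- The nested Cauchy problems have at most one solution. -/
theorem IsExpansion.eq_of {μ M : ℝ} (hA : K.NonDegenerate μ M) {T : ℝ} {N : ℕ} {φ : Sp p → ℝ}
    {u v : ℕ → ℝ × Sp p → ℝ} (hu : K.IsExpansion ζ T N φ u) (hv : K.IsExpansion ζ T N φ v)
    {n : ℕ} (hn : n ≤ N) : ∀ t ∈ Icc 0 T, ∀ x, u n (t, x) = v n (t, x) := by
  induction n using Nat.strong_induction_on with
  | _ n ih =>
    refine (hu.admissible n hn).eq (ζ := ζ) hA (hv.admissible n hn) (fun z hz => ?_) fun x => ?_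
    · rcases Nat.eq_zero_or_pos n with rfl | h0
      · rw [hu.eq_zero z hz, hv.eq_zero z hz]
      · rw [hu.eq n h0 hn z hz, hv.eq n h0 hn z hz]
        congr 1
        refine Finset.sum_congr rfl fun m hm => ?_
        obtain ⟨h1, h2⟩ := Finset.mem_Icc.1 hm
        -- The right side of the n-th equation only involves functions of smaller index, which
        -- already agree.
        have h3 := ih (n - m) (by omega) (by omega)
        rw [approx_congr h3 _ hz, approx_congr h3 _ hz]
    · rcases Nat.eq_zero_or_pos n with rfl | h0
      · rw [hu.final_zero, hv.final_zero]
      · rw [hu.final n h0 hn, hv.final n h0 hn]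

end KolmogorovOp

end

/-! ### Conclusion: the explicit solution, transferred to every solution by uniqueness. -/

theorem mainTheorem3 {r : ℕ} {p : Fin (r + 1) → ℕ} (K : KolmogorovOp p) (μ M : ℝ) (N : ℕ)
    (hA : K.NonDegenerate μ M) (hB : K.BlockStructure) (hC : K.Regular N M)
    (T : ℝ) (hT : 0 < T) (φ : Sp p → ℝ) (hφ : Continuous φ)
    (hφ' : ∃ C : ℝ, ∀ x, |φ x| ≤ C * Real.exp (C * ‖x‖)) (ζ : ℝ × Sp p) :
    (∃ u : ℕ → ℝ × Sp p → ℝ, K.IsExpansion ζ T N φ u) ∧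
    ∀ u : ℕ → ℝ × Sp p → ℝ, K.IsExpansion ζ T N φ u →
      (∀ t ∈ Ico 0 T, ContDiff ℝ ∞ fun x => u 0 (t, x)) ∧
      ∀ n : ℕ, 1 ≤ n → n ≤ N → ∀ t ∈ Ico 0 T, ∀ x : Sp p,
        (∀ h ∈ Finset.Icc 1 n, ∀ i ∈ KolmogorovOp.compIdx n h,
          Continuous fun s : Fin h → ℝ => K.prodG ζ t i s (fun y => u 0 (t, y)) x) ∧
        u n (t, x) = K.opL ζ n t T (fun y => u 0 (t, y)) x := by
  obtain ⟨C, hC⟩ := hφ'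
  have hφ₁ : ExpGrowth φ := by
    refine ⟨hφ, |C|, |C|, abs_nonneg _, abs_nonneg _, fun x => (hC x).trans ?_⟩
    have := le_abs_self C
    gcongr
  obtain ⟨G, hG⟩ := K.exists_gaussForm ζ hA hB
  have hv := K.isExpansion_sol ζ hA.symm hB G hG hφ₁ T N
  refine ⟨⟨_, hv⟩, fun u hu => ?_⟩
  have huv : ∀ n ≤ N, ∀ t ∈ Ico 0 T, ∀ x, u n (t, x) =
      K.slice (T - t) (K.heatV ζ T n t (G.Phi hφ₁ 1)) x := fun n hn t ht x =>
    (hu.eq_of hA hv hn t ⟨ht.1, ht.2.le⟩ x).trans (congrFun (K.sol_of_lt ζ _ φ n ht.2) x)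
  -- For n = 0 the operator `heatV` is the identity, so u_0 is the slice of the Gaussian integral
  -- and inherits its smoothness.
  have hu₀ : ∀ t ∈ Ico 0 T, (fun x => u 0 (t, x)) = K.slice (T - t) (G.Phi hφ₁ 1) :=
    fun t ht => funext fun x => by
      rw [huv 0 (Nat.zero_le N) t ht x]
      simp [KolmogorovOp.heatV, KolmogorovOp.heatN]
  refine ⟨fun t ht => ?_, fun n hn hnN t ht x => ⟨fun h _ i _ => ?_, ?_⟩⟩
  · rw [hu₀ t ht]
    exact Sm.contDiff _
  · rw [hu₀ t ht]
    exact K.continuous_prodG_slice ζ hA.symm hB ht.2 i _ x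
  · rw [hu₀ t ht, huv n hnN t ht x, K.opL_slice ζ hA.symm hB ht.2 hn]
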